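/- Fix an integer $d\ge 2$. The random $d$-process on $n$ labelled vertices starts with the empty graph and, at each step, adds one edge chosen uniformly at random from all pairs of distinct, non-adjacent vertices both of which currently have degree less than $d$; it stops when no such pair exists, which happens after at most $\lfloor dn/2\rfloor$ steps. The process saturates if its final graph either is $d$-regular or has $n-1$ vertices of degree $d$ and one vertex of degree $d-1$. Let $F=F(n,d)$ be the event that the process fails to saturate. Then, as $n\to\infty$ with $d$ fixed, $$\mathbb P(F)\sim\begin{cases}\dfrac{d-1}{\log n}&\text{when } dn \text{ is even},\\[2mm] \dfrac{(d-1)(d-2)}{\log^2 n}&\text{when } dn\text{ is odd},\end{cases}$$ where $\log$ is the natural logarithm and $\log^2 n=(\log n)^2$. -/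

import Mathlib

open Filter Asymptotics

/-- The pairs that may be added to `G` in the `d`-process: pairs of distinct vertices which are
not yet edges of `G` and whose two members both have degree less than `d` in `G`. -/
noncomputable def availablePairs {V : Type*} [Fintype V] (d : ℕ) (G : SimpleGraph V) :
    Finset (Sym2 V) :=
  open Classical in
  Finset.univ.filter fun e => ¬ e.IsDiag ∧ e ∉ G.edgeSet ∧ ∀ v ∈ e, G.degree v < d

/-- One step of the `d`-process from the graph `G`: add an available pair chosen uniformly at
random; if there is none, the process is stuck and stays at `G`. -/
noncomputable def dProcessStep {V : Type*} [Fintype V] (d : ℕ) (G : SimpleGraph V) :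
    PMF (SimpleGraph V) :=
  open Classical in
  if h : (availablePairs d G).Nonempty then
    (PMF.uniformOfFinset (availablePairs d G) h).map fun e => G ⊔ SimpleGraph.fromEdgeSet {e}
  else PMF.pure G

/-- The law of the graph of the `d`-process on the vertex set `V` after `s` steps, starting from
the empty graph. -/
noncomputable def dProcessLaw (V : Type*) [Fintype V] (d : ℕ) : ℕ → PMF (SimpleGraph V)
  | 0 => PMF.pure ⊥
  | s + 1 => (dProcessLaw V d s).bind (dProcessStep d)

/-- The law of the final graph of the `d`-process on `n` vertices. All degrees stay at most `d`,
so at most `⌊d * n / 2⌋` edges are ever added, and after that many steps the process is stuck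
(this is proved in `availablePairs_eq_empty_of_mem_support`). -/
noncomputable def finalGraphLaw (n d : ℕ) : PMF (SimpleGraph (Fin n)) :=
  dProcessLaw (Fin n) d (d * n / 2)

open Classical in
/-- A final graph is saturated if it is `d`-regular, or if one vertex has degree `d - 1` and all
the others have degree `d`. -/
def IsSaturated {V : Type*} [Fintype V] (d : ℕ) (G : SimpleGraph V) : Prop :=
  G.IsRegularOfDegree d ∨ ∃ v, G.degree v + 1 = d ∧ ∀ w, w ≠ v → G.degree w = d

/-- The probability that the `d`-process on `n` vertices fails to saturate (there are finitely many
graphs on `Fin n`, and every set of them is an event). -/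
noncomputable def probNotSaturated (n d : ℕ) : ℝ :=
  (@PMF.toMeasure _ ⊤ (finalGraphLaw n d) {G | ¬ IsSaturated d G}).toReal

open Classical in
/-- As long as the process is not stuck, it has one edge per step, and degrees at most `d`. -/
theorem dProcessLaw_support {V : Type*} [Fintype V] (d s : ℕ) :
    ∀ G ∈ (dProcessLaw V d s).support, (∀ v, G.degree v ≤ d) ∧
      (availablePairs d G = ∅ ∨ G.edgeFinset.card = s) := by
  induction s with
  | zero =>
    intro G hG
    simp only [dProcessLaw, PMF.support_pure, Set.mem_singleton_iff] at hG
    subst hG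
    refine ⟨fun v => by simp, Or.inr (by simp)⟩
  | succ s ih =>
    intro G hG
    simp only [dProcessLaw, PMF.mem_support_bind_iff] at hG
    obtain ⟨H, hH, hG⟩ := hG
    obtain ⟨hdeg, hst⟩ := ih H hH
    unfold dProcessStep at hG
    split_ifs at hG with h
    · rw [PMF.mem_support_map_iff] at hG
      obtain ⟨e, he, rfl⟩ := hG
      rw [PMF.mem_support_uniformOfFinset_iff] at he
      have he' := he
      simp only [availablePairs, Finset.mem_filter, Finset.mem_univ, true_and] at he'
      obtain ⟨hd, hne, hlt⟩ := he'
      have hcard : H.edgeFinset.card = s := by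
        rcases hst with h0 | h0
        · simp [h0] at he
        · exact h0
      constructor
      · intro v
        induction e with | _ a b =>
        have hsub : (H ⊔ SimpleGraph.fromEdgeSet {s(a, b)}).neighborFinset v ⊆
            H.neighborFinset v ∪ (if v = a then {b} else if v = b then {a} else ∅) := by
          intro w hw
          simp only [SimpleGraph.mem_neighborFinset, SimpleGraph.sup_adj,
            SimpleGraph.fromEdgeSet_adj, Set.mem_singleton_iff, Sym2.eq_iff] at hw
          simp only [Finset.mem_union, SimpleGraph.mem_neighborFinset]
          split_ifs <;> simp <;> grind
        rw [← SimpleGraph.card_neighborFinset_eq_degree]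
        suffices hs : (H.neighborFinset v ∪
            (if v = a then {b} else if v = b then {a} else ∅)).card ≤ d by
          refine le_trans (le_of_eq ?_) ((Finset.card_le_card hsub).trans hs)
          congr!
        refine (Finset.card_union_le _ _).trans ?_
        rw [SimpleGraph.card_neighborFinset_eq_degree]
        have h1 := hlt a (by simp)
        have h2 := hlt b (by simp)
        split_ifs with hva hvb
        · subst hva; simp; omega
        · subst hvb; simp; omega
        · simpa using hdeg v
      · right
        have : (H ⊔ SimpleGraph.fromEdgeSet {e}).edgeFinset = insert e H.edgeFinset := by
          ext x
          simp only [SimpleGraph.mem_edgeFinset, SimpleGraph.edgeSet_sup,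
            SimpleGraph.edgeSet_fromEdgeSet, Finset.mem_insert, Set.mem_union, Set.mem_sdiff,
            Set.mem_singleton_iff]
          constructor
          · rintro (h | h)
            · exact Or.inr h
            · exact Or.inl h.1
          · rintro (h | h)
            · subst h; exact Or.inr ⟨rfl, by simpa using hd⟩
            · exact Or.inl h
        have h2 := congrArg Finset.card this
        rw [Finset.card_insert_of_notMem (by simpa using hne), hcard] at h2
        rw [← h2]
        congr!
    · simp only [PMF.support_pure, Set.mem_singleton_iff] at hG
      subst hG
      exact ⟨hdeg, Or.inl (Finset.not_nonempty_iff_eq_empty.mp h)⟩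

/-- After `⌊d * n / 2⌋` steps the process is stuck, so that `finalGraphLaw` is indeed the law of
the final graph. -/
theorem availablePairs_eq_empty_of_mem_support (n d : ℕ) (G : SimpleGraph (Fin n))
    (hG : G ∈ (finalGraphLaw n d).support) : availablePairs d G = ∅ := by
  classical
  obtain ⟨hdeg, h | h⟩ := dProcessLaw_support d (d * n / 2) G hG
  · exact h
  · by_contra hne
    obtain ⟨e, he⟩ := Finset.nonempty_iff_ne_empty.mpr hne
    simp only [availablePairs, Finset.mem_filter, Finset.mem_univ, true_and] at he
    obtain ⟨hd, hn, hlt⟩ := he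
    induction e with | _ a b =>
    have hab : a ≠ b := by simpa using hd
    have hsum := G.sum_degrees_eq_twice_card_edges
    have ha := hlt a (by simp)
    have hb := hlt b (by simp)
    have hle : ∑ v, (G.degree v + if v = a ∨ v = b then 1 else 0) ≤ ∑ _v : Fin n, d := by
      refine Finset.sum_le_sum fun v _ => ?_
      split_ifs with hv
      · rcases hv with rfl | rfl <;> convert Nat.succ_le_of_lt (by assumption)
      · rw [add_zero]
        refine le_trans (le_of_eq ?_) (hdeg v)
        congr!
    have h2 : ∑ v : Fin n, (if v = a ∨ v = b then 1 else 0) = 2 := by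
      rw [← Finset.card_filter]
      have : Finset.univ.filter (fun v : Fin n => v = a ∨ v = b) = {a, b} := by
        ext; simp
      rw [this, Finset.card_pair hab]
    rw [Finset.sum_add_distrib, h2, Finset.sum_const, Finset.card_univ, Fintype.card_fin,
      smul_eq_mul, mul_comm n d] at hle
    have h3 : G.edgeFinset.card = d * n / 2 := by convert h
    have h4 : ∑ v, G.degree v = 2 * (d * n / 2) := by rw [← h3]; convert hsum
    omega

/-! Write `b = log n`, let the deficit of a vertex be `d - deg`, and let `k = 2` if `d n` is even
and `k = 3` if it is odd. Let `N_k` be the number of vertices of deficit at least `k`, `u` the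
number of unsaturated vertices, and `D` the sum of all deficits. As long as `D` is not bounded it is
deterministic, `D = d n - 2 s`, and it keeps the parity of `d n`; so failure leaves a total deficit
of at least `k`. The dominant way to fail is that one vertex of deficit `k` is never chosen again
while all the other unsaturated vertices, each of deficit 1, are used up. The probability of this is
governed by the expectation of `N_k`, which is followed through three stages.

Early stage, down to `D` about `exp √(log n)`. The degree sequence is compared with balls thrown
into bins of capacity `d`; by `expect_degreeIndicator_le` this costs only a factor polynomial in
`n`. In continuous time the loads of the bins are independent truncated Poisson variables, so the
degree counts concentrate outside an event of superpolynomially small probability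
(`expect_not_isTypical_le`). Since `D = n ^ o(1)`, the Poisson time is asymptotic to `log n`, and
the number of vertices of degree `j` is about `D * (d-1)! / j! * b ^ (-(d-1-j))`
(`tendsto_typical`). Hence `N_k / D` is about `κ * b ^ (-(k-1))` with `κ = (d-1)! / (d-k)!`.

Middle stage, from there down to a large constant `D = K`. One step lowers `N_k` by about `2 N_k /
D` on average while `D` drops by 2, so `E N_k / D` is almost conserved (`abs_density_sub_le`). The
relative errors of order `1 / D ^ 2` and `1 / (b D)` add up to `O(1 / K + log D₀ / b)`, where `D₀`
is the deficit at the start of this stage, and `log D₀`, about `√(log n)`, is negligible against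
`b`. The a priori bounds on `E N_(k+1)` and `E (N_2 N_k)` come from weighting a set `S` of
unsaturated vertices by `b ^ (-cut S)`; the total weight of the `m`-sets, divided by `D ^ m`, is
nearly a supermartingale (`expect_sumCutWeight_le`).

End stage, from `D = K`. The excess is the sum of `deficit - 1` over the unsaturated vertices plus
twice the number of edges among them. The same weights show that it is at least `k` with probability
`O(b ^ (-k))`. If it is smaller than `k`, then either there is no vertex of deficit at least `k` and
the process surely saturates, or there is exactly one, all else is generic, and failure has
probability exactly `1 / u = 1 / (K - k + 1)` (`IsCritical.iterate_stepExp_failure`). So the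
probability of failure is `E N_k / (K - k + 1) + O(b ^ (-k))`; letting `n` and then `K` tend to
infinity gives `κ / b ^ (k-1)`. -/

section
open Classical

namespace DegreeBounded

variable {V : Type*} [Fintype V]

/-! ### Expectations of finitely supported random variables -/

theorem sum_toReal_bind {α β : Type*} [Fintype α] [Fintype β] (p : PMF α) (q : α → PMF β)
    (f : β → ℝ) :
    ∑ b, ((p.bind q) b).toReal * f b = ∑ a, (p a).toReal * ∑ b, (q a b).toReal * f b := by
  have h : ∀ b, ((p.bind q) b).toReal = ∑ a, (p a).toReal * (q a b).toReal := by
    intro b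
    rw [PMF.bind_apply, tsum_fintype, ENNReal.toReal_sum]
    · simp [ENNReal.toReal_mul]
    · intro a _
      exact ENNReal.mul_ne_top (PMF.apply_ne_top _ _) (PMF.apply_ne_top _ _)
  simp_rw [h, Finset.sum_mul, Finset.mul_sum]
  rw [Finset.sum_comm]
  simp_rw [mul_assoc]

theorem sum_toReal_pure {α : Type*} [Fintype α] (a : α) (f : α → ℝ) :
    ∑ b, (PMF.pure a b).toReal * f b = f a := by
  simp [PMF.pure_apply, apply_ite ENNReal.toReal]

theorem sum_toReal_map {α β : Type*} [Fintype α] [Fintype β] (p : PMF α) (g : α → β)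
    (f : β → ℝ) :
    ∑ b, ((p.map g) b).toReal * f b = ∑ a, (p a).toReal * f (g a) := by
  rw [← PMF.bind_pure_comp, sum_toReal_bind]
  exact Finset.sum_congr rfl fun a _ => congrArg _ (sum_toReal_pure (g a) f)

theorem sum_toReal_uniformOfFinset {α : Type*} [Fintype α] (s : Finset α) (hs : s.Nonempty)
    (f : α → ℝ) :
    ∑ a, (PMF.uniformOfFinset s hs a).toReal * f a = (∑ a ∈ s, f a) / s.card := by
  simp only [PMF.uniformOfFinset_apply, apply_ite ENNReal.toReal, ENNReal.toReal_inv,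
    ENNReal.toReal_natCast, ENNReal.toReal_zero, ite_mul, zero_mul]
  rw [← Finset.sum_filter]
  simp [div_eq_inv_mul, Finset.mul_sum]

/-! ### The process in terms of ordered pairs -/

/-- The vertices of degree less than `d`. -/
noncomputable def unsat (d : ℕ) (G : SimpleGraph V) : Finset V :=
  Finset.univ.filter fun v => G.degree v < d

/-- The ordered pairs of distinct, non-adjacent vertices of degree less than `d`. -/
noncomputable def openPairs (d : ℕ) (G : SimpleGraph V) : Finset (V × V) :=
  Finset.univ.filter fun p => p.1 ≠ p.2 ∧ ¬ G.Adj p.1 p.2 ∧ p.1 ∈ unsat d G ∧ p.2 ∈ unsat d G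

/-- The graph `G` with the edge `p` added. -/
def addEdge (G : SimpleGraph V) (p : V × V) : SimpleGraph V :=
  G ⊔ SimpleGraph.fromEdgeSet {s(p.1, p.2)}

/-- The expectation of `f` after one step of the process from `G`. -/
noncomputable def stepExp (d : ℕ) (f : SimpleGraph V → ℝ) (G : SimpleGraph V) : ℝ :=
  if (openPairs d G).Nonempty then
    (∑ p ∈ openPairs d G, f (addEdge G p)) / (openPairs d G).card
  else f G

/-- The expectation of `f` after `s` steps of the process. -/
noncomputable def expect (d s : ℕ) (f : SimpleGraph V → ℝ) : ℝ :=
  ∑ G, (dProcessLaw V d s G).toReal * f G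

theorem mem_unsat {d : ℕ} {G : SimpleGraph V} {v : V} : v ∈ unsat d G ↔ G.degree v < d := by
  simp [unsat]

theorem mem_openPairs {d : ℕ} {G : SimpleGraph V} {p : V × V} :
    p ∈ openPairs d G ↔ p.1 ≠ p.2 ∧ ¬ G.Adj p.1 p.2 ∧ p.1 ∈ unsat d G ∧ p.2 ∈ unsat d G := by
  simp [openPairs]

theorem mem_availablePairs {d : ℕ} {G : SimpleGraph V} {a b : V} :
    s(a, b) ∈ availablePairs d G ↔ (a, b) ∈ openPairs d G := by
  simp [availablePairs, mem_openPairs, mem_unsat]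

/-- Every available pair has exactly two orientations, so choosing a uniform ordered pair gives the
same step. Ordered pairs are convenient because their number is a sum over the first vertex. -/
theorem sum_openPairs {d : ℕ} (G : SimpleGraph V) (f : Sym2 V → ℝ) :
    ∑ p ∈ openPairs d G, f s(p.1, p.2) = 2 * ∑ e ∈ availablePairs d G, f e := by
  have hmaps : ∀ p ∈ openPairs d G, s(p.1, p.2) ∈ availablePairs d G :=
    fun p hp => mem_availablePairs.mpr hp
  rw [← Finset.sum_fiberwise_of_maps_to hmaps, Finset.mul_sum]
  refine Finset.sum_congr rfl fun e he => ?_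
  induction e with | _ a b =>
  have hab := mem_availablePairs.mp he
  have hne : a ≠ b := (mem_openPairs.mp hab).1
  have hfil : (openPairs d G).filter (fun p => s(p.1, p.2) = s(a, b)) = {(a, b), (b, a)} := by
    ext ⟨x, y⟩
    simp only [Finset.mem_filter, Sym2.eq_iff, Finset.mem_insert, Finset.mem_singleton,
      Prod.mk.injEq]
    constructor
    · exact fun h => h.2
    · rintro (⟨rfl, rfl⟩ | ⟨rfl, rfl⟩)
      · exact ⟨hab, Or.inl ⟨rfl, rfl⟩⟩
      · refine ⟨?_, Or.inr ⟨rfl, rfl⟩⟩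
        rw [← mem_availablePairs, Sym2.eq_swap, mem_availablePairs]
        exact hab
  rw [hfil, Finset.sum_pair (by simpa using fun h _ => hne h)]
  simp only [Sym2.eq_swap (a := b)]
  ring

theorem openPairs_nonempty_iff {d : ℕ} {G : SimpleGraph V} :
    (openPairs d G).Nonempty ↔ (availablePairs d G).Nonempty := by
  constructor
  · rintro ⟨p, hp⟩
    exact ⟨s(p.1, p.2), mem_availablePairs.mpr hp⟩
  · rintro ⟨e, he⟩
    induction e with | _ a b =>
    exact ⟨_, mem_availablePairs.mp he⟩

theorem card_openPairs_eq {d : ℕ} (G : SimpleGraph V) :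
    ((openPairs d G).card : ℝ) = 2 * (availablePairs d G).card := by
  simpa using sum_openPairs (d := d) G fun _ => 1

theorem sum_dProcessStep (d : ℕ) (f : SimpleGraph V → ℝ) (G : SimpleGraph V) :
    ∑ H, (dProcessStep d G H).toReal * f H = stepExp d f G := by
  unfold dProcessStep stepExp
  by_cases h : (availablePairs d G).Nonempty
  · rw [dif_pos h, if_pos (openPairs_nonempty_iff.mpr h)]
    rw [sum_toReal_map, sum_toReal_uniformOfFinset, card_openPairs_eq]
    have := sum_openPairs (d := d) G fun e => f (G ⊔ SimpleGraph.fromEdgeSet {e})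
    simp only [addEdge]
    rw [this, mul_div_mul_left _ _ two_ne_zero]
  · rw [dif_neg h, if_neg (by rwa [openPairs_nonempty_iff])]
    exact sum_toReal_pure _ _

theorem expect_zero (d : ℕ) (f : SimpleGraph V → ℝ) : expect d 0 f = f ⊥ := by
  simp only [expect, dProcessLaw]
  exact sum_toReal_pure _ _

theorem expect_succ (d s : ℕ) (f : SimpleGraph V → ℝ) :
    expect d (s + 1) f = expect d s (stepExp d f) := by
  simp only [expect, dProcessLaw, sum_toReal_bind, sum_dProcessStep]

theorem expect_add (d s r : ℕ) (f : SimpleGraph V → ℝ) :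
    expect d (s + r) f = expect d s ((stepExp d)^[r] f) := by
  induction r generalizing f with
  | zero => rfl
  | succ r ih => rw [← add_assoc, expect_succ, ih, Function.iterate_succ_apply]

theorem expect_const (d s : ℕ) (c : ℝ) : expect d s (fun _ : SimpleGraph V => c) = c := by
  induction s with
  | zero => rw [expect_zero]
  | succ s ih =>
    rw [expect_succ]
    convert ih using 2
    ext G
    unfold stepExp
    split_ifs with h
    · rw [Finset.sum_const, nsmul_eq_mul, mul_div_cancel_left₀]
      exact_mod_cast h.card_pos.ne'
    · rfl

theorem expect_mono {d s : ℕ} {f g : SimpleGraph V → ℝ}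
    (h : ∀ G ∈ (dProcessLaw V d s).support, f G ≤ g G) : expect d s f ≤ expect d s g := by
  refine Finset.sum_le_sum fun G _ => ?_
  by_cases hG : dProcessLaw V d s G = 0
  · simp [hG]
  · exact mul_le_mul_of_nonneg_left (h G ((PMF.mem_support_iff _ _).mpr hG))
      ENNReal.toReal_nonneg

theorem expect_nonneg {d s : ℕ} {f : SimpleGraph V → ℝ}
    (h : ∀ G ∈ (dProcessLaw V d s).support, 0 ≤ f G) : 0 ≤ expect d s f := by
  have := expect_mono (d := d) (s := s) (f := fun _ => 0) (g := f) h
  rwa [expect_const] at this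

theorem expect_add_fun (d s : ℕ) (f g : SimpleGraph V → ℝ) :
    expect d s (fun G => f G + g G) = expect d s f + expect d s g := by
  simp [expect, mul_add, Finset.sum_add_distrib]

theorem expect_sub_fun (d s : ℕ) (f g : SimpleGraph V → ℝ) :
    expect d s (fun G => f G - g G) = expect d s f - expect d s g := by
  simp [expect, mul_sub, Finset.sum_sub_distrib]

theorem expect_const_mul (d s : ℕ) (c : ℝ) (f : SimpleGraph V → ℝ) :
    expect d s (fun G => c * f G) = c * expect d s f := by
  simp [expect, Finset.mul_sum, mul_left_comm]

theorem expect_sum {ι : Type*} (d s : ℕ) (I : Finset ι) (f : ι → SimpleGraph V → ℝ) :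
    expect d s (fun G => ∑ i ∈ I, f i G) = ∑ i ∈ I, expect d s (f i) := by
  simp only [expect, Finset.mul_sum]
  exact Finset.sum_comm

theorem abs_expect_le {d s : ℕ} {f g : SimpleGraph V → ℝ}
    (h : ∀ G ∈ (dProcessLaw V d s).support, |f G| ≤ g G) : |expect d s f| ≤ expect d s g := by
  rw [abs_le]
  refine ⟨?_, expect_mono fun G hG => (abs_le.mp (h G hG)).2⟩
  have := expect_mono (d := d) (s := s) (f := fun G => -1 * g G) (g := f)
    fun G hG => by linarith [(abs_le.mp (h G hG)).1]
  rw [expect_const_mul] at this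
  linarith

theorem probNotSaturated_eq (n d : ℕ) :
    probNotSaturated n d =
      expect d (d * n / 2) fun G : SimpleGraph (Fin n) => if IsSaturated d G then 0 else 1 := by
  unfold probNotSaturated finalGraphLaw expect
  let _ : MeasurableSpace (SimpleGraph (Fin n)) := ⊤
  rw [PMF.toMeasure_apply_eq_toOuterMeasure_apply _ MeasurableSpace.measurableSet_top,
    PMF.toOuterMeasure_apply_fintype, ENNReal.toReal_sum]
  · refine Finset.sum_congr (by congr!) fun G _ => ?_
    by_cases h : IsSaturated d G <;> simp [Set.indicator, h]
  · intro G _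
    by_cases h : IsSaturated d G <;> simp [Set.indicator, h, PMF.apply_ne_top]

/-! ### Adding an edge -/

theorem addEdge_adj {G : SimpleGraph V} {p : V × V} {x y : V} :
    (addEdge G p).Adj x y ↔
      G.Adj x y ∨ (((x = p.1 ∧ y = p.2) ∨ (x = p.2 ∧ y = p.1)) ∧ x ≠ y) := by
  simp only [addEdge, SimpleGraph.sup_adj, SimpleGraph.fromEdgeSet_adj, Set.mem_singleton_iff,
    Sym2.eq_iff]

theorem degree_addEdge {d : ℕ} {G : SimpleGraph V} {p : V × V} (hp : p ∈ openPairs d G) (v : V) :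
    (addEdge G p).degree v = G.degree v + if v = p.1 ∨ v = p.2 then 1 else 0 := by
  obtain ⟨a, b⟩ := p
  obtain ⟨hne, hadj, -, -⟩ := mem_openPairs.mp hp
  simp only at hne hadj
  have key : (addEdge G (a, b)).neighborFinset v = G.neighborFinset v ∪
      (if v = a then {b} else if v = b then {a} else ∅) := by
    ext w
    simp only [SimpleGraph.mem_neighborFinset, addEdge_adj, Finset.mem_union]
    split_ifs with h1 h2
    · subst h1; simp only [Finset.mem_singleton]; grind
    · subst h2; simp only [Finset.mem_singleton]; grind
    · simp; grind
  rw [← SimpleGraph.card_neighborFinset_eq_degree, key, Finset.card_union_of_disjoint,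
    SimpleGraph.card_neighborFinset_eq_degree]
  · split_ifs <;> simp_all
  · split_ifs with h1 h2
    · subst h1; simpa using hadj
    · subst h2; simpa [SimpleGraph.adj_comm] using hadj
    · simp

/-! ### Deficits and the number of open pairs -/

/-- The sum of all deficits `d - deg v`. -/
noncomputable def deficitSum (d : ℕ) (G : SimpleGraph V) : ℕ := ∑ v, (d - G.degree v)

theorem swap_mem_openPairs {d : ℕ} {G : SimpleGraph V} {p : V × V} :
    p.swap ∈ openPairs d G ↔ p ∈ openPairs d G := by
  simp only [mem_openPairs, Prod.fst_swap, Prod.snd_swap, G.adj_comm p.2 p.1]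
  grind

theorem openPairs_eq_empty_or {d : ℕ} (G : SimpleGraph V) :
    openPairs d G = ∅ ∨ (openPairs d G).Nonempty := Finset.eq_empty_or_nonempty _

theorem degree_le_addEdge {d : ℕ} {G : SimpleGraph V} {p : V × V} (hp : p ∈ openPairs d G)
    (v : V) : G.degree v ≤ (addEdge G p).degree v := by
  rw [degree_addEdge hp]; omega

theorem degree_addEdge_le {d : ℕ} {G : SimpleGraph V} {p : V × V} (hp : p ∈ openPairs d G)
    (hG : ∀ v, G.degree v ≤ d) (v : V) : (addEdge G p).degree v ≤ d := by
  rw [degree_addEdge hp]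
  obtain ⟨-, -, h1, h2⟩ := mem_openPairs.mp hp
  rw [mem_unsat] at h1 h2
  split_ifs with h
  · rcases h with rfl | rfl <;> omega
  · simpa using hG v

theorem unsat_addEdge_subset {d : ℕ} {G : SimpleGraph V} {p : V × V} (hp : p ∈ openPairs d G) :
    unsat d (addEdge G p) ⊆ unsat d G := by
  intro v hv
  rw [mem_unsat] at hv ⊢
  exact (degree_le_addEdge hp v).trans_lt hv

theorem sum_ite_pair {p : V × V} (h : p.1 ≠ p.2) :
    ∑ v, (if v = p.1 ∨ v = p.2 then 1 else 0) = 2 := by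
  rw [← Finset.card_filter, show Finset.univ.filter (fun v => v = p.1 ∨ v = p.2) = {p.1, p.2} by
    ext; simp, Finset.card_pair h]

theorem deficitSum_addEdge {d : ℕ} {G : SimpleGraph V} {p : V × V} (hp : p ∈ openPairs d G) :
    deficitSum d (addEdge G p) + 2 = deficitSum d G := by
  obtain ⟨hne, -, h1, h2⟩ := mem_openPairs.mp hp
  rw [mem_unsat] at h1 h2
  unfold deficitSum
  rw [← sum_ite_pair hne, ← Finset.sum_add_distrib]
  refine Finset.sum_congr rfl fun v _ => ?_
  rw [degree_addEdge hp]
  split_ifs with h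
  · rcases h with rfl | rfl <;> omega
  · rfl

theorem deficitSum_eq_sum_unsat (d : ℕ) (G : SimpleGraph V) :
    deficitSum d G = ∑ v ∈ unsat d G, (d - G.degree v) := by
  unfold deficitSum
  symm
  refine Finset.sum_subset (Finset.subset_univ _) fun v _ hv => ?_
  rw [mem_unsat] at hv
  omega

theorem card_unsat_le_deficitSum (d : ℕ) (G : SimpleGraph V) :
    (unsat d G).card ≤ deficitSum d G := by
  rw [deficitSum_eq_sum_unsat, Finset.card_eq_sum_ones]
  refine Finset.sum_le_sum fun v hv => ?_
  rw [mem_unsat] at hv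
  omega

theorem deficitSum_le (d : ℕ) (G : SimpleGraph V) :
    deficitSum d G ≤ d * (unsat d G).card := by
  rw [deficitSum_eq_sum_unsat, mul_comm, ← smul_eq_mul]
  exact Finset.sum_le_card_nsmul _ _ _ fun v _ => Nat.sub_le _ _

/-- The vertices that can be joined to `v`. -/
noncomputable def partners (d : ℕ) (G : SimpleGraph V) (v : V) : Finset V :=
  (unsat d G).filter fun w => v ≠ w ∧ ¬ G.Adj v w

theorem mem_openPairs_iff_partners {d : ℕ} {G : SimpleGraph V} {p : V × V} :
    p ∈ openPairs d G ↔ p.1 ∈ unsat d G ∧ p.2 ∈ partners d G p.1 := by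
  rw [mem_openPairs, partners, Finset.mem_filter]; tauto

theorem card_partners_add_one_le {d : ℕ} {G : SimpleGraph V} {v : V} (hv : v ∈ unsat d G) :
    (partners d G v).card + 1 ≤ (unsat d G).card := by
  apply Finset.card_lt_card
  refine ⟨Finset.filter_subset _ _, fun h => ?_⟩
  have := h hv
  simp [partners] at this

theorem le_card_partners_add {d : ℕ} {G : SimpleGraph V} {v : V} (hv : v ∈ unsat d G) :
    (unsat d G).card ≤ (partners d G v).card + d := by
  have hsub : unsat d G ⊆ partners d G v ∪ insert v (G.neighborFinset v) := by
    intro w hw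
    simp only [partners, Finset.mem_union, Finset.mem_filter, Finset.mem_insert,
      SimpleGraph.mem_neighborFinset]
    by_cases h : v = w
    · right; left; exact h.symm
    · by_cases h' : G.Adj v w
      · right; right; exact h'
      · left; exact ⟨hw, h, h'⟩
  refine (Finset.card_le_card hsub).trans ((Finset.card_union_le _ _).trans ?_)
  have h1 := Finset.card_insert_le v (G.neighborFinset v)
  rw [SimpleGraph.card_neighborFinset_eq_degree] at h1
  have h2 := mem_unsat.mp hv
  omega

theorem card_openPairs_fst {d : ℕ} (G : SimpleGraph V) (P : V → V → Prop)
    [∀ v w, Decidable (P v w)] :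
    ((openPairs d G).filter fun p => P p.1 p.2).card =
      ∑ v ∈ unsat d G, ((partners d G v).filter fun w => P v w).card := by
  rw [← Finset.card_sigma]
  refine Finset.card_bij' (fun p _ => ⟨p.1, p.2⟩) (fun q _ => (q.1, q.2)) ?_ ?_ ?_ ?_
  · rintro ⟨a, b⟩ h
    simpa [mem_openPairs_iff_partners, and_assoc] using h
  · rintro ⟨a, b⟩ h
    simpa [mem_openPairs_iff_partners, and_assoc] using h
  · intros; rfl
  · intros; rfl

theorem card_openPairs_eq_sum {d : ℕ} (G : SimpleGraph V) :
    (openPairs d G).card = ∑ v ∈ unsat d G, (partners d G v).card := by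
  simpa using card_openPairs_fst (d := d) G fun _ _ => True

theorem card_openPairs_swap {d : ℕ} (G : SimpleGraph V) (P : V → V → Prop)
    [∀ v w, Decidable (P v w)] :
    ((openPairs d G).filter fun p => P p.1 p.2).card =
      ((openPairs d G).filter fun p => P p.2 p.1).card := by
  refine Finset.card_bij' (fun p _ => p.swap) (fun p _ => p.swap) ?_ ?_ ?_ ?_
  · intro p h
    simpa [swap_mem_openPairs] using h
  · intro p h
    simpa [swap_mem_openPairs] using h
  · intros; simp
  · intros; simp

theorem card_openPairs_le {d : ℕ} (G : SimpleGraph V) :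
    ((openPairs d G).card : ℝ) ≤ (unsat d G).card * ((unsat d G).card - 1) := by
  rw [card_openPairs_eq_sum, Nat.cast_sum, ← nsmul_eq_mul]
  refine Finset.sum_le_card_nsmul _ _ _ fun v hv => ?_
  have : ((partners d G v).card : ℝ) + 1 ≤ (unsat d G).card := by
    exact_mod_cast card_partners_add_one_le hv
  linarith

theorem le_card_openPairs {d : ℕ} (G : SimpleGraph V) :
    ((unsat d G).card : ℝ) * ((unsat d G).card - d) ≤ (openPairs d G).card := by
  rw [card_openPairs_eq_sum, Nat.cast_sum, ← nsmul_eq_mul]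
  refine Finset.card_nsmul_le_sum _ _ _ fun v hv => ?_
  have : ((unsat d G).card : ℝ) ≤ (partners d G v).card + d := by
    exact_mod_cast le_card_partners_add hv
  linarith

theorem openPairs_nonempty_of_lt {d : ℕ} {G : SimpleGraph V} (h : d < (unsat d G).card) :
    (openPairs d G).Nonempty := by
  rw [← Finset.card_pos]
  have h1 := le_card_openPairs (d := d) G
  have h2 : (d : ℝ) < (unsat d G).card := by exact_mod_cast h
  have h3 : (0 : ℝ) ≤ d := by positivity
  have : (0 : ℝ) < (openPairs d G).card := lt_of_lt_of_le (mul_pos (by linarith) (by linarith)) h1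
  exact_mod_cast this

/-- Each unsaturated vertex carries a deficit of at most `d`, so more than `d` of them are left; one
of them has fewer than `d` neighbours and hence a partner among the others. -/
theorem openPairs_nonempty_of_lt_deficitSum {d : ℕ} {G : SimpleGraph V}
    (h : d * d < deficitSum d G) : (openPairs d G).Nonempty := by
  apply openPairs_nonempty_of_lt
  have := deficitSum_le d G
  by_contra h'
  have h2 : d * (unsat d G).card ≤ d * d := Nat.mul_le_mul_left _ (by omega)
  omega

/-! ### One step -/

theorem stepExp_of_nonempty {d : ℕ} {G : SimpleGraph V} (h : (openPairs d G).Nonempty)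
    (f : SimpleGraph V → ℝ) :
    stepExp d f G = (∑ p ∈ openPairs d G, f (addEdge G p)) / (openPairs d G).card := if_pos h

theorem stepExp_of_eq_empty {d : ℕ} {G : SimpleGraph V} (h : openPairs d G = ∅)
    (f : SimpleGraph V → ℝ) : stepExp d f G = f G := by
  unfold stepExp
  rw [if_neg (by simp [h])]

theorem iterate_stepExp_of_eq_empty {d : ℕ} {G : SimpleGraph V} (h : openPairs d G = ∅)
    (f : SimpleGraph V → ℝ) (r : ℕ) : (stepExp d)^[r] f G = f G := by
  induction r generalizing f with
  | zero => rfl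
  | succ r ih => rw [Function.iterate_succ_apply, ih, stepExp_of_eq_empty h]

theorem iterate_stepExp_nonneg_le_one {d : ℕ} {f : SimpleGraph V → ℝ}
    (hf : ∀ G, 0 ≤ f G ∧ f G ≤ 1) (r : ℕ) (G : SimpleGraph V) :
    0 ≤ (stepExp d)^[r] f G ∧ (stepExp d)^[r] f G ≤ 1 := by
  induction r generalizing f with
  | zero => exact hf G
  | succ r ih =>
    rw [Function.iterate_succ_apply]
    refine ih fun H => ?_
    rcases openPairs_eq_empty_or (d := d) H with h | h
    · rw [stepExp_of_eq_empty h]; exact hf H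
    · rw [stepExp_of_nonempty h]
      have hpos : (0 : ℝ) < (openPairs d H).card := by exact_mod_cast h.card_pos
      refine ⟨div_nonneg (Finset.sum_nonneg fun p _ => (hf _).1) hpos.le, ?_⟩
      rw [div_le_one hpos]
      refine (Finset.sum_le_card_nsmul _ _ 1 fun p _ => (hf _).2).trans ?_
      simp

/-! ### Invariants of the process -/

theorem law_induction {d : ℕ} {P : ℕ → SimpleGraph V → Prop} (h0 : P 0 ⊥)
    (hstuck : ∀ s G, P s G → openPairs d G = ∅ → P (s + 1) G)
    (hstep : ∀ s G p, P s G → p ∈ openPairs d G → P (s + 1) (addEdge G p)) (s : ℕ) :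
    ∀ G ∈ (dProcessLaw V d s).support, P s G := by
  induction s with
  | zero =>
    intro G hG
    simp only [dProcessLaw, PMF.support_pure, Set.mem_singleton_iff] at hG
    rwa [hG]
  | succ s ih =>
    intro G hG
    simp only [dProcessLaw, PMF.mem_support_bind_iff] at hG
    obtain ⟨H, hH, hG⟩ := hG
    have hP := ih H hH
    unfold dProcessStep at hG
    split_ifs at hG with h
    · rw [PMF.mem_support_map_iff] at hG
      obtain ⟨e, he, rfl⟩ := hG
      rw [PMF.mem_support_uniformOfFinset_iff] at he
      induction e with | _ a b =>
      exact hstep s H (a, b) hP (mem_availablePairs.mp he)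
    · simp only [PMF.support_pure, Set.mem_singleton_iff] at hG
      subst hG
      refine hstuck s G hP (Finset.not_nonempty_iff_eq_empty.mp ?_)
      rwa [openPairs_nonempty_iff]

theorem law_degree_le {d s : ℕ} {G : SimpleGraph V} (hG : G ∈ (dProcessLaw V d s).support)
    (v : V) : G.degree v ≤ d := by
  refine law_induction (d := d) (P := fun _ G => ∀ v : V, G.degree v ≤ d) ?_ ?_ ?_ s G hG v
  · simp
  · exact fun _ _ h _ => h
  · exact fun s G p h hp => degree_addEdge_le hp h

/-- The hypothesis says that the deficit before step `s` still exceeded `d * d`, so no step so far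
was stuck and each lowered the deficit by exactly 2. This makes the deficit a deterministic clock.
-/
theorem law_deficitSum {d s : ℕ} {G : SimpleGraph V} (hG : G ∈ (dProcessLaw V d s).support)
    (hs : d * d + 2 * s < d * Fintype.card V + 2) :
    deficitSum d G + 2 * s = d * Fintype.card V := by
  revert hs
  refine law_induction (d := d) (P := fun s G => d * d + 2 * s < d * Fintype.card V + 2 →
    deficitSum d G + 2 * s = d * Fintype.card V) ?_ ?_ ?_ s G hG
  · simp [deficitSum, mul_comm]
  · intro s G h hG hs
    have h1 := h (by omega)
    have := openPairs_nonempty_of_lt_deficitSum (d := d) (G := G) (by omega)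
    simp [hG] at this
  · intro s G p h hp hs
    have := deficitSum_addEdge hp
    have := h (by omega)
    omega

/-! ### Cuts -/

/-- The number of edges between `S` and its complement. -/
noncomputable def cut (S : Finset V) (G : SimpleGraph V) : ℕ :=
  ∑ v ∈ S, ((G.neighborFinset v).filter fun w => w ∉ S).card

theorem cut_addEdge {d : ℕ} {G : SimpleGraph V} {p : V × V} (hp : p ∈ openPairs d G)
    (S : Finset V) : cut S (addEdge G p) =
      cut S G + if (p.1 ∈ S ∧ p.2 ∉ S) ∨ (p.2 ∈ S ∧ p.1 ∉ S) then 1 else 0 := by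
  obtain ⟨a, b⟩ := p
  obtain ⟨hne, hadj, -, -⟩ := mem_openPairs.mp hp
  simp only at hne hadj ⊢
  have key : ∀ v ∈ S, (((addEdge G (a, b)).neighborFinset v).filter fun w => w ∉ S).card =
      ((G.neighborFinset v).filter fun w => w ∉ S).card +
      ((if v = a ∧ b ∉ S then 1 else 0) + if v = b ∧ a ∉ S then 1 else 0) := by
    intro v hv
    have : ((addEdge G (a, b)).neighborFinset v).filter (fun w => w ∉ S) =
        (G.neighborFinset v).filter (fun w => w ∉ S) ∪
          ((if v = a ∧ b ∉ S then {b} else ∅) ∪ if v = b ∧ a ∉ S then {a} else ∅) := by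
      ext w
      simp only [SimpleGraph.mem_neighborFinset, addEdge_adj, Finset.mem_union, Finset.mem_filter]
      split_ifs <;> simp <;> grind
    have hadj' : ¬ G.Adj b a := fun h => hadj h.symm
    rw [this, Finset.card_union_of_disjoint, Finset.card_union_of_disjoint]
    · split_ifs <;> simp
    · split_ifs <;> simp <;> grind
    · split_ifs with h1 h2 h2 <;> simp <;> grind
  unfold cut
  rw [Finset.sum_congr rfl key, Finset.sum_add_distrib, Finset.sum_add_distrib]
  congr 1
  by_cases ha : a ∈ S <;> by_cases hb : b ∈ S <;> simp [ha, hb, Finset.sum_ite_eq']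

theorem cut_le_sum_degree (S : Finset V) (G : SimpleGraph V) :
    cut S G ≤ ∑ v ∈ S, G.degree v :=
  Finset.sum_le_sum fun _ _ => (Finset.card_filter_le _ _).trans
    (SimpleGraph.card_neighborFinset_eq_degree _ _).le

theorem sum_degree_eq_cut_add (S : Finset V) (G : SimpleGraph V) :
    ∑ v ∈ S, G.degree v = cut S G + ∑ v ∈ S, ((G.neighborFinset v).filter fun w => w ∈ S).card := by
  unfold cut
  rw [← Finset.sum_add_distrib]
  refine Finset.sum_congr rfl fun v _ => ?_
  rw [← SimpleGraph.card_neighborFinset_eq_degree, add_comm,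
    Finset.card_filter_add_card_filter_not]

/-! ### Discrete Gronwall inequalities -/

theorem two_div_le_log_sub_log {D : ℝ} (hD : 4 ≤ D) :
    2 / D ≤ Real.log D - Real.log (D - 2) := by
  rw [← Real.log_div (by linarith) (by linarith)]
  have h := Real.one_sub_inv_le_log_of_pos (x := D / (D - 2)) (div_pos (by linarith) (by linarith))
  refine le_trans (le_of_eq ?_) h
  have : D - 2 ≠ 0 := by linarith
  field_simp
  ring

theorem two_div_sq_le_inv_sub_inv {D : ℝ} (hD : 4 ≤ D) :
    2 / D ^ 2 ≤ 1 / (D - 2) - 1 / D := by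
  have h1 : 0 < D - 2 := by linarith
  have : 1 / (D - 2) - 1 / D = 2 / (D * (D - 2)) := by
    field_simp
    ring
  rw [this]
  apply div_le_div_of_nonneg_left (by norm_num) (by nlinarith) (by nlinarith)

/-- With `D = M - 2 * s` falling by 2 per step, errors `1 / D ^ 2` and `1 / D` are dominated by the
increments of `1 / D` and `-log D`, and these telescope. -/
theorem abs_sub_le_of_step {a : ℕ → ℝ} {M C₁ C₂ : ℝ} {s₀ s₁ : ℕ} (hs : s₀ ≤ s₁)
    (hM : 2 ≤ M - 2 * s₁) (hC₁ : 0 ≤ C₁) (hC₂ : 0 ≤ C₂)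
    (h : ∀ s, s₀ ≤ s → s < s₁ →
      |a (s + 1) - a s| ≤ C₁ / (M - 2 * s) ^ 2 + C₂ / (M - 2 * s)) :
    |a s₁ - a s₀| ≤ C₁ / (M - 2 * s₁) + C₂ * Real.log (M - 2 * s₀) := by
  have key : ∀ s, s₀ ≤ s → s ≤ s₁ → |a s - a s₀| ≤
      C₁ / (M - 2 * s) - C₁ / (M - 2 * s₀) +
        C₂ * (Real.log (M - 2 * s₀) - Real.log (M - 2 * s)) := by
    intro s h0
    induction s, h0 using Nat.le_induction with
    | base => intro _; simp
    | succ s h0 ih =>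
      intro h1
      have hlt : (s : ℝ) + 1 ≤ s₁ := by exact_mod_cast h1
      have hD : 4 ≤ M - 2 * s := by linarith
      have e : M - 2 * ((s + 1 : ℕ) : ℝ) = (M - 2 * s) - 2 := by push_cast; ring
      rw [e]
      set D := M - 2 * (s : ℝ)
      have i1 := ih (by omega)
      have i2 := h s h0 (by omega)
      have i3 := mul_le_mul_of_nonneg_left (two_div_sq_le_inv_sub_inv hD) hC₁
      have i4 := mul_le_mul_of_nonneg_left (two_div_le_log_sub_log hD) hC₂
      have i5 : C₁ / D ^ 2 ≤ C₁ * (2 / D ^ 2) := by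
        rw [mul_div_assoc', mul_comm C₁ 2, mul_div_assoc]
        have : 0 ≤ C₁ / D ^ 2 := by positivity
        linarith
      have i6 : C₂ / D ≤ C₂ * (2 / D) := by
        rw [mul_div_assoc', mul_comm C₂ 2, mul_div_assoc]
        have : 0 ≤ C₂ / D := div_nonneg hC₂ (by linarith)
        linarith
      have i7 : a (s + 1) - a s₀ = (a (s + 1) - a s) + (a s - a s₀) := by ring
      rw [i7]
      refine (abs_add_le _ _).trans ?_
      have i8 : C₁ * (1 / (D - 2) - 1 / D) = C₁ / (D - 2) - C₁ / D := by ring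
      linarith
  have h1 := key s₁ hs le_rfl
  have hs' : (s₀ : ℝ) ≤ s₁ := by exact_mod_cast hs
  have h2 : 0 ≤ C₁ / (M - 2 * s₀) := div_nonneg hC₁ (by linarith)
  have h3 : 0 ≤ C₂ * Real.log (M - 2 * s₁) := mul_nonneg hC₂ (Real.log_nonneg (by linarith))
  linarith

/-- The main factor `1 - 2 m / D` is at most `((D - 2) / D) ^ m`, which is exactly how `D ^ m`
shrinks. The remaining errors multiply to a constant: `1 / D ^ 2` is summable, and the sum of `1 /
(b D)` is at most about `log D₀ / b ≤ 1`, where `D₀ = M - 2 * s₀`. -/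
theorem le_mul_of_step {y : ℕ → ℝ} {M C b : ℝ} {m s₀ s₁ : ℕ} (hs : s₀ ≤ s₁)
    (hM : 2 ≤ M - 2 * s₁) (hC : 0 ≤ C) (hb : 0 < b) (hbM : Real.log (M - 2 * s₀) ≤ b)
    (hy : ∀ s, 0 ≤ y s)
    (h : ∀ s, s₀ ≤ s → s < s₁ → y (s + 1) ≤
      (1 - 2 * m / (M - 2 * s) + C / (M - 2 * s) ^ 2 + C / (b * (M - 2 * s))) * y s) :
    y s₁ / (M - 2 * s₁) ^ m ≤ Real.exp (2 ^ m * C) * (y s₀ / (M - 2 * s₀) ^ m) := by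
  -- `P` is the potential whose increment over a step absorbs `2 ^ m * ξ`. The division by 2 matches
  -- the increments `2 / D ^ 2` and `2 / D`; the factor `2 ^ m` pays for pulling `((D - 2) / D) ^
  -- m`, at least `2 ^ (-m)` as `D ≥ 4`, out of the error term.
  set B : ℝ := 2 ^ m * C / 2 with hB
  have hB0 : 0 ≤ B := by positivity
  set P : ℝ → ℝ := fun D => B / D - B / b * Real.log D with hP
  have key : ∀ s, s₀ ≤ s → s ≤ s₁ → y s / (M - 2 * s) ^ m ≤
      Real.exp (P (M - 2 * s) - P (M - 2 * s₀)) * (y s₀ / (M - 2 * s₀) ^ m) := by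
    intro s h0
    induction s, h0 using Nat.le_induction with
    | base => intro _; simp
    | succ s h0 ih =>
      intro h1
      have hlt : (s : ℝ) + 1 ≤ s₁ := by exact_mod_cast h1
      have hD : 4 ≤ M - 2 * s := by linarith
      have e : M - 2 * ((s + 1 : ℕ) : ℝ) = (M - 2 * s) - 2 := by push_cast; ring
      rw [e]
      have i1 := ih (by omega)
      have i2 := h s h0 (by omega)
      set D := M - 2 * (s : ℝ)
      have hD0 : 0 < D := by linarith
      have hD2 : 0 < D - 2 := by linarith
      set ξ := C / D ^ 2 + C / (b * D) with hξ
      have hξ0 : 0 ≤ ξ := by positivity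
      have bern : 1 - 2 * m / D ≤ ((D - 2) / D) ^ m := by
        have := one_add_mul_le_pow (a := -(2 / D)) (by
          have : 2 / D ≤ 1 := by rw [div_le_one hD0]; linarith
          linarith) m
        calc 1 - 2 * m / D = 1 + m * -(2 / D) := by ring
          _ ≤ _ := this
          _ = _ := by congr 1; field_simp; ring
      have half : (1 : ℝ) ≤ 2 ^ m * ((D - 2) / D) ^ m := by
        rw [← mul_pow]
        apply one_le_pow₀
        rw [mul_div_assoc', le_div_iff₀ hD0]
        linarith
      have hPd : 2 ^ m * ξ ≤ P (D - 2) - P D := by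
        have j1 := mul_le_mul_of_nonneg_left (two_div_sq_le_inv_sub_inv hD) hB0
        have j2 := mul_le_mul_of_nonneg_left (two_div_le_log_sub_log hD)
          (div_nonneg hB0 hb.le)
        have j3 : 2 ^ m * ξ = B * (2 / D ^ 2) + B / b * (2 / D) := by
          rw [hξ, hB]; field_simp
        rw [j3, hP]
        have j4 : B * (1 / (D - 2) - 1 / D) = B / (D - 2) - B / D := by ring
        simp only
        linarith
      have i3 : y (s + 1) ≤ ((D - 2) / D) ^ m * Real.exp (P (D - 2) - P D) * y s := by
        refine i2.trans (mul_le_mul_of_nonneg_right ?_ (hy s))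
        have hpos : 0 ≤ ((D - 2) / D) ^ m := by positivity
        calc 1 - 2 * m / D + C / D ^ 2 + C / (b * D) = (1 - 2 * m / D) + ξ := by rw [hξ]; ring
          _ ≤ ((D - 2) / D) ^ m + (2 ^ m * ((D - 2) / D) ^ m) * ξ := by
            refine add_le_add bern (le_mul_of_one_le_left hξ0 half)
          _ = ((D - 2) / D) ^ m * (2 ^ m * ξ + 1) := by ring
          _ ≤ ((D - 2) / D) ^ m * Real.exp (P (D - 2) - P D) := by
            refine mul_le_mul_of_nonneg_left ?_ hpos
            exact (Real.add_one_le_exp _).trans (Real.exp_le_exp.mpr hPd)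
      calc y (s + 1) / (D - 2) ^ m
          ≤ (((D - 2) / D) ^ m * Real.exp (P (D - 2) - P D) * y s) / (D - 2) ^ m := by gcongr
        _ = Real.exp (P (D - 2) - P D) * (y s / D ^ m) := by
            rw [div_pow]; field_simp
        _ ≤ Real.exp (P (D - 2) - P D) * (Real.exp (P D - P (M - 2 * s₀)) *
              (y s₀ / (M - 2 * s₀) ^ m)) := by gcongr
        _ = _ := by rw [← mul_assoc, ← Real.exp_add]; congr 2; ring
  refine (key s₁ hs le_rfl).trans ?_
  have hs' : (s₀ : ℝ) ≤ s₁ := by exact_mod_cast hs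
  have hD0 : 2 ≤ M - 2 * s₀ := by linarith
  refine mul_le_mul_of_nonneg_right (Real.exp_le_exp.mpr ?_)
    (div_nonneg (hy _) (by positivity))
  have j1 : B / (M - 2 * s₁) ≤ B := div_le_self hB0 (by linarith)
  have j2 : 0 ≤ B / (M - 2 * s₀) := by positivity
  have j3 : 0 ≤ B / b * Real.log (M - 2 * s₁) :=
    mul_nonneg (by positivity) (Real.log_nonneg (by linarith))
  have j4 : B / b * Real.log (M - 2 * s₀) ≤ B := by
    calc B / b * Real.log (M - 2 * s₀) ≤ B / b * b := by gcongr
      _ = B := by field_simp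
  simp only [hP]
  have : 2 ^ m * C = 2 * B := by rw [hB]; ring
  linarith

/-! ### Weights of sets of unsaturated vertices -/

/-- The weight `b ^ (-cut S G)` if all vertices of `S` are unsaturated, and `0` otherwise. -/
noncomputable def cutWeight (d : ℕ) (b : ℝ) (S : Finset V) (G : SimpleGraph V) : ℝ :=
  if S ⊆ unsat d G then b⁻¹ ^ cut S G else 0

theorem cutWeight_nonneg {d : ℕ} {b : ℝ} (hb : 0 ≤ b) (S : Finset V) (G : SimpleGraph V) :
    0 ≤ cutWeight d b S G := by
  unfold cutWeight
  split_ifs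
  · positivity
  · exact le_rfl

theorem card_crossing_ge {d : ℕ} {G : SimpleGraph V} {S : Finset V} (hS : S ⊆ unsat d G) :
    2 * (S.card : ℝ) * ((unsat d G).card - d - S.card) ≤
      ((openPairs d G).filter fun p => (p.1 ∈ S ∧ p.2 ∉ S) ∨ (p.2 ∈ S ∧ p.1 ∉ S)).card := by
  have hdisj : Disjoint ((openPairs d G).filter fun p => p.1 ∈ S ∧ p.2 ∉ S)
      ((openPairs d G).filter fun p => p.2 ∈ S ∧ p.1 ∉ S) :=
    Finset.disjoint_filter.mpr fun p _ h1 h2 => h2.2 h1.1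
  rw [Finset.filter_or, Finset.card_union_of_disjoint hdisj,
    ← card_openPairs_swap (d := d) G (fun x y => x ∈ S ∧ y ∉ S),
    card_openPairs_fst G (fun x y => x ∈ S ∧ y ∉ S)]
  have h1 : (S.card : ℝ) * ((unsat d G).card - d - S.card) ≤
      ∑ v ∈ unsat d G, (((partners d G v).filter fun w => v ∈ S ∧ w ∉ S).card : ℝ) := by
    refine le_trans ?_ (Finset.sum_le_sum_of_subset_of_nonneg hS fun _ _ _ => by positivity)
    rw [← nsmul_eq_mul]
    refine Finset.card_nsmul_le_sum _ _ _ fun v hv => ?_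
    have h2 := le_card_partners_add (hS hv)
    have h3 : (partners d G v).card ≤
        ((partners d G v).filter fun w => v ∈ S ∧ w ∉ S).card + S.card := by
      rw [← Finset.card_filter_add_card_filter_not (s := partners d G v) (fun w => v ∈ S ∧ w ∉ S)]
      refine Nat.add_le_add_left (Finset.card_le_card fun w hw => ?_) _
      simp only [Finset.mem_filter, hv, true_and, not_not] at hw
      exact hw.2
    have h4 : ((unsat d G).card : ℝ) ≤
        ((partners d G v).filter fun w => v ∈ S ∧ w ∉ S).card + S.card + d := by
      exact_mod_cast h2.trans (by omega)
    linarith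
  push_cast
  linarith

/-- A pair leaving `S` raises the cut by one and multiplies the weight by `b⁻¹`; any other pair
leaves the cut alone. The loss of the whole weight when a vertex of `S` saturates is discarded,
since only an upper bound is needed. -/
theorem sum_cutWeight_addEdge_le {d : ℕ} {b : ℝ} (hb : 1 ≤ b) {G : SimpleGraph V} {S : Finset V}
    (hS : S ⊆ unsat d G) :
    ∑ p ∈ openPairs d G, cutWeight d b S (addEdge G p) ≤
      ((openPairs d G).card - ((openPairs d G).filter fun p =>
        (p.1 ∈ S ∧ p.2 ∉ S) ∨ (p.2 ∈ S ∧ p.1 ∉ S)).card * (1 - b⁻¹)) * cutWeight d b S G := by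
  have hb0 : 0 ≤ b⁻¹ := by positivity
  have h1 : ∀ p ∈ openPairs d G, cutWeight d b S (addEdge G p) ≤
      cutWeight d b S G - (if (p.1 ∈ S ∧ p.2 ∉ S) ∨ (p.2 ∈ S ∧ p.1 ∉ S) then 1 else 0) *
        ((1 - b⁻¹) * cutWeight d b S G) := by
    intro p hp
    have h2 : cutWeight d b S (addEdge G p) ≤ b⁻¹ ^ cut S (addEdge G p) := by
      unfold cutWeight
      split_ifs
      · exact le_rfl
      · positivity
    refine h2.trans (le_of_eq ?_)
    rw [cut_addEdge hp]
    simp only [cutWeight, hS, if_true]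
    split_ifs
    · rw [pow_succ]; ring
    · simp
  refine (Finset.sum_le_sum h1).trans (le_of_eq ?_)
  rw [Finset.sum_sub_distrib, ← Finset.sum_mul, Finset.sum_boole, Finset.sum_const, nsmul_eq_mul]
  ring

/-- Here `a / A` is the probability that the new edge leaves `S`, about `2 m / u`. In the main term
`u` may be replaced by `D` because `u ≤ D` goes in the right direction; in the error terms `D ≤ d *
u` is used. -/
theorem crossing_factor_le {A a u D d m b : ℝ} (hA : 0 < A) (hAu : A ≤ u * (u - 1))
    (ha : 2 * m * (u - d - m) ≤ a) (ha0 : 0 ≤ a) (hu : 1 ≤ u) (hd : 1 ≤ d) (hm : 0 ≤ m)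
    (huD : u ≤ D) (hDu : D ≤ d * u) (hb : 1 ≤ b) :
    A - a * (1 - b⁻¹) ≤ (1 - 2 * m / D + 2 * m * (d + m) * d ^ 2 / D ^ 2 +
      2 * m * (d + m) * d ^ 2 / (b * D)) * A := by
  have hu0 : 0 < u := by linarith
  have hD0 : 0 < D := by linarith
  have hb0 : 0 < b := by linarith
  have hb1 : 0 ≤ 1 - b⁻¹ := by
    have := inv_le_one_of_one_le₀ hb
    linarith
  have hib : 0 ≤ b⁻¹ := by positivity
  -- Chosen so that `y * u ^ 2` is the lower bound for `a`; then `A ≤ u ^ 2` gives `y * A ≤ a` when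
  -- `y` is positive, and for `y ≤ 0` the claim is trivial.
  set y := 2 * m / u - 2 * m * (d + m) / u ^ 2 with hy
  have hyu : y * u ^ 2 = 2 * m * (u - d - m) := by
    rw [hy]; field_simp; ring
  have hyle : y ≤ 2 * m / u := by
    have : 0 ≤ 2 * m * (d + m) / u ^ 2 := by positivity
    linarith
  have hx : (y - 2 * m / u * b⁻¹) * A ≤ a * (1 - b⁻¹) := by
    rcases le_or_gt y 0 with h | h
    · have h1 : 0 ≤ 2 * m / u * b⁻¹ := by positivity
      have h2 : (y - 2 * m / u * b⁻¹) * A ≤ 0 :=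
        mul_nonpos_of_nonpos_of_nonneg (by linarith) hA.le
      exact h2.trans (mul_nonneg ha0 hb1)
    · have h1 : y * A ≤ a := by
        have : A ≤ u ^ 2 := by nlinarith
        nlinarith
      have h2 : y * b⁻¹ ≤ 2 * m / u * b⁻¹ := mul_le_mul_of_nonneg_right hyle hib
      calc (y - 2 * m / u * b⁻¹) * A ≤ (y - y * b⁻¹) * A := by gcongr
        _ = (y * A) * (1 - b⁻¹) := by ring
        _ ≤ a * (1 - b⁻¹) := by gcongr
  have hinv : 1 / u ≤ d / D := by
    rw [div_le_div_iff₀ hu0 hD0]; linarith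
  have k1 : 2 * m / D ≤ 2 * m / u := by gcongr
  have k2 : 2 * m * (d + m) / u ^ 2 ≤ 2 * m * (d + m) * d ^ 2 / D ^ 2 := by
    have : (1 / u) ^ 2 ≤ (d / D) ^ 2 := by gcongr
    calc 2 * m * (d + m) / u ^ 2 = 2 * m * (d + m) * (1 / u) ^ 2 := by ring
      _ ≤ 2 * m * (d + m) * (d / D) ^ 2 := by gcongr
      _ = _ := by ring
  have k3 : 2 * m / u * b⁻¹ ≤ 2 * m * (d + m) * d ^ 2 / (b * D) := by
    calc 2 * m / u * b⁻¹ = 2 * m * (1 / u) * b⁻¹ := by ring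
      _ ≤ 2 * m * (d / D) * b⁻¹ := by gcongr
      _ = 2 * m * 1 * d / (b * D) := by field_simp
      _ ≤ 2 * m * (d + m) * d ^ 2 / (b * D) := by
        gcongr
        · linarith
        · nlinarith
  have : (2 * m / D - 2 * m * (d + m) * d ^ 2 / D ^ 2 - 2 * m * (d + m) * d ^ 2 / (b * D)) * A ≤
      (y - 2 * m / u * b⁻¹) * A := by
    refine mul_le_mul_of_nonneg_right ?_ hA.le
    linarith
  nlinarith

theorem stepExp_cutWeight_le {d : ℕ} {b : ℝ} (hb : 1 ≤ b) {G : SimpleGraph V}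
    (hG : (openPairs d G).Nonempty) (S : Finset V) :
    stepExp d (cutWeight d b S) G ≤
      (1 - 2 * S.card / deficitSum d G + 2 * S.card * (d + S.card) * d ^ 2 / deficitSum d G ^ 2 +
        2 * S.card * (d + S.card) * d ^ 2 / (b * deficitSum d G)) * cutWeight d b S G := by
  rw [stepExp_of_nonempty hG]
  have hA : (0 : ℝ) < (openPairs d G).card := by exact_mod_cast hG.card_pos
  rw [div_le_iff₀ hA]
  by_cases hS : S ⊆ unsat d G
  swap
  · have : ∀ p ∈ openPairs d G, cutWeight d b S (addEdge G p) = 0 := fun p hp =>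
      if_neg fun h => hS (h.trans (unsat_addEdge_subset hp))
    rw [Finset.sum_eq_zero this]
    simp [cutWeight, hS]
  refine (sum_cutWeight_addEdge_le hb hS).trans ?_
  rw [mul_right_comm]
  refine mul_le_mul_of_nonneg_right ?_ (cutWeight_nonneg (by linarith) S G)
  have hcross := card_crossing_ge hS
  have hAu := card_openPairs_le (d := d) G
  have hu1 : (1 : ℝ) ≤ (unsat d G).card := by
    obtain ⟨p, hp⟩ := hG
    exact_mod_cast Finset.card_pos.mpr ⟨_, (mem_openPairs.mp hp).2.2.1⟩
  have hd1 : (1 : ℝ) ≤ d := by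
    obtain ⟨p, hp⟩ := hG
    have := mem_unsat.mp (mem_openPairs.mp hp).2.2.1
    exact_mod_cast (by omega : 1 ≤ d)
  have huD : ((unsat d G).card : ℝ) ≤ deficitSum d G := by
    exact_mod_cast card_unsat_le_deficitSum d G
  have hDu : (deficitSum d G : ℝ) ≤ d * (unsat d G).card := by
    exact_mod_cast deficitSum_le d G
  exact crossing_factor_le hA hAu hcross (by positivity) hu1 hd1 (by positivity) huD hDu hb

theorem law_deficitSum_cast {d s : ℕ} {G : SimpleGraph V}
    (hG : G ∈ (dProcessLaw V d s).support)
    (hs : d * d + 2 * s < d * Fintype.card V + 2) :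
    (deficitSum d G : ℝ) = (d * Fintype.card V : ℕ) - 2 * s := by
  have := law_deficitSum hG hs
  have h2 : ((deficitSum d G + 2 * s : ℕ) : ℝ) = (d * Fintype.card V : ℕ) := by rw [this]
  push_cast at h2 ⊢
  linarith

/-- The sum of the weights of all sets of `m` vertices. -/
noncomputable def sumCutWeight (d m : ℕ) (b : ℝ) (G : SimpleGraph V) : ℝ :=
  ∑ S ∈ (Finset.univ : Finset V).powersetCard m, cutWeight d b S G

theorem sumCutWeight_nonneg {d m : ℕ} {b : ℝ} (hb : 0 ≤ b) (G : SimpleGraph V) :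
    0 ≤ sumCutWeight d m b G :=
  Finset.sum_nonneg fun S _ => cutWeight_nonneg hb S G

/-- Up to a factor depending only on `m` and `d`, the expected total weight per `D ^ m` never
increases, so bounds valid at the start of the middle stage persist until `D` is constant. -/
theorem expect_sumCutWeight_le {d m s₀ s₁ : ℕ} {b : ℝ} (hb : 1 ≤ b) (hs : s₀ ≤ s₁)
    (hs₁ : d * d + 2 * s₁ + 2 ≤ d * Fintype.card V)
    (hbM : Real.log ((d * Fintype.card V : ℕ) - 2 * s₀) ≤ b) :
    expect d s₁ (sumCutWeight (V := V) d m b) / ((d * Fintype.card V : ℕ) - 2 * s₁ : ℝ) ^ m ≤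
      Real.exp (2 ^ m * (2 * m * (d + m) * d ^ 2)) *
        (expect d s₀ (sumCutWeight (V := V) d m b) /
          ((d * Fintype.card V : ℕ) - 2 * s₀ : ℝ) ^ m) := by
  refine le_mul_of_step (y := fun s => expect d s (sumCutWeight (V := V) d m b)) (b := b) hs ?_
    (by positivity) (by linarith) hbM
    (fun s => expect_nonneg fun G _ => sumCutWeight_nonneg (by linarith) G) ?_
  · have : ((d * d + 2 * s₁ + 2 : ℕ) : ℝ) ≤ (d * Fintype.card V : ℕ) := by exact_mod_cast hs₁
    push_cast at this ⊢
    nlinarith [sq_nonneg (d : ℝ)]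
  · intro s _ h1
    rw [expect_succ, ← expect_const_mul]
    refine expect_mono fun G hG => ?_
    have hD := law_deficitSum_cast hG (by omega)
    have hne : (openPairs d G).Nonempty := openPairs_nonempty_of_lt_deficitSum (by
      have := law_deficitSum hG (by omega)
      omega)
    have hlin : stepExp d (sumCutWeight d m b) G =
        ∑ S ∈ (Finset.univ : Finset V).powersetCard m, stepExp d (cutWeight d b S) G := by
      simp only [stepExp_of_nonempty hne, sumCutWeight]
      rw [Finset.sum_comm, Finset.sum_div]
    rw [hlin, sumCutWeight, Finset.mul_sum]
    refine Finset.sum_le_sum fun S hS => ?_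
    have hcard : S.card = m := (Finset.mem_powersetCard.mp hS).2
    have := stepExp_cutWeight_le hb hne S
    rwa [hcard, hD] at this

/-! ### The number of vertices of large deficit -/

/-- The vertices of deficit at least `k`. -/
noncomputable def deficient (d k : ℕ) (G : SimpleGraph V) : Finset V :=
  Finset.univ.filter fun v => G.degree v + k ≤ d

theorem mem_deficient {d k : ℕ} {G : SimpleGraph V} {v : V} :
    v ∈ deficient d k G ↔ G.degree v + k ≤ d := by simp [deficient]

theorem deficient_subset_unsat {d k : ℕ} (hk : 1 ≤ k) (G : SimpleGraph V) :
    deficient d k G ⊆ unsat d G := fun v hv => by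
  rw [mem_deficient] at hv
  rw [mem_unsat]; omega

theorem deficient_succ_subset {d k : ℕ} (G : SimpleGraph V) :
    deficient d (k + 1) G ⊆ deficient d k G := fun v hv => by
  rw [mem_deficient] at hv ⊢; omega

theorem deficient_addEdge_subset {d k : ℕ} {G : SimpleGraph V} {p : V × V}
    (hp : p ∈ openPairs d G) : deficient d k (addEdge G p) ⊆ deficient d k G := fun v hv => by
  rw [mem_deficient] at hv ⊢
  have := degree_le_addEdge hp v
  omega

theorem card_deficient_addEdge {d k : ℕ} {G : SimpleGraph V} {p : V × V}
    (hp : p ∈ openPairs d G) :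
    ((deficient d k (addEdge G p)).card : ℝ) = (deficient d k G).card -
      ((if G.degree p.1 + k = d then 1 else 0) + if G.degree p.2 + k = d then 1 else 0) := by
  have hne := (mem_openPairs.mp hp).1
  have h1 : deficient d k (addEdge G p) =
      deficient d k G \ (({p.1, p.2} : Finset V).filter fun v => G.degree v + k = d) := by
    ext v
    simp only [mem_deficient, degree_addEdge hp, Finset.mem_sdiff, Finset.mem_filter,
      Finset.mem_insert, Finset.mem_singleton]
    split_ifs with h
    · simp only [h, true_and]; omega
    · simp [h]
  have h2 : (({p.1, p.2} : Finset V).filter fun v => G.degree v + k = d) ⊆ deficient d k G := by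
    intro v hv
    rw [Finset.mem_filter] at hv
    rw [mem_deficient]; omega
  rw [h1, Finset.cast_card_sdiff h2, Finset.card_filter, Finset.sum_pair hne]
  push_cast
  rfl

theorem sum_card_deficient_addEdge {d k : ℕ} (G : SimpleGraph V) (hk : 1 ≤ k) :
    ∑ p ∈ openPairs d G, ((deficient d k (addEdge G p)).card : ℝ) =
      (openPairs d G).card * (deficient d k G).card -
        2 * ∑ v ∈ deficient d k G \ deficient d (k + 1) G, ((partners d G v).card : ℝ) := by
  rw [Finset.sum_congr rfl fun p hp => card_deficient_addEdge hp, Finset.sum_sub_distrib,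
    Finset.sum_add_distrib, Finset.sum_const, nsmul_eq_mul]
  have h1 : ∑ p ∈ openPairs d G, (if G.degree p.1 + k = d then (1 : ℝ) else 0) =
      ∑ v ∈ deficient d k G \ deficient d (k + 1) G, ((partners d G v).card : ℝ) := by
    rw [Finset.sum_boole, card_openPairs_fst (d := d) G (fun v _ => G.degree v + k = d)]
    push_cast
    have hsub : deficient d k G \ deficient d (k + 1) G ⊆ unsat d G :=
      Finset.sdiff_subset.trans (deficient_subset_unsat hk G)
    rw [← Finset.sum_subset hsub]
    · refine Finset.sum_congr rfl fun v hv => ?_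
      rw [Finset.mem_sdiff, mem_deficient, mem_deficient] at hv
      rw [Finset.filter_true_of_mem fun _ _ => by omega]
    · intro v _ hv
      rw [Finset.mem_sdiff, mem_deficient, mem_deficient] at hv
      rw [Finset.filter_false_of_mem fun _ _ => by omega]
      simp
  have h2 : ∑ p ∈ openPairs d G, (if G.degree p.2 + k = d then (1 : ℝ) else 0) =
      ∑ p ∈ openPairs d G, (if G.degree p.1 + k = d then (1 : ℝ) else 0) := by
    rw [Finset.sum_boole, Finset.sum_boole,
      card_openPairs_swap (d := d) G (fun v _ => G.degree v + k = d)]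
  rw [h2, h1]
  ring

/-- Only vertices of deficit at least 2 separate `D` from the number `u` of unsaturated vertices;
this turns `1 / u` into `1 / D` at a cost proportional to their number. -/
theorem deficitSum_le_card_add {d : ℕ} (G : SimpleGraph V) :
    deficitSum d G ≤ (unsat d G).card + d * (deficient d 2 G).card := by
  rw [deficitSum_eq_sum_unsat]
  have h : ∀ v ∈ unsat d G, d - G.degree v ≤ 1 + if v ∈ deficient d 2 G then d else 0 := by
    intro v _
    simp only [mem_deficient]
    split_ifs <;> omega
  refine (Finset.sum_le_sum h).trans (le_of_eq ?_)
  rw [Finset.sum_add_distrib, ← Finset.card_eq_sum_ones, ← Finset.sum_filter, Finset.sum_const,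
    smul_eq_mul, mul_comm d,
    show (unsat d G).filter (fun v => v ∈ deficient d 2 G) = deficient d 2 G by
      ext v
      rw [Finset.mem_filter, and_iff_right_of_imp fun h =>
        deficient_subset_unsat (by norm_num) G h]]

/-- `N`, `N'`, `N₂` stand for the numbers of vertices of deficit at least `k`, `k + 1` and 2, and
`z` for those of deficit exactly `k`, the only ones that can drop out. Their expected loss is `2 * x
/ A`, about `2 * z / u`. Replacing `z` by `N` costs the term with `N'`, replacing `u` by `D` the
term with `N₂ * N`. -/
theorem abs_deficient_drift_le {A u D d x z N N' N₂ : ℝ} (hA : 0 < A) (hAu : A ≤ u * (u - 1))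
    (hAl : u * (u - d) ≤ A) (hd : 1 ≤ d) (hu : 2 * d ≤ u) (huD : u ≤ D) (hDu : D ≤ d * u)
    (hX : D ≤ u + d * N₂) (hz : z = N - N') (hz0 : 0 ≤ z) (hN' : 0 ≤ N')
    (hN₂ : 0 ≤ N₂) (hxl : z * (u - d) ≤ x) (hxu : x ≤ z * (u - 1)) :
    |(A * N - 2 * x) / A - (1 - 2 / D) * N| ≤
      (4 * d ^ 3 * N + 2 * d ^ 2 * (N₂ * N)) / D ^ 2 + 2 * N' / D := by
  have hu0 : 0 < u := by linarith
  have hD0 : 0 < D := by linarith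
  have hN : 0 ≤ N := by linarith
  have hinv : 1 / u ≤ d / D := by
    rw [div_le_div_iff₀ hu0 hD0]; linarith
  have hinv2 : 1 / u ^ 2 ≤ d ^ 2 / D ^ 2 := by
    have : (1 / u) ^ 2 ≤ (d / D) ^ 2 := by gcongr
    simpa [div_pow] using this
  have e : (A * N - 2 * x) / A - (1 - 2 / D) * N = 2 * N / D - 2 * (x / A) := by
    field_simp; ring
  rw [e, abs_le]
  have lower : z * (1 / D - d ^ 3 / D ^ 2) ≤ x / A := by
    rw [le_div_iff₀ hA]
    refine le_trans ?_ hxl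
    rw [mul_assoc]
    refine mul_le_mul_of_nonneg_left ?_ hz0
    have h1 : 1 / D - d ^ 3 / D ^ 2 ≤ 1 / u - d / u ^ 2 := by
      have h2 : 1 / D ≤ 1 / u := by gcongr
      have h3 : d / u ^ 2 ≤ d ^ 3 / D ^ 2 := by
        calc d / u ^ 2 = d * (1 / u ^ 2) := by ring
          _ ≤ d * (d ^ 2 / D ^ 2) := by gcongr
          _ = _ := by ring
      linarith
    have h4 : (1 / u - d / u ^ 2) * u ^ 2 = u - d := by field_simp
    have h5 : 0 ≤ 1 / u - d / u ^ 2 := by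
      by_contra h
      push Not at h
      have : (1 / u - d / u ^ 2) * u ^ 2 < 0 := mul_neg_of_neg_of_pos h (by positivity)
      linarith
    calc (1 / D - d ^ 3 / D ^ 2) * A ≤ (1 / u - d / u ^ 2) * A := by gcongr
      _ ≤ (1 / u - d / u ^ 2) * u ^ 2 := by gcongr; nlinarith
      _ = u - d := h4
  have upper : x / A ≤ z * (1 / D + d ^ 2 * N₂ / D ^ 2 + 2 * d ^ 3 / D ^ 2) := by
    rw [div_le_iff₀ hA]
    refine hxu.trans ?_
    rw [mul_assoc]
    refine mul_le_mul_of_nonneg_left ?_ hz0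
    have h1 : 1 / u ≤ 1 / D + d ^ 2 * N₂ / D ^ 2 := by
      have : 1 / u - 1 / D = (D - u) * (1 / u) * (1 / D) := by field_simp
      have h2 : (D - u) * (1 / u) * (1 / D) ≤ (d * N₂) * (d / D) * (1 / D) := by
        gcongr
        linarith
      have h3 : (d * N₂) * (d / D) * (1 / D) = d ^ 2 * N₂ / D ^ 2 := by field_simp
      linarith
    have h2 : 2 * d / u ^ 2 ≤ 2 * d ^ 3 / D ^ 2 := by
      calc 2 * d / u ^ 2 = 2 * d * (1 / u ^ 2) := by ring
        _ ≤ 2 * d * (d ^ 2 / D ^ 2) := by gcongr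
        _ = _ := by ring
    calc u - 1 ≤ (1 / u + 2 * d / u ^ 2) * (u * (u - d)) := by
          have : (1 / u + 2 * d / u ^ 2) * (u * (u - d)) = u - d + 2 * d * (u - d) / u := by
            field_simp
          rw [this]
          have : d ≤ 2 * d * (u - d) / u := by
            rw [le_div_iff₀ hu0]; nlinarith
          linarith
      _ ≤ (1 / u + 2 * d / u ^ 2) * A := by gcongr
      _ ≤ _ := by gcongr
  have hzN : z ≤ N := by linarith
  constructor
  · have h1 : z * (1 / D + d ^ 2 * N₂ / D ^ 2 + 2 * d ^ 3 / D ^ 2) ≤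
        N * (1 / D + d ^ 2 * N₂ / D ^ 2 + 2 * d ^ 3 / D ^ 2) := by gcongr
    have h2 : N * (1 / D + d ^ 2 * N₂ / D ^ 2 + 2 * d ^ 3 / D ^ 2) =
        N / D + (2 * d ^ 3 * N + d ^ 2 * (N₂ * N)) / D ^ 2 := by ring
    have h3 : (4 * d ^ 3 * N + 2 * d ^ 2 * (N₂ * N)) / D ^ 2 =
      2 * ((2 * d ^ 3 * N + d ^ 2 * (N₂ * N)) / D ^ 2) := by ring
    have h4 : 0 ≤ 2 * N' / D := by positivity
    have h5 : 2 * N / D = 2 * (N / D) := by ring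
    linarith
  · have h1 : z * (1 / D - d ^ 3 / D ^ 2) = N / D - N' / D - z * (d ^ 3 / D ^ 2) := by
      rw [hz]; ring
    have h2 : z * (d ^ 3 / D ^ 2) ≤ N * (d ^ 3 / D ^ 2) := by gcongr
    have h3 : (4 * d ^ 3 * N + 2 * d ^ 2 * (N₂ * N)) / D ^ 2 = 2 * (N * (d ^ 3 / D ^ 2)) +
      (2 * d ^ 3 * N + 2 * d ^ 2 * (N₂ * N)) / D ^ 2 := by ring
    have h4 : 0 ≤ (2 * d ^ 3 * N + 2 * d ^ 2 * (N₂ * N)) / D ^ 2 := by positivity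
    have h5 : 2 * N / D = 2 * (N / D) := by ring
    have h6 : 2 * N' / D = 2 * (N' / D) := by ring
    linarith

theorem abs_stepExp_deficient_sub_le {d k : ℕ} {G : SimpleGraph V} (hd : 1 ≤ d) (hk : 1 ≤ k)
    (hu : 2 * d ≤ (unsat d G).card) :
    |stepExp d (fun G => ((deficient d k G).card : ℝ)) G -
        (1 - 2 / deficitSum d G) * (deficient d k G).card| ≤
      (4 * d ^ 3 * (deficient d k G).card +
        2 * d ^ 2 * ((deficient d 2 G).card * (deficient d k G).card)) / deficitSum d G ^ 2 +
      2 * (deficient d (k + 1) G).card / deficitSum d G := by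
  have hne : (openPairs d G).Nonempty := openPairs_nonempty_of_lt (by omega)
  rw [stepExp_of_nonempty hne, sum_card_deficient_addEdge G hk]
  have hsub := deficient_succ_subset (d := d) (k := k) G
  refine abs_deficient_drift_le (u := (unsat d G).card)
    (z := (deficient d k G \ deficient d (k + 1) G).card) (by exact_mod_cast hne.card_pos)
    (card_openPairs_le G) (le_card_openPairs G) (by exact_mod_cast hd) (by exact_mod_cast hu)
    (by exact_mod_cast card_unsat_le_deficitSum d G) (by exact_mod_cast deficitSum_le d G)
    (by exact_mod_cast deficitSum_le_card_add G) (Finset.cast_card_sdiff hsub) (by positivity)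
    (by positivity) (by positivity) ?_ ?_
  · rw [← nsmul_eq_mul]
    refine Finset.card_nsmul_le_sum _ _ _ fun v hv => ?_
    have hv' := deficient_subset_unsat hk G (Finset.mem_sdiff.mp hv).1
    have : ((unsat d G).card : ℝ) ≤ (partners d G v).card + d := by
      exact_mod_cast le_card_partners_add hv'
    linarith
  · rw [← nsmul_eq_mul]
    refine Finset.sum_le_card_nsmul _ _ _ fun v hv => ?_
    have hv' := deficient_subset_unsat hk G (Finset.mem_sdiff.mp hv).1
    have : ((partners d G v).card : ℝ) + 1 ≤ (unsat d G).card := by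
      exact_mod_cast card_partners_add_one_le hv'
    linarith

/-! ### Counting deficient vertices by weights -/

theorem pow_le_cutWeight {d j : ℕ} {b : ℝ} (hb : 1 ≤ b) {S : Finset V} {G : SimpleGraph V}
    (hS : S ⊆ unsat d G) (h : cut S G + j ≤ S.card * (d - 1)) :
    b ^ j ≤ b ^ (S.card * (d - 1)) * cutWeight d b S G := by
  rw [cutWeight, if_pos hS, inv_pow, ← div_eq_mul_inv, le_div_iff₀ (by positivity), ← pow_add]
  exact pow_le_pow_right₀ hb (by omega)

/-- After scaling by `b ^ (m * (d - 1))`, a set of `m` unsaturated vertices has weight `b ^ e`,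
where `e = m * (d - 1) - cut` is the sum of `deficit - 1` over the set plus twice its number of
inner edges. So this is Markov's inequality for sets with `e ≥ j`. -/
theorem card_mul_pow_le_sumCutWeight {d m j : ℕ} {b : ℝ} (hb : 1 ≤ b) {G : SimpleGraph V}
    (T : Finset (Finset V)) (hT : ∀ S ∈ T, S.card = m ∧ S ⊆ unsat d G ∧
      cut S G + j ≤ m * (d - 1)) :
    T.card * b ^ j ≤ b ^ (m * (d - 1)) * sumCutWeight d m b G := by
  have h1 : T ⊆ (Finset.univ : Finset V).powersetCard m := fun S hS =>
    Finset.mem_powersetCard.mpr ⟨Finset.subset_univ _, (hT S hS).1⟩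
  rw [sumCutWeight, Finset.mul_sum, ← nsmul_eq_mul]
  refine le_trans (Finset.card_nsmul_le_sum _ _ _ fun S hS => ?_)
    (Finset.sum_le_sum_of_subset_of_nonneg h1 fun S _ _ =>
      mul_nonneg (by positivity) (cutWeight_nonneg (by linarith) S G))
  obtain ⟨h2, h3, h4⟩ := hT S hS
  have := pow_le_cutWeight (j := j) hb h3 (by rwa [h2])
  rwa [h2] at this

theorem card_deficient_mul_pow_le {d k : ℕ} {b : ℝ} (hb : 1 ≤ b) (hk : 1 ≤ k)
    (G : SimpleGraph V) :
    (deficient d k G).card * b ^ (k - 1) ≤ b ^ (1 * (d - 1)) * sumCutWeight d 1 b G := by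
  have := card_mul_pow_le_sumCutWeight (d := d) (m := 1) (j := k - 1) hb (G := G)
    ((deficient d k G).map ⟨fun v => {v}, Finset.singleton_injective⟩) ?_
  · rwa [Finset.card_map] at this
  · intro S hS
    rw [Finset.mem_map] at hS
    obtain ⟨v, hv, rfl⟩ := hS
    have h1 := cut_le_sum_degree {v} G
    rw [Finset.sum_singleton] at h1
    refine ⟨Finset.card_singleton v, ?_, ?_⟩
    · simpa using deficient_subset_unsat hk G hv
    · rw [mem_deficient] at hv
      simp only [Function.Embedding.coeFn_mk]
      omega

/-- Two distinct vertices of deficits at least 2 and `k` give the exponent `1 + (k - 1) = k`. Each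
two-element set comes from at most two ordered pairs, and the diagonal pairs account for the last
term. -/
theorem card_deficient_two_mul_mul_pow_le {d k : ℕ} {b : ℝ} (hb : 1 ≤ b) (hk : 2 ≤ k)
    (G : SimpleGraph V) :
    ((deficient d 2 G).card * (deficient d k G).card : ℝ) * b ^ k ≤
      2 * (b ^ (2 * (d - 1)) * sumCutWeight d 2 b G) + (deficient d k G).card * b ^ k := by
  set P := (deficient d 2 G ×ˢ deficient d k G).filter fun p => p.1 ≠ p.2 with hP
  have h1 : (deficient d 2 G).card * (deficient d k G).card ≤ P.card + (deficient d k G).card := by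
    rw [← Finset.card_product, ← Finset.card_filter_add_card_filter_not (fun p : V × V => p.1 ≠ p.2)]
    refine Nat.add_le_add_left ?_ _
    refine Finset.card_le_card_of_injOn Prod.snd ?_ ?_
    · intro p hp
      simp only [Finset.coe_filter, Set.mem_ofPred_eq, Finset.mem_product] at hp
      exact hp.1.2
    · intro p hp q hq h
      simp only [Finset.coe_filter, Set.mem_ofPred_eq, not_not] at hp hq
      exact Prod.ext (by rw [hp.2, hq.2, h]) h
  set T := P.image fun p => ({p.1, p.2} : Finset V) with hT
  have h2 : P.card ≤ 2 * T.card := by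
    refine Finset.card_le_mul_card_image P 2 fun S hS => ?_
    obtain ⟨⟨a, c⟩, hp, rfl⟩ := Finset.mem_image.mp hS
    refine (Finset.card_le_card (t := {(a, c), (c, a)}) ?_).trans Finset.card_le_two
    rintro ⟨x, y⟩ hxy
    rw [Finset.mem_filter] at hxy
    have hne : x ≠ y := by
      have := hxy.1
      simp only [hP, Finset.mem_filter] at this
      exact this.2
    have heq := hxy.2
    have hx : x ∈ ({a, c} : Finset V) := heq ▸ Finset.mem_insert_self _ _
    have hy : y ∈ ({a, c} : Finset V) := heq ▸ (by simp)
    simp only [Finset.mem_insert, Finset.mem_singleton] at hx hy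
    simp only [Finset.mem_insert, Finset.mem_singleton, Prod.mk.injEq]
    grind
  have h3 : T.card * b ^ k ≤ b ^ (2 * (d - 1)) * sumCutWeight d 2 b G := by
    refine card_mul_pow_le_sumCutWeight hb T fun S hS => ?_
    obtain ⟨⟨a, c⟩, hp, rfl⟩ := Finset.mem_image.mp hS
    simp only [hP, Finset.mem_filter, Finset.mem_product] at hp
    obtain ⟨⟨ha, hc⟩, hne⟩ := hp
    have h4 := cut_le_sum_degree {a, c} G
    rw [Finset.sum_pair hne] at h4
    refine ⟨Finset.card_pair hne, ?_, ?_⟩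
    · intro v hv
      simp only [Finset.mem_insert, Finset.mem_singleton] at hv
      rcases hv with rfl | rfl
      · exact deficient_subset_unsat (by norm_num) G ha
      · exact deficient_subset_unsat (by omega) G hc
    · rw [mem_deficient] at ha hc
      simp only
      omega
  have h4 : ((deficient d 2 G).card * (deficient d k G).card : ℝ) ≤
      2 * T.card + (deficient d k G).card := by
    exact_mod_cast h1.trans (Nat.add_le_add_right h2 _)
  have hbk : 0 ≤ b ^ k := by positivity
  nlinarith

/-! ### The density of vertices of large deficit is almost conserved -/

theorem expect_deficient_mul_pow_le {d k s : ℕ} {b : ℝ} (hb : 1 ≤ b) (hk : 1 ≤ k) :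
    expect d s (fun G : SimpleGraph V => ((deficient d k G).card : ℝ)) * b ^ (k - 1) ≤
      b ^ (1 * (d - 1)) * expect d s (sumCutWeight (V := V) d 1 b) := by
  rw [mul_comm, ← expect_const_mul, ← expect_const_mul]
  refine expect_mono fun G _ => ?_
  rw [mul_comm]
  exact card_deficient_mul_pow_le hb hk G

theorem expect_deficient_two_mul_mul_pow_le {d k s : ℕ} {b : ℝ} (hb : 1 ≤ b) (hk : 2 ≤ k) :
    expect d s (fun G : SimpleGraph V =>
        ((deficient d 2 G).card * (deficient d k G).card : ℝ)) * b ^ k ≤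
      2 * (b ^ (2 * (d - 1)) * expect d s (sumCutWeight (V := V) d 2 b)) +
        expect d s (fun G : SimpleGraph V => ((deficient d k G).card : ℝ)) * b ^ k := by
  rw [mul_comm, ← expect_const_mul, ← expect_const_mul, ← expect_const_mul,
    mul_comm _ (b ^ k), ← expect_const_mul, ← expect_add_fun]
  refine expect_mono fun G _ => ?_
  have := card_deficient_two_mul_mul_pow_le (d := d) hb hk G
  linarith

/-- Dividing `E'` by `D - 2 = D * (1 - 2 / D)` cancels the drift, and only the errors remain. `β` is
the typical density `b ^ (-(k-1))`; one more unit of deficit, in `F`, or a second deficient vertex,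
in `M₂`, gains a factor `1 / b`. -/
theorem density_step_le {d b β D K E E' F M₂ : ℝ} (hd : 1 ≤ d) (hb : 0 < b) (hD : 4 ≤ D)
    (hE : E ≤ K * D * β) (hF : F ≤ K * D * (β / b))
    (hM : M₂ ≤ 2 * K * D ^ 2 * (β / b) + K * D * β) (hK : 0 ≤ K) (hβ : 0 ≤ β)
    (h : |E' - (1 - 2 / D) * E| ≤ (4 * d ^ 3 * E + 2 * d ^ 2 * M₂) / D ^ 2 + 2 * F / D) :
    |E' / (D - 2) - E / D| ≤
      (12 * d ^ 3 * K * β) / D ^ 2 + (12 * d ^ 3 * K * (β / b)) / D := by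
  have hD0 : 0 < D := by linarith
  have hD2 : 0 < D - 2 := by linarith
  have e : E' / (D - 2) - E / D = (E' - (1 - 2 / D) * E) / (D - 2) := by
    field_simp
  rw [e, abs_div, abs_of_pos hD2, div_le_iff₀ hD2]
  refine h.trans ?_
  have hd23 : d ^ 2 ≤ d ^ 3 := pow_le_pow_right₀ hd (by norm_num)
  have hd3 : 1 ≤ d ^ 3 := one_le_pow₀ hd
  have h1 : (4 * d ^ 3 * E + 2 * d ^ 2 * M₂) / D ^ 2 + 2 * F / D ≤
      (4 * d ^ 3 * (K * D * β) + 2 * d ^ 2 * (2 * K * D ^ 2 * (β / b) + K * D * β)) / D ^ 2 +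
        2 * (K * D * (β / b)) / D := by gcongr
  refine h1.trans ?_
  have h2 : (4 * d ^ 3 * (K * D * β) + 2 * d ^ 2 * (2 * K * D ^ 2 * (β / b) + K * D * β)) / D ^ 2 +
        2 * (K * D * (β / b)) / D =
      (4 * d ^ 3 + 2 * d ^ 2) * (K * β / D) + (4 * d ^ 2 + 2) * (K * (β / b)) := by
    field_simp
    ring
  have h3 : ((12 * d ^ 3 * K * β) / D ^ 2 + (12 * d ^ 3 * K * (β / b)) / D) * (D - 2) =
      (12 * d ^ 3 * ((D - 2) / D)) * (K * β / D) +
        (12 * d ^ 3 * ((D - 2) / D)) * (K * (β / b)) := by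
    field_simp
  have h4 : 1 / 2 ≤ (D - 2) / D := by
    rw [div_le_div_iff₀ (by norm_num) hD0]; linarith
  have h5 : 6 * d ^ 3 ≤ 12 * d ^ 3 * ((D - 2) / D) := by nlinarith
  rw [h2, h3]
  gcongr <;> linarith

/-- If the weights of single vertices and of pairs stay of their typical order between the times
`s₀` and `s₁`, the expected proportion of vertices of deficit at least `k` hardly changes. -/
theorem abs_density_sub_le {d k s₀ s₁ : ℕ} {b K : ℝ} (hd : 1 ≤ d) (hk : 2 ≤ k) (hb : 1 ≤ b)
    (hs : s₀ ≤ s₁) (hs₁ : 2 * (d * d) + 2 * s₁ + 2 ≤ d * Fintype.card V)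
    (h1 : ∀ s, s₀ ≤ s → s ≤ s₁ → b ^ (1 * (d - 1)) * expect d s (sumCutWeight (V := V) d 1 b) ≤
      K * ((d * Fintype.card V : ℕ) - 2 * s))
    (h2 : ∀ s, s₀ ≤ s → s ≤ s₁ → b ^ (2 * (d - 1)) * expect d s (sumCutWeight (V := V) d 2 b) ≤
      K * ((d * Fintype.card V : ℕ) - 2 * s) ^ 2) :
    |expect d s₁ (fun G : SimpleGraph V => ((deficient d k G).card : ℝ)) /
          ((d * Fintype.card V : ℕ) - 2 * s₁) -
        expect d s₀ (fun G : SimpleGraph V => ((deficient d k G).card : ℝ)) /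
          ((d * Fintype.card V : ℕ) - 2 * s₀)| * b ^ (k - 1) ≤
      12 * d ^ 3 * K * (1 / ((d * Fintype.card V : ℕ) - 2 * s₁) +
        Real.log ((d * Fintype.card V : ℕ) - 2 * s₀) / b) := by
  have hb0 : 0 < b := by linarith
  set β := (b ^ (k - 1))⁻¹ with hβ
  have hβ0 : 0 ≤ β := by positivity
  have hβb : β / b = (b ^ k)⁻¹ := by
    obtain ⟨j, rfl⟩ : ∃ j, k = j + 1 := ⟨k - 1, by omega⟩
    rw [hβ, Nat.add_sub_cancel, pow_succ, mul_inv, div_eq_mul_inv]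
  have hd' : (1 : ℝ) ≤ d := by exact_mod_cast hd
  have hDs : ∀ s, s ≤ s₁ → (2 * d ^ 2 + 2 : ℝ) ≤ (d * Fintype.card V : ℕ) - 2 * s := by
    intro s h
    have h3 : ((2 * (d * d) + 2 * s + 2 : ℕ) : ℝ) ≤ (d * Fintype.card V : ℕ) := by
      exact_mod_cast (by omega : 2 * (d * d) + 2 * s + 2 ≤ d * Fintype.card V)
    push_cast at h3 ⊢
    nlinarith
  have hK : 0 ≤ K := by
    have h3 := h1 s₁ hs le_rfl
    have h4 : 0 ≤ b ^ (1 * (d - 1)) * expect d s₁ (sumCutWeight (V := V) d 1 b) :=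
      mul_nonneg (by positivity) (expect_nonneg fun G _ => sumCutWeight_nonneg hb0.le G)
    have h5 := hDs s₁ le_rfl
    by_contra h6
    push Not at h6
    have h7 : (0 : ℝ) < (d * Fintype.card V : ℕ) - 2 * s₁ := by nlinarith
    nlinarith
  have key := abs_sub_le_of_step
    (a := fun s => expect d s (fun G : SimpleGraph V => ((deficient d k G).card : ℝ)) /
      ((d * Fintype.card V : ℕ) - 2 * s)) (M := (d * Fintype.card V : ℕ))
    (C₁ := 12 * d ^ 3 * K * β) (C₂ := 12 * d ^ 3 * K * (β / b)) hs
    (by have := hDs s₁ le_rfl; nlinarith) (by positivity) (by positivity) ?_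
  · refine (mul_le_mul_of_nonneg_right key (by positivity)).trans (le_of_eq ?_)
    rw [hβ]
    field_simp
  · intro s h0 hlt
    have e : ((d * Fintype.card V : ℕ) : ℝ) - 2 * ((s + 1 : ℕ) : ℝ) =
      (d * Fintype.card V : ℕ) - 2 * s - 2 := by push_cast; ring
    rw [e]
    have hD := hDs s hlt.le
    have i1 := h1 s h0 hlt.le
    have i2 := h2 s h0 hlt.le
    have j1 := (expect_deficient_mul_pow_le (V := V) (d := d) (s := s) hb
      (by omega : 1 ≤ k)).trans i1
    have j2 := (expect_deficient_mul_pow_le (V := V) (d := d) (s := s) hb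
      (by omega : 1 ≤ k + 1)).trans i1
    have j3 := expect_deficient_two_mul_mul_pow_le (V := V) (d := d) (s := s) hb hk
    have hbk : (0 : ℝ) < b ^ k := by positivity
    have hbk1 : (0 : ℝ) < b ^ (k - 1) := by positivity
    set D : ℝ := (d * Fintype.card V : ℕ) - 2 * (s : ℝ) with hDdef
    have hE : expect d s (fun G : SimpleGraph V => ((deficient d k G).card : ℝ)) ≤ K * D * β := by
      rw [hβ, ← div_eq_mul_inv, le_div_iff₀ hbk1]
      exact j1
    refine density_step_le (d := d) hd' hb0 (by nlinarith) hE
      (F := expect d s (fun G : SimpleGraph V => ((deficient d (k + 1) G).card : ℝ)))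
      (M₂ := expect d s (fun G : SimpleGraph V =>
        ((deficient d 2 G).card * (deficient d k G).card : ℝ))) ?_ ?_ hK hβ0 ?_
    · rw [hβb, ← div_eq_mul_inv, le_div_iff₀ hbk]
      simpa using j2
    · have j4 : expect d s (fun G : SimpleGraph V =>
          ((deficient d 2 G).card * (deficient d k G).card : ℝ)) ≤
          2 * K * D ^ 2 * (b ^ k)⁻¹ +
            expect d s (fun G : SimpleGraph V => ((deficient d k G).card : ℝ)) := by
        rw [← sub_le_iff_le_add, ← div_eq_mul_inv, le_div_iff₀ hbk]
        linarith
      rw [hβb]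
      linarith
    · rw [expect_succ, ← expect_const_mul, ← expect_sub_fun]
      have : (4 * d ^ 3 * expect d s (fun G : SimpleGraph V => ((deficient d k G).card : ℝ)) +
          2 * d ^ 2 * expect d s (fun G : SimpleGraph V =>
            ((deficient d 2 G).card * (deficient d k G).card : ℝ))) / D ^ 2 +
          2 * expect d s (fun G : SimpleGraph V => ((deficient d (k + 1) G).card : ℝ)) / D =
          expect d s (fun G : SimpleGraph V => (D ^ 2)⁻¹ * (4 * d ^ 3 * (deficient d k G).card +
            2 * d ^ 2 * ((deficient d 2 G).card * (deficient d k G).card)) +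
            2 / D * (deficient d (k + 1) G).card) := by
        rw [expect_add_fun, expect_const_mul, expect_const_mul, expect_add_fun, expect_const_mul,
          expect_const_mul]
        ring
      rw [this]
      refine abs_expect_le fun G hG => ?_
      have hDG := law_deficitSum_cast hG (by omega)
      rw [← hDdef] at hDG
      have hu : 2 * d ≤ (unsat d G).card := by
        have h3 : (deficitSum d G : ℝ) ≤ d * (unsat d G).card := by
          exact_mod_cast deficitSum_le d G
        have h4 : (2 * d : ℝ) ≤ (unsat d G).card := by
          by_contra h5
          push Not at h5
          nlinarith
        exact_mod_cast h4
      have h6 := abs_stepExp_deficient_sub_le (k := k) hd (by omega) hu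
      rw [hDG] at h6
      refine h6.trans (le_of_eq ?_)
      ring

/-! ### The end of the process -/

/-- The indicator of the graphs that are not saturated. -/
noncomputable def failure (d : ℕ) (G : SimpleGraph V) : ℝ := if IsSaturated d G then 0 else 1

/-- The excess `∑ (deficit - 1)` of the unsaturated vertices plus twice the number of edges between
them. -/
noncomputable def excess (d : ℕ) (G : SimpleGraph V) : ℕ :=
  (unsat d G).card * (d - 1) - cut (unsat d G) G

theorem cut_unsat_le {d : ℕ} (G : SimpleGraph V) :
    cut (unsat d G) G ≤ (unsat d G).card * (d - 1) := by
  refine (cut_le_sum_degree _ _).trans ?_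
  rw [← smul_eq_mul]
  refine Finset.sum_le_card_nsmul _ _ _ fun v hv => ?_
  rw [mem_unsat] at hv
  omega

theorem excess_add_card {d : ℕ} (G : SimpleGraph V) :
    excess d G + (unsat d G).card = deficitSum d G +
      ∑ v ∈ unsat d G, ((G.neighborFinset v).filter fun w => w ∈ unsat d G).card := by
  have h1 := cut_unsat_le (d := d) G
  have h2 := sum_degree_eq_cut_add (unsat d G) G
  have h3 : deficitSum d G + ∑ v ∈ unsat d G, G.degree v =
      (unsat d G).card * (d - 1) + (unsat d G).card := by
    rw [deficitSum_eq_sum_unsat, ← Finset.sum_add_distrib]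
    have : ∀ v ∈ unsat d G, d - G.degree v + G.degree v = (d - 1) + 1 := by
      intro v hv
      rw [mem_unsat] at hv
      omega
    rw [Finset.sum_congr rfl this, Finset.sum_const, smul_eq_mul]
    ring
  unfold excess
  omega

/-- The excess is the sum over unsaturated `v` of `d - 1` minus the number of saturated neighbours
of `v`. Each summand is nonnegative, as `v` has degree at most `d - 1`, so dropping a vertex that
saturates does not raise the sum; and the remaining summands can only fall, since no vertex becomes
unsaturated again. -/
theorem excess_addEdge_le {d : ℕ} {G : SimpleGraph V} {p : V × V} (hp : p ∈ openPairs d G) :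
    excess d (addEdge G p) ≤ excess d G := by
  have hsub := unsat_addEdge_subset hp
  have h1 : cut (unsat d G) G ≤ cut (unsat d (addEdge G p)) (addEdge G p) +
      ((unsat d G).card - (unsat d (addEdge G p)).card) * (d - 1) := by
    unfold cut
    rw [← Finset.sum_sdiff hsub, add_comm]
    refine Nat.add_le_add (Finset.sum_le_sum fun v _ => Finset.card_le_card fun w hw => ?_) ?_
    · simp only [Finset.mem_filter, SimpleGraph.mem_neighborFinset, addEdge_adj] at hw ⊢
      exact ⟨Or.inl hw.1, fun h => hw.2 (hsub h)⟩
    · rw [← Finset.card_sdiff_of_subset hsub, ← smul_eq_mul]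
      refine Finset.sum_le_card_nsmul _ _ _ fun v hv => ?_
      have h2 := mem_unsat.mp (Finset.mem_sdiff.mp hv).1
      have h3 := Finset.card_filter_le (G.neighborFinset v) (fun w => w ∉ unsat d G)
      rw [SimpleGraph.card_neighborFinset_eq_degree] at h3
      omega
  have h2 := cut_unsat_le (d := d) G
  have h3 := cut_unsat_le (d := d) (addEdge G p)
  have h4 := Finset.card_le_card hsub
  obtain ⟨j, hj⟩ := Nat.exists_eq_add_of_le h4
  have h5 : (unsat d G).card * (d - 1) = (unsat d (addEdge G p)).card * (d - 1) + j * (d - 1) := by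
    rw [hj]; ring
  have h6 : (unsat d G).card - (unsat d (addEdge G p)).card = j := by omega
  rw [h6] at h1
  unfold excess
  omega

theorem degree_eq_of_notMem_unsat {d : ℕ} {G : SimpleGraph V} (hG : ∀ v, G.degree v ≤ d) {v : V}
    (hv : v ∉ unsat d G) : G.degree v = d := by
  rw [mem_unsat] at hv
  have := hG v
  omega

theorem isSaturated_of_deficitSum_le_one {d : ℕ} {G : SimpleGraph V} (hG : ∀ v, G.degree v ≤ d)
    (h : deficitSum d G ≤ 1) : IsSaturated d G := by
  have hu := (card_unsat_le_deficitSum d G).trans h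
  rcases (unsat d G).eq_empty_or_nonempty with h0 | ⟨v, hv⟩
  · left
    intro v
    exact degree_eq_of_notMem_unsat hG (by simp [h0])
  · right
    have h1 : unsat d G = {v} := by
      symm
      refine Finset.eq_of_subset_of_card_le (by simpa using hv) (by simpa using hu)
    refine ⟨v, ?_, fun w hw => degree_eq_of_notMem_unsat hG (by simpa [h1] using hw)⟩
    rw [deficitSum_eq_sum_unsat, h1, Finset.sum_singleton] at h
    rw [mem_unsat] at hv
    omega

/-- Graphs from which the process surely saturates. -/
structure IsSafe (d k : ℕ) (G : SimpleGraph V) : Prop where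
  degree_le : ∀ v, G.degree v ≤ d
  parity : deficitSum d G % 2 = k % 2
  excess_lt : excess d G < k
  deficient_eq : deficient d k G = ∅

theorem IsSafe.addEdge {d k : ℕ} {G : SimpleGraph V} (h : IsSafe d k G) {p : V × V}
    (hp : p ∈ openPairs d G) : IsSafe d k (addEdge G p) where
  degree_le := degree_addEdge_le hp h.degree_le
  parity := by
    have h1 := deficitSum_addEdge hp
    have h2 := h.parity
    omega
  excess_lt := (excess_addEdge_le hp).trans_lt h.excess_lt
  deficient_eq := Finset.subset_empty.mp (h.deficient_eq ▸ deficient_addEdge_subset hp)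

theorem sum_card_neighbors_unsat_of_openPairs_eq_empty {d : ℕ} {G : SimpleGraph V}
    (h : openPairs d G = ∅) :
    ∑ v ∈ unsat d G, ((G.neighborFinset v).filter fun w => w ∈ unsat d G).card =
      (unsat d G).card * ((unsat d G).card - 1) := by
  rw [← smul_eq_mul]
  refine Finset.sum_eq_card_nsmul fun v hv => ?_
  rw [← Finset.card_erase_of_mem hv]
  congr 1
  ext w
  simp only [Finset.mem_filter, SimpleGraph.mem_neighborFinset, Finset.mem_erase]
  constructor
  · rintro ⟨h1, h2⟩
    exact ⟨h1.ne', h2⟩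
  · rintro ⟨h1, h2⟩
    refine ⟨?_, h2⟩
    by_contra h3
    have : (v, w) ∈ openPairs d G := mem_openPairs.mpr ⟨fun h => h1 h.symm, h3, hv, h2⟩
    simp [h] at this

/-- In a stuck graph the `u` unsaturated vertices form a clique, so the excess equals `D - u + u *
(u - 1)` with `D ≥ u`. For `u ≥ 3` it is at least 6. For `u = 2` it equals `D ≥ 2`, which is
excluded by excess below `k` and parity. For `u = 1` the deficit is less than `k` and of the parity
of `k`, hence at most 1. -/
theorem IsSafe.isSaturated {d k : ℕ} {G : SimpleGraph V} (hk : k = 2 ∨ k = 3)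
    (h : IsSafe d k G) (hG : openPairs d G = ∅) : IsSaturated d G := by
  have h1 := excess_add_card (d := d) G
  rw [sum_card_neighbors_unsat_of_openPairs_eq_empty hG] at h1
  have h2 := card_unsat_le_deficitSum d G
  have h3 := h.excess_lt
  have h4 := h.parity
  apply isSaturated_of_deficitSum_le_one h.degree_le
  have h6 : (unsat d G).card < 3 := by
    by_contra h7
    push Not at h7
    have : 3 * 2 ≤ (unsat d G).card * ((unsat d G).card - 1) :=
      Nat.mul_le_mul h7 (by omega)
    omega
  have h7 : (unsat d G).card = 1 → deficitSum d G < k := by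
    intro h8
    obtain ⟨v, hv⟩ := Finset.card_eq_one.mp h8
    rw [deficitSum_eq_sum_unsat, hv, Finset.sum_singleton]
    by_contra h9
    have : v ∈ deficient d k G := by
      rw [mem_deficient]; omega
    simp [h.deficient_eq] at this
  have h8 := deficitSum_le d G
  interval_cases h9 : (unsat d G).card
  · omega
  · have := h7 rfl
    omega
  · omega

theorem IsSafe.iterate_stepExp_failure {d k : ℕ} (hk : k = 2 ∨ k = 3) (r : ℕ) :
    ∀ {G : SimpleGraph V}, IsSafe d k G → deficitSum d G ≤ 2 * r + 1 →
      (stepExp d)^[r] (failure d) G = 0 := by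
  induction r with
  | zero =>
    intro G h hD
    exact if_pos (isSaturated_of_deficitSum_le_one h.degree_le hD)
  | succ r ih =>
    intro G h hD
    rcases openPairs_eq_empty_or (d := d) G with h0 | h0
    · rw [iterate_stepExp_of_eq_empty h0]
      exact if_pos (h.isSaturated hk h0)
    · rw [Function.iterate_succ_apply', stepExp_of_nonempty h0, Finset.sum_eq_zero, zero_div]
      intro p hp
      refine ih (h.addEdge hp) ?_
      have := deficitSum_addEdge hp
      omega

/-- Graphs in which the vertex `v` has deficit `k`, the other unsaturated vertices have deficit `1`,
and no two unsaturated vertices are adjacent. -/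
structure IsCritical (d k : ℕ) (G : SimpleGraph V) (v : V) : Prop where
  degree_le : ∀ w, G.degree w ≤ d
  degree_add : G.degree v + k = d
  degree_add_one : ∀ w ∈ unsat d G, w ≠ v → G.degree w + 1 = d
  not_adj : ∀ x ∈ unsat d G, ∀ y ∈ unsat d G, ¬ G.Adj x y

theorem IsCritical.mem_unsat {d k : ℕ} {G : SimpleGraph V} {v : V} (h : IsCritical d k G v)
    (hk : 1 ≤ k) : v ∈ unsat d G := by
  rw [DegreeBounded.mem_unsat]
  have := h.degree_add
  omega

theorem IsCritical.deficitSum_add_one {d k : ℕ} {G : SimpleGraph V} {v : V}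
    (h : IsCritical d k G v) (hk : 1 ≤ k) :
    deficitSum d G + 1 = (unsat d G).card + k := by
  have hv := h.mem_unsat hk
  rw [deficitSum_eq_sum_unsat, ← Finset.add_sum_erase _ _ hv,
    Finset.sum_congr rfl (g := fun _ => 1)]
  · rw [← Finset.card_eq_sum_ones, Finset.card_erase_of_mem hv]
    have h1 : 0 < (unsat d G).card := Finset.card_pos.mpr ⟨v, hv⟩
    have := h.degree_add
    omega
  · intro w hw
    have := h.degree_add_one w (Finset.mem_of_mem_erase hw) (Finset.ne_of_mem_erase hw)
    omega

theorem IsCritical.excess_lt {d k : ℕ} {G : SimpleGraph V} {v : V}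
    (h : IsCritical d k G v) (hk : 1 ≤ k) : excess d G < k := by
  have h1 := excess_add_card (d := d) G
  have h2 := h.deficitSum_add_one hk
  rw [Finset.sum_eq_zero] at h1
  · omega
  · intro x hx
    rw [Finset.card_eq_zero, Finset.filter_eq_empty_iff]
    intro y hy hy'
    exact h.not_adj x hx y hy' (by simpa using hy)

theorem IsCritical.openPairs_eq {d k : ℕ} {G : SimpleGraph V} {v : V}
    (h : IsCritical d k G v) : openPairs d G = (unsat d G).offDiag := by
  ext p
  rw [mem_openPairs, Finset.mem_offDiag]
  constructor
  · rintro ⟨h1, -, h2, h3⟩; exact ⟨h2, h3, h1⟩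
  · rintro ⟨h2, h3, h1⟩; exact ⟨h1, h.not_adj _ h2 _ h3, h2, h3⟩

/-- Once `v` is touched its deficit is `k - 1`, so no vertex of deficit `k` remains; excess and
parity are inherited. -/
theorem IsCritical.addEdge_isSafe {d k : ℕ} {G : SimpleGraph V} {v : V} (hk : 2 ≤ k)
    (h : IsCritical d k G v) (hpar : deficitSum d G % 2 = k % 2) {p : V × V}
    (hp : p ∈ openPairs d G) (hv : v = p.1 ∨ v = p.2) : IsSafe d k (addEdge G p) where
  degree_le := degree_addEdge_le hp h.degree_le
  parity := by
    have h1 := deficitSum_addEdge hp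
    omega
  excess_lt := (excess_addEdge_le hp).trans_lt (h.excess_lt (by omega))
  deficient_eq := by
    rw [Finset.eq_empty_iff_forall_notMem]
    intro w hw
    rw [mem_deficient, degree_addEdge hp] at hw
    by_cases hwv : w = v
    · subst hwv
      have := h.degree_add
      simp only [hv, if_true] at hw
      omega
    · have h1 : w ∈ unsat d G := by
        rw [DegreeBounded.mem_unsat]; omega
      have := h.degree_add_one w h1 hwv
      omega

theorem IsCritical.unsat_addEdge {d k : ℕ} {G : SimpleGraph V} {v : V}
    (h : IsCritical d k G v) {p : V × V} (hp : p ∈ openPairs d G)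
    (hv : ¬ (v = p.1 ∨ v = p.2)) : unsat d (addEdge G p) = unsat d G \ {p.1, p.2} := by
  obtain ⟨-, -, h1, h2⟩ := mem_openPairs.mp hp
  push Not at hv
  ext w
  rw [Finset.mem_sdiff, DegreeBounded.mem_unsat, degree_addEdge hp, DegreeBounded.mem_unsat]
  simp only [Finset.mem_insert, Finset.mem_singleton]
  split_ifs with hw
  · have : G.degree w + 1 = d := by
      rcases hw with rfl | rfl
      · exact h.degree_add_one _ h1 hv.1.symm
      · exact h.degree_add_one _ h2 hv.2.symm
    simp only [hw, not_true, and_false, iff_false]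
    omega
  · simp [hw]

theorem IsCritical.addEdge {d k : ℕ} {G : SimpleGraph V} {v : V}
    (h : IsCritical d k G v) {p : V × V} (hp : p ∈ openPairs d G)
    (hv : ¬ (v = p.1 ∨ v = p.2)) : IsCritical d k (addEdge G p) v where
  degree_le := degree_addEdge_le hp h.degree_le
  degree_add := by rw [degree_addEdge hp, if_neg hv]; exact h.degree_add
  degree_add_one := by
    intro w hw hwv
    rw [h.unsat_addEdge hp hv, Finset.mem_sdiff] at hw
    rw [degree_addEdge hp, if_neg (by simpa using hw.2)]
    exact h.degree_add_one w hw.1 hwv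
  not_adj := by
    intro x hx y hy
    rw [h.unsat_addEdge hp hv, Finset.mem_sdiff] at hx hy
    have h1 := h.not_adj x hx.1 y hy.1
    have h2 := hx.2
    simp only [Finset.mem_insert, Finset.mem_singleton] at h2
    rw [addEdge_adj]
    tauto

theorem IsCritical.not_isSaturated {d k : ℕ} {G : SimpleGraph V} {v : V} (hk : 2 ≤ k)
    (h : IsCritical d k G v) : ¬ IsSaturated d G := by
  have h1 := h.degree_add
  rintro (h2 | ⟨w, hw, hw'⟩)
  · have := h2 v
    omega
  · by_cases hvw : v = w
    · subst hvw; omega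
    · have := hw' v hvw
      omega

/-- With `u` unsaturated vertices and all pairs open, `v` is avoided with probability `(u - 2) / u`.
Then two vertices of deficit 1 saturate and the graph is critical with `u - 2` unsaturated vertices;
otherwise it becomes safe. The product telescopes to `1 / u`, ending in failure at `u = 1`. -/
theorem IsCritical.iterate_stepExp_failure {d k : ℕ} (hk : k = 2 ∨ k = 3) {v : V} (r : ℕ) :
    ∀ {G : SimpleGraph V}, IsCritical d k G v → deficitSum d G % 2 = k % 2 →
      deficitSum d G ≤ 2 * r + 1 →
      (stepExp d)^[r] (failure d) G = 1 / (unsat d G).card := by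
  induction r with
  | zero =>
    intro G h _ hD
    have h1 := h.deficitSum_add_one (by omega)
    have h2 : 0 < (unsat d G).card := Finset.card_pos.mpr ⟨v, h.mem_unsat (by omega)⟩
    omega
  | succ r ih =>
    intro G h hpar hD
    have h1 := h.deficitSum_add_one (by omega)
    have hv := h.mem_unsat (by omega)
    have h2 : 0 < (unsat d G).card := Finset.card_pos.mpr ⟨v, hv⟩
    rcases openPairs_eq_empty_or (d := d) G with h0 | h0
    · rw [iterate_stepExp_of_eq_empty h0, failure, if_neg (h.not_isSaturated (by omega))]
      have h3 := Finset.offDiag_card (s := unsat d G)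
      rw [← h.openPairs_eq, h0, Finset.card_empty] at h3
      have h4 : (unsat d G).card = 1 := by
        by_contra h5
        have : 2 * (unsat d G).card ≤ (unsat d G).card * (unsat d G).card :=
          Nat.mul_le_mul_right _ (by omega)
        omega
      rw [h4]; simp
    · rw [Function.iterate_succ_apply', stepExp_of_nonempty h0]
      -- By parity and `D + 1 = u + k` the number `u` is odd, and `u = 1` would leave no open pair.
      have h3 : 3 ≤ (unsat d G).card := by
        have h4 : (unsat d G).card ≠ 1 := by
          intro h5
          have h6 := Finset.offDiag_card (s := unsat d G)
          rw [← h.openPairs_eq, h5] at h6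
          have := h0.card_pos
          omega
        omega
      obtain ⟨u, hu⟩ := Nat.exists_eq_add_of_le h3
      have hval : ∀ p ∈ openPairs d G, (stepExp d)^[r] (failure d) (DegreeBounded.addEdge G p) =
          if p ∈ ((unsat d G).erase v).offDiag then 1 / ((u : ℝ) + 1) else 0 := by
        intro p hp
        obtain ⟨hne, -, hp1, hp2⟩ := mem_openPairs.mp hp
        have hd2 := deficitSum_addEdge hp
        by_cases hvp : v = p.1 ∨ v = p.2
        · rw [(h.addEdge_isSafe (by omega) hpar hp hvp).iterate_stepExp_failure hk r (by omega),
            if_neg]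
          simp only [Finset.mem_offDiag, Finset.mem_erase]
          grind
        · rw [ih (h.addEdge hp hvp) (by omega) (by omega), if_pos, h.unsat_addEdge hp hvp,
            Finset.card_sdiff_of_subset, Finset.card_pair hne, hu]
          · congr 1
            rw [show 3 + u - 2 = u + 1 by omega]
            push_cast; ring
          · intro w hw
            simp only [Finset.mem_insert, Finset.mem_singleton] at hw
            rcases hw with rfl | rfl <;> assumption
          · simp only [Finset.mem_offDiag, Finset.mem_erase]
            grind
      rw [Finset.sum_congr rfl hval, ← Finset.sum_filter, Finset.sum_const, nsmul_eq_mul]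
      have hfil : (openPairs d G).filter (fun p => p ∈ ((unsat d G).erase v).offDiag) =
          ((unsat d G).erase v).offDiag := by
        rw [h.openPairs_eq]
        ext p
        simp only [Finset.mem_filter, Finset.mem_offDiag, Finset.mem_erase]
        tauto
      rw [hfil, h.openPairs_eq, Finset.offDiag_card, Finset.offDiag_card,
        Finset.card_erase_of_mem hv, hu]
      rw [show 3 + u - 1 = u + 2 by omega,
        show (u + 2) * (u + 2) - (u + 2) = (u + 2) * (u + 1) by
          rw [show (u + 2) * (u + 2) = (u + 2) * (u + 1) + (u + 2) by ring, Nat.add_sub_cancel],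
        show (3 + u) * (3 + u) - (3 + u) = (3 + u) * (u + 2) by
          rw [show (3 + u) * (3 + u) = (3 + u) * (u + 2) + (3 + u) by ring, Nat.add_sub_cancel]]
      push_cast
      field_simp

/-- A vertex of deficit at least `k` alone contributes `k - 1` to the excess, the most that is
allowed. So its deficit is exactly `k`, every other deficit is 1 and no edge joins two unsaturated
vertices. -/
theorem exists_isCritical {d k : ℕ} {G : SimpleGraph V} (hk : 2 ≤ k) (hG : ∀ v, G.degree v ≤ d)
    (hex : excess d G < k) (hne : (deficient d k G).Nonempty) :
    (deficient d k G).card = 1 ∧ ∃ v, IsCritical d k G v := by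
  obtain ⟨v, hv⟩ := hne
  have hvu := deficient_subset_unsat (by omega) G hv
  have h1 := excess_add_card (d := d) G
  have h2 := hv
  rw [mem_deficient] at h2
  have h3 : deficitSum d G = (d - G.degree v) + ∑ w ∈ (unsat d G).erase v, (d - G.degree w) := by
    rw [deficitSum_eq_sum_unsat]
    exact (Finset.add_sum_erase _ (fun w => d - G.degree w) hvu).symm
  have h4 : ∑ w ∈ (unsat d G).erase v, (d - G.degree w) =
      ((unsat d G).card - 1) + ∑ w ∈ (unsat d G).erase v, (d - G.degree w - 1) := by
    rw [← Finset.card_erase_of_mem hvu, Finset.card_eq_sum_ones, ← Finset.sum_add_distrib]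
    refine Finset.sum_congr rfl fun w hw => ?_
    have := mem_unsat.mp (Finset.mem_of_mem_erase hw)
    omega
  have h5 : 0 < (unsat d G).card := Finset.card_pos.mpr ⟨v, hvu⟩
  have h6 : ∑ w ∈ (unsat d G).erase v, (d - G.degree w - 1) = 0 := by omega
  have h7 : ∑ v ∈ unsat d G, ((G.neighborFinset v).filter fun w => w ∈ unsat d G).card = 0 := by
    omega
  have hone : ∀ w ∈ unsat d G, w ≠ v → G.degree w + 1 = d := by
    intro w hw hwv
    have := (Finset.sum_eq_zero_iff.mp h6) w (Finset.mem_erase.mpr ⟨hwv, hw⟩)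
    have := mem_unsat.mp hw
    omega
  refine ⟨?_, v, hG, by omega, hone, ?_⟩
  · rw [Finset.card_eq_one]
    refine ⟨v, ?_⟩
    ext w
    rw [Finset.mem_singleton]
    refine ⟨fun hw => ?_, fun h => h ▸ hv⟩
    by_contra hwv
    have := hone w (deficient_subset_unsat (by omega) G hw) hwv
    rw [mem_deficient] at hw
    omega
  · intro x hx y hy hadj
    have h8 := (Finset.sum_eq_zero_iff.mp h7) x hx
    rw [Finset.card_eq_zero, Finset.filter_eq_empty_iff] at h8
    exact h8 (by simpa using hadj) hy

/-- If the excess is below `k` the difference is zero: the graph is safe, or critical with `u = D -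
k + 1`. Otherwise the difference is at most `1 + D`, and the set of all unsaturated vertices, of
size `u ≤ D`, has scaled weight at least `b ^ k`. -/
theorem abs_iterate_stepExp_failure_sub_le {d k r : ℕ} {b : ℝ} {G : SimpleGraph V} (hb : 1 ≤ b)
    (hk : k = 2 ∨ k = 3) (hG : ∀ v, G.degree v ≤ d) (hpar : deficitSum d G % 2 = k % 2)
    (hr : deficitSum d G ≤ 2 * r + 1) (hkD : k ≤ deficitSum d G) :
    |(stepExp d)^[r] (failure d) G - (deficient d k G).card / (deficitSum d G - k + 1)| * b ^ k ≤
      (1 + deficitSum d G) * ∑ m ∈ Finset.range (deficitSum d G + 1),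
        b ^ (m * (d - 1)) * sumCutWeight d m b G := by
  have hkD' : (k : ℝ) ≤ deficitSum d G := by exact_mod_cast hkD
  have hnn : ∀ m, 0 ≤ b ^ (m * (d - 1)) * sumCutWeight d m b G := fun m =>
    mul_nonneg (by positivity) (sumCutWeight_nonneg (by linarith) G)
  rcases lt_or_ge (excess d G) k with hex | hex
  · have hzero : (stepExp d)^[r] (failure d) G -
        (deficient d k G).card / (deficitSum d G - k + 1) = 0 := by
      rcases (deficient d k G).eq_empty_or_nonempty with h0 | h0
      · have : IsSafe d k G := ⟨hG, hpar, hex, h0⟩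
        rw [this.iterate_stepExp_failure hk r hr, h0]
        simp
      · obtain ⟨h1, v, hv⟩ := exists_isCritical (by omega) hG hex h0
        rw [hv.iterate_stepExp_failure hk r hpar hr, h1]
        have h2 := hv.deficitSum_add_one (by omega)
        have h3 : (deficitSum d G : ℝ) + 1 = (unsat d G).card + k := by exact_mod_cast h2
        rw [show (deficitSum d G : ℝ) - k + 1 = (unsat d G).card by linarith]
        simp
    rw [hzero, abs_zero, zero_mul]
    exact mul_nonneg (by positivity) (Finset.sum_nonneg fun m _ => hnn m)
  · have h1 : |(stepExp d)^[r] (failure d) G -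
        (deficient d k G).card / (deficitSum d G - k + 1)| ≤ 1 + deficitSum d G := by
      have h2 := iterate_stepExp_nonneg_le_one (d := d) (f := failure (V := V) d)
        (fun G => by unfold failure; split_ifs <;> norm_num) r G
      have h3 : ((deficient d k G).card : ℝ) ≤ deficitSum d G := by
        exact_mod_cast (Finset.card_le_card (deficient_subset_unsat (by omega) G)).trans
          (card_unsat_le_deficitSum d G)
      have h4 : ((deficient d k G).card : ℝ) / (deficitSum d G - k + 1) ≤ deficitSum d G :=
        (div_le_self (by positivity) (by linarith)).trans h3
      have h5 : (0 : ℝ) ≤ (deficient d k G).card / (deficitSum d G - k + 1) :=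
        div_nonneg (by positivity) (by linarith)
      rw [abs_le]
      constructor <;> linarith
    refine mul_le_mul h1 ?_ (by positivity) (by positivity)
    have h2 : b ^ k ≤ b ^ ((unsat d G).card * (d - 1)) * sumCutWeight d (unsat d G).card b G := by
      have := card_mul_pow_le_sumCutWeight (d := d) (m := (unsat d G).card) (j := k) hb (G := G)
        {unsat d G} ?_
      · simpa using this
      · intro S hS
        rw [Finset.mem_singleton] at hS
        subst hS
        refine ⟨rfl, subset_rfl, ?_⟩
        have := cut_unsat_le (d := d) G
        unfold excess at hex
        omega
    refine h2.trans (Finset.single_le_sum (f := fun m => b ^ (m * (d - 1)) * sumCutWeight d m b G)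
      (fun m _ => hnn m) ?_)
    have := card_unsat_le_deficitSum d G
    rw [Finset.mem_range]
    omega

/-- Comparison of the probability of failure with the expected number of vertices of deficit at
least `k` when the total deficit is `D`. -/
theorem abs_expect_failure_sub_le {d k s D : ℕ} {b : ℝ} (hb : 1 ≤ b) (hk : k = 2 ∨ k = 3)
    (hs : D + 2 * s = d * Fintype.card V) (hD : d * d < D + 2) (hpar : D % 2 = k % 2)
    (hkD : k ≤ D) :
    |expect d (d * Fintype.card V / 2) (failure (V := V) d) -
        expect d s (fun G : SimpleGraph V => ((deficient d k G).card : ℝ)) / (D - k + 1)| * b ^ k ≤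
      (1 + D) * ∑ m ∈ Finset.range (D + 1),
        b ^ (m * (d - 1)) * expect d s (sumCutWeight (V := V) d m b) := by
  obtain ⟨r, hr⟩ := Nat.exists_eq_add_of_le (show s ≤ d * Fintype.card V / 2 by omega)
  rw [hr, expect_add]
  have e1 : expect d s (fun G : SimpleGraph V => ((deficient d k G).card : ℝ)) / (D - k + 1) =
      expect d s (fun G : SimpleGraph V => (D - k + 1 : ℝ)⁻¹ * (deficient d k G).card) := by
    rw [expect_const_mul, div_eq_inv_mul]
  have e2 : (1 + D) * ∑ m ∈ Finset.range (D + 1),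
        b ^ (m * (d - 1)) * expect d s (sumCutWeight (V := V) d m b) =
      b ^ k * expect d s (fun G : SimpleGraph V => (b ^ k)⁻¹ * ((1 + D) * ∑ m ∈ Finset.range (D + 1),
        b ^ (m * (d - 1)) * sumCutWeight d m b G)) := by
    rw [expect_const_mul, expect_const_mul, expect_sum]
    simp only [expect_const_mul]
    have : b ^ k ≠ 0 := by positivity
    field_simp
  rw [e1, e2, ← expect_sub_fun, mul_comm]
  refine mul_le_mul_of_nonneg_left (abs_expect_le fun G hG => ?_) (by positivity)
  have hDG := law_deficitSum hG (by omega)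
  have hDG' : deficitSum d G = D := by omega
  have h := abs_iterate_stepExp_failure_sub_le (r := r) hb hk (law_degree_le hG)
    (by rwa [hDG']) (by omega) (by omega)
  rw [hDG'] at h
  rw [le_inv_mul_iff₀ (by positivity), mul_comm, inv_mul_eq_div]
  exact h

/-! ### Truncated Poisson loads -/

/-- The Poisson weight `exp (-t) * t ^ j / j!`. -/
noncomputable def poissonWeight (t : ℝ) (j : ℕ) : ℝ := Real.exp (-t) * t ^ j / j.factorial

/-- The law of a Poisson variable of mean `t` truncated at `d`. -/
noncomputable def truncWeight (d : ℕ) (t : ℝ) (j : ℕ) : ℝ :=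
  if j < d then poissonWeight t j
  else if j = d then 1 - ∑ i ∈ Finset.range d, poissonWeight t i else 0

theorem poissonWeight_nonneg {t : ℝ} (ht : 0 ≤ t) (j : ℕ) : 0 ≤ poissonWeight t j := by
  unfold poissonWeight; positivity

theorem sum_poissonWeight_le_one {t : ℝ} (ht : 0 ≤ t) (d : ℕ) :
    ∑ i ∈ Finset.range d, poissonWeight t i ≤ 1 := by
  have h := Real.sum_le_exp_of_nonneg ht d
  have : ∑ i ∈ Finset.range d, poissonWeight t i =
      Real.exp (-t) * ∑ i ∈ Finset.range d, t ^ i / i.factorial := by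
    rw [Finset.mul_sum]
    exact Finset.sum_congr rfl fun i _ => by rw [poissonWeight, mul_div_assoc]
  rw [this]
  calc Real.exp (-t) * ∑ i ∈ Finset.range d, t ^ i / i.factorial
      ≤ Real.exp (-t) * Real.exp t := by gcongr
    _ = 1 := by rw [← Real.exp_add]; simp

theorem poissonWeight_le_one {t : ℝ} (ht : 0 ≤ t) (j : ℕ) : poissonWeight t j ≤ 1 :=
  (Finset.single_le_sum (fun i _ => poissonWeight_nonneg ht i)
    (Finset.self_mem_range_succ j)).trans (sum_poissonWeight_le_one ht (j + 1))

/-- The weight at `t` is `2 ^ j * exp (-t / 2)` times the weight at `t / 2`, which is at most 1. The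
decay makes integrals over all times converge. -/
theorem poissonWeight_le {t : ℝ} (ht : 0 ≤ t) (j : ℕ) :
    poissonWeight t j ≤ 2 ^ j * Real.exp (-(1 / 2) * t) := by
  have h := poissonWeight_le_one (t := t / 2) (by linarith) j
  unfold poissonWeight at h ⊢
  have e1 : Real.exp (-t) = Real.exp (-(t / 2)) * Real.exp (-(1 / 2) * t) := by
    rw [← Real.exp_add]; congr 1; ring
  have e2 : t ^ j = 2 ^ j * (t / 2) ^ j := by rw [← mul_pow]; congr 1; ring
  rw [e1, e2]
  calc Real.exp (-(t / 2)) * Real.exp (-(1 / 2) * t) * (2 ^ j * (t / 2) ^ j) / j.factorial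
      = 2 ^ j * Real.exp (-(1 / 2) * t) *
        (Real.exp (-(t / 2)) * (t / 2) ^ j / j.factorial) := by ring
    _ ≤ 2 ^ j * Real.exp (-(1 / 2) * t) * 1 := by gcongr
    _ = _ := mul_one _

theorem hasDerivAt_poissonWeight (t : ℝ) (j : ℕ) :
    HasDerivAt (fun t => poissonWeight t j)
      ((if j = 0 then 0 else poissonWeight t (j - 1)) - poissonWeight t j) t := by
  unfold poissonWeight
  have h1 : HasDerivAt (fun t : ℝ => Real.exp (-t)) (-Real.exp (-t)) t := by
    simpa using (hasDerivAt_neg t).exp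
  have h2 := (h1.mul (hasDerivAt_pow j t)).div_const (j.factorial : ℝ)
  refine h2.congr_deriv ?_
  rcases j with _ | j
  · simp
  · rw [if_neg (Nat.succ_ne_zero j), Nat.factorial_succ]
    simp only [Nat.add_sub_cancel]
    push_cast
    field_simp
    ring

theorem hasDerivAt_sum_poissonWeight (t : ℝ) (d : ℕ) :
    HasDerivAt (fun t => ∑ i ∈ Finset.range d, poissonWeight t i)
      (if d = 0 then 0 else -poissonWeight t (d - 1)) t := by
  refine (HasDerivAt.fun_sum fun i _ => hasDerivAt_poissonWeight t i).congr_deriv ?_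
  induction d with
  | zero => simp
  | succ d ih =>
    rw [Finset.sum_range_succ, ih]
    rcases d with _ | d
    · simp
    · simp only [Nat.add_one_ne_zero, if_false, Nat.add_sub_cancel]
      ring

/-- These are the forward equations of a bin that receives balls at rate 1 until it holds `d` of
them. -/
theorem hasDerivAt_truncWeight (d : ℕ) (t : ℝ) {j : ℕ} (hj : j ≤ d) :
    HasDerivAt (fun t => truncWeight d t j)
      ((if j = 0 then 0 else truncWeight d t (j - 1)) - if j < d then truncWeight d t j else 0)
      t := by
  unfold truncWeight
  rcases hj.lt_or_eq with h | rfl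
  · have h' : j - 1 < d := by omega
    simp only [h, h', if_true]
    exact hasDerivAt_poissonWeight t j
  · simp only [lt_irrefl, if_false, if_true, sub_zero]
    refine ((hasDerivAt_sum_poissonWeight t j).const_sub 1).congr_deriv ?_
    split_ifs with h1 h2
    · exact neg_zero
    · rw [neg_neg]
    · omega
    · omega

theorem truncWeight_nonneg {t : ℝ} (ht : 0 ≤ t) (d j : ℕ) : 0 ≤ truncWeight d t j := by
  unfold truncWeight
  split_ifs
  · exact poissonWeight_nonneg ht j
  · linarith [sum_poissonWeight_le_one ht d]
  · exact le_rfl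

theorem truncWeight_le_one {t : ℝ} (ht : 0 ≤ t) (d j : ℕ) : truncWeight d t j ≤ 1 := by
  unfold truncWeight
  split_ifs
  · exact poissonWeight_le_one ht j
  · linarith [Finset.sum_nonneg fun i (_ : i ∈ Finset.range d) => poissonWeight_nonneg ht i]
  · exact zero_le_one

theorem sum_truncWeight (d : ℕ) (t : ℝ) : ∑ j ∈ Finset.range (d + 1), truncWeight d t j = 1 := by
  rw [Finset.sum_range_succ, Finset.sum_congr rfl (g := fun j => poissonWeight t j)]
  · simp [truncWeight]
  · intro j hj
    simp [truncWeight, Finset.mem_range.mp hj]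

theorem truncWeight_zero {d j : ℕ} (hj : j ≠ 0) : truncWeight d 0 j = 0 := by
  unfold truncWeight
  split_ifs with h1 h2
  · simp [poissonWeight, hj]
  · subst h2
    obtain ⟨i, rfl⟩ := Nat.exists_eq_succ_of_ne_zero hj
    rw [Finset.sum_range_succ']
    simp [poissonWeight]
  · rfl

/-- The probability that independent truncated Poisson loads are `c`. -/
noncomputable def loadWeight (d : ℕ) (t : ℝ) (c : V → ℕ) : ℝ := ∏ v, truncWeight d t (c v)

theorem loadWeight_nonneg {t : ℝ} (ht : 0 ≤ t) (d : ℕ) (c : V → ℕ) : 0 ≤ loadWeight d t c :=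
  Finset.prod_nonneg fun _ _ => truncWeight_nonneg ht _ _

theorem loadWeight_le {d : ℕ} {t : ℝ} (ht : 0 ≤ t) {c : V → ℕ} {v : V} (hv : c v < d) :
    loadWeight d t c ≤ 2 ^ c v * Real.exp (-(1 / 2) * t) := by
  unfold loadWeight
  rw [← Finset.mul_prod_erase _ _ (Finset.mem_univ v)]
  have h1 : ∏ w ∈ Finset.univ.erase v, truncWeight d t (c w) ≤ 1 :=
    Finset.prod_le_one (fun _ _ => truncWeight_nonneg ht _ _) fun _ _ => truncWeight_le_one ht _ _
  have h2 : truncWeight d t (c v) = poissonWeight t (c v) := if_pos hv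
  calc truncWeight d t (c v) * ∏ w ∈ Finset.univ.erase v, truncWeight d t (c w)
      ≤ truncWeight d t (c v) * 1 :=
        mul_le_mul_of_nonneg_left h1 (truncWeight_nonneg ht _ _)
    _ ≤ _ := by rw [mul_one, h2]; exact poissonWeight_le ht _

theorem continuous_poissonWeight (j : ℕ) : Continuous fun t => poissonWeight t j := by
  unfold poissonWeight; fun_prop

theorem continuous_loadWeight (d : ℕ) (c : V → ℕ) : Continuous fun t => loadWeight d t c := by
  refine continuous_finsetProd _ fun v _ => ?_
  unfold truncWeight
  split_ifs
  · exact continuous_poissonWeight _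
  · exact continuous_const.sub (continuous_finsetSum _ fun i _ => continuous_poissonWeight i)
  · exact continuous_const

theorem integrableOn_loadWeight {d : ℕ} {c : V → ℕ} {v : V} (hv : c v < d) :
    MeasureTheory.IntegrableOn (fun t => loadWeight d t c) (Set.Ioi 0) := by
  refine MeasureTheory.Integrable.mono'
    (g := fun t => 2 ^ c v * Real.exp (-(1 / 2) * t))
    ((exp_neg_integrableOn_Ioi 0 (by norm_num : (0 : ℝ) < 1 / 2)).const_mul _)
    (continuous_loadWeight d c).aestronglyMeasurable ?_
  refine (MeasureTheory.ae_restrict_iff' measurableSet_Ioi).mpr (Filter.Eventually.of_forall ?_)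
  intro t ht
  have ht' : 0 ≤ t := le_of_lt ht
  rw [Real.norm_of_nonneg (loadWeight_nonneg ht' d c)]
  exact loadWeight_le ht' hv

theorem tendsto_loadWeight {d : ℕ} {c : V → ℕ} {v : V} (hv : c v < d) :
    Tendsto (fun t => loadWeight d t c) atTop (nhds 0) := by
  refine squeeze_zero' (g := fun t => 2 ^ c v * Real.exp (-(1 / 2) * t)) ?_ ?_ ?_
  · filter_upwards [eventually_ge_atTop 0] with t ht using loadWeight_nonneg ht d c
  · filter_upwards [eventually_ge_atTop 0] with t ht using loadWeight_le ht hv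
  · have h1 : Tendsto (fun t : ℝ => -(1 / 2) * t) atTop atBot :=
      tendsto_id.const_mul_atTop_of_neg (by norm_num)
    have := (Real.tendsto_exp_atBot.comp h1).const_mul ((2 : ℝ) ^ c v)
    simpa using this

/-- The time that growing independent truncated Poisson loads spend in the configuration `c`. -/
noncomputable def occupation (d : ℕ) (c : V → ℕ) : ℝ := ∫ t in Set.Ioi 0, loadWeight d t c

theorem occupation_nonneg (d : ℕ) (c : V → ℕ) : 0 ≤ occupation d c :=
  MeasureTheory.setIntegral_nonneg measurableSet_Ioi fun _ ht =>
    loadWeight_nonneg (le_of_lt ht) d c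

/-- The vertices of load less than `d`. -/
noncomputable def lowVertices (d : ℕ) (c : V → ℕ) : Finset V := Finset.univ.filter fun v => c v < d

theorem mem_lowVertices {d : ℕ} {c : V → ℕ} {v : V} : v ∈ lowVertices d c ↔ c v < d := by
  simp [lowVertices]

/-- The load `c` with one unit removed at `v`. -/
noncomputable def decr (c : V → ℕ) (v : V) : V → ℕ := Function.update c v (c v - 1)

theorem loadWeight_update (d : ℕ) (t : ℝ) (c : V → ℕ) (v : V) (j : ℕ) :
    loadWeight d t (Function.update c v j) =
      (∏ w ∈ Finset.univ.erase v, truncWeight d t (c w)) * truncWeight d t j := by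
  unfold loadWeight
  rw [← Finset.prod_erase_mul _ _ (Finset.mem_univ v), Function.update_self]
  congr 1
  refine Finset.prod_congr rfl fun w hw => ?_
  rw [Function.update_of_ne (Finset.ne_of_mem_erase hw)]

theorem hasDerivAt_loadWeight {d : ℕ} {c : V → ℕ} (hc : ∀ v, c v ≤ d) (t : ℝ) :
    HasDerivAt (fun t => loadWeight d t c)
      (∑ v, ((if c v = 0 then 0 else loadWeight d t (decr c v)) -
        if c v < d then loadWeight d t c else 0)) t := by
  have h := HasDerivAt.fun_finsetProd (u := Finset.univ) (x := t)
    (f := fun v t => truncWeight d t (c v)) fun v _ => hasDerivAt_truncWeight d t (hc v)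
  refine h.congr_deriv (Finset.sum_congr rfl fun v _ => ?_)
  rw [smul_eq_mul, mul_sub, decr, loadWeight_update]
  have : loadWeight d t c =
      (∏ w ∈ Finset.univ.erase v, truncWeight d t (c w)) * truncWeight d t (c v) := by
    rw [← loadWeight_update, Function.update_eq_self]
  rw [this]
  split_ifs <;> simp

/-- Integrating the forward equation over all times gives a balance of flow, as the probability of
`c` vanishes at both ends: `c ≠ 0` at time 0, a bin that is not full at infinity. The left side is
the outflow, which is also the probability that the balls ever pass through `c`. -/
theorem card_lowVertices_mul_occupation {d : ℕ} {c : V → ℕ} (hc : ∀ v, c v ≤ d) (hc0 : c ≠ 0)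
    (hlow : (lowVertices d c).Nonempty) :
    (lowVertices d c).card * occupation d c =
      ∑ v ∈ Finset.univ.filter (fun v => c v ≠ 0), occupation d (decr c v) := by
  obtain ⟨v₀, hv₀⟩ := hlow
  rw [mem_lowVertices] at hv₀
  have hint1 : ∀ v, MeasureTheory.IntegrableOn
      (fun t => if c v = 0 then 0 else loadWeight d t (decr c v)) (Set.Ioi 0) := by
    intro v
    split_ifs with h
    · exact MeasureTheory.integrableOn_zero
    · refine integrableOn_loadWeight (v := v) ?_
      have := hc v
      simp only [decr, Function.update_self]
      omega
  have hint2 : ∀ v, MeasureTheory.IntegrableOn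
      (fun t => if c v < d then loadWeight d t c else 0) (Set.Ioi 0) := by
    intro v
    split_ifs with h
    · exact integrableOn_loadWeight hv₀
    · exact MeasureTheory.integrableOn_zero
  have hint : ∀ v ∈ Finset.univ, MeasureTheory.IntegrableOn
      (fun t => (if c v = 0 then 0 else loadWeight d t (decr c v)) -
        if c v < d then loadWeight d t c else 0) (Set.Ioi 0) :=
    fun v _ => (hint1 v).sub (hint2 v)
  have key := MeasureTheory.integral_Ioi_of_hasDerivAt_of_tendsto
    (continuous_loadWeight d c).continuousWithinAt (fun t _ => hasDerivAt_loadWeight hc t)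
    (MeasureTheory.integrable_finsetSum _ hint) (tendsto_loadWeight hv₀)
  have hzero : loadWeight d 0 c = 0 := by
    obtain ⟨v, hv⟩ := Function.ne_iff.mp hc0
    exact Finset.prod_eq_zero (Finset.mem_univ v) (truncWeight_zero hv)
  rw [hzero, sub_zero, MeasureTheory.integral_finsetSum _ hint] at key
  have h1 : ∀ v, ∫ t in Set.Ioi 0, ((if c v = 0 then 0 else loadWeight d t (decr c v)) -
        if c v < d then loadWeight d t c else 0) =
      (if c v ≠ 0 then occupation d (decr c v) else 0) -
        if c v < d then occupation d c else 0 := by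
    intro v
    rw [MeasureTheory.integral_sub (hint1 v) (hint2 v)]
    congr 1
    · split_ifs <;> simp [occupation] <;> omega
    · split_ifs <;> simp [occupation]
  simp only [h1] at key
  rw [Finset.sum_sub_distrib, ← Finset.sum_filter, ← Finset.sum_filter, Finset.sum_const,
    nsmul_eq_mul] at key
  unfold lowVertices
  linarith

theorem card_mul_occupation_zero {d : ℕ} (hd : 1 ≤ d) [Nonempty V] :
    (lowVertices d (0 : V → ℕ)).card * occupation d (0 : V → ℕ) = 1 := by
  have h1 : lowVertices d (0 : V → ℕ) = Finset.univ := by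
    ext v
    simp [mem_lowVertices]; omega
  have h2 : ∀ t, loadWeight d t (0 : V → ℕ) = Real.exp (-(Fintype.card V : ℝ) * t) := by
    intro t
    have : truncWeight d t 0 = Real.exp (-t) := by
      simp [truncWeight, poissonWeight, show 0 < d by omega]
    simp only [loadWeight, Pi.zero_apply, this, Finset.prod_const, Finset.card_univ]
    rw [← Real.exp_nat_mul]
    congr 1; ring
  have hn : (0 : ℝ) < Fintype.card V := by exact_mod_cast Fintype.card_pos
  rw [h1, Finset.card_univ, occupation]
  simp only [h2]
  rw [integral_exp_mul_Ioi (by linarith)]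
  simp

/-! ### Comparison of the process with truncated Poisson loads -/

theorem lowVertices_decr_subset (d : ℕ) (c : V → ℕ) (v : V) :
    lowVertices d c ⊆ lowVertices d (decr c v) := by
  intro w hw
  rw [mem_lowVertices] at hw ⊢
  unfold decr
  by_cases h : w = v
  · subst h; rw [Function.update_self]; omega
  · rwa [Function.update_of_ne h]

theorem decr_le {d : ℕ} {c : V → ℕ} (hc : ∀ v, c v ≤ d) (v w : V) : decr c v w ≤ d := by
  unfold decr
  by_cases h : w = v
  · subst h; rw [Function.update_self]; have := hc w; omega
  · rw [Function.update_of_ne h]; exact hc w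

theorem mem_lowVertices_decr {d : ℕ} {c : V → ℕ} (hc : ∀ v, c v ≤ d) {v : V} (hv : c v ≠ 0) :
    v ∈ lowVertices d (decr c v) := by
  rw [mem_lowVertices]
  unfold decr
  rw [Function.update_self]
  have := hc v
  omega

/-- The pairs at which a unit of load can be removed from `c`. -/
noncomputable def loadPairs (c : V → ℕ) : Finset (V × V) :=
  Finset.univ.filter fun p => p.1 ≠ p.2 ∧ c p.1 ≠ 0 ∧ c p.2 ≠ 0

/-- One edge is compared with two successive balls in distinct bins, so the flow balance is applied
twice. The first ball can only reduce the number of bins that are not full, so the second goes to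
its bin with at least the probability it had before; hence the inequality. -/
theorem sum_occupation_decr_decr_le {d : ℕ} {c : V → ℕ} (hc : ∀ v, c v ≤ d)
    (hlow : (lowVertices d c).Nonempty) :
    ∑ p ∈ loadPairs c, occupation d (decr (decr c p.1) p.2) /
        (lowVertices d (decr (decr c p.1) p.2)).card ≤
      (lowVertices d c).card * occupation d c := by
  by_cases hc0 : c = 0
  · subst hc0
    simp only [loadPairs, Pi.zero_apply, ne_eq, not_true_eq_false, and_false, Finset.filter_false,
      Finset.sum_empty]
    exact mul_nonneg (by positivity) (occupation_nonneg _ _)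
  rw [card_lowVertices_mul_occupation hc hc0 hlow]
  have hsplit : ∑ p ∈ loadPairs c, occupation d (decr (decr c p.1) p.2) /
        (lowVertices d (decr (decr c p.1) p.2)).card =
      ∑ v ∈ Finset.univ.filter (fun v => c v ≠ 0),
        ∑ w ∈ Finset.univ.filter (fun w => v ≠ w ∧ c w ≠ 0),
          occupation d (decr (decr c v) w) / (lowVertices d (decr (decr c v) w)).card := by
    rw [Finset.sum_sigma']
    refine Finset.sum_bij' (fun p _ => ⟨p.1, p.2⟩) (fun q _ => (q.1, q.2)) ?_ ?_ ?_ ?_ ?_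
    · intro p hp
      simp only [loadPairs, Finset.mem_filter, Finset.mem_univ, true_and] at hp
      simp only [Finset.mem_sigma, Finset.mem_filter, Finset.mem_univ, true_and]
      tauto
    · intro q hq
      simp only [Finset.mem_sigma, Finset.mem_filter, Finset.mem_univ, true_and] at hq
      simp only [loadPairs, Finset.mem_filter, Finset.mem_univ, true_and]
      tauto
    · intros; rfl
    · intros; rfl
    · intros; rfl
  rw [hsplit]
  refine Finset.sum_le_sum fun v hv => ?_
  rw [Finset.mem_filter] at hv
  have hvlow := mem_lowVertices_decr hc hv.2
  have hpos : (0 : ℝ) < (lowVertices d (decr c v)).card := by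
    exact_mod_cast Finset.card_pos.mpr ⟨v, hvlow⟩
  have h1 : ∑ w ∈ Finset.univ.filter (fun w => v ≠ w ∧ c w ≠ 0),
      occupation d (decr (decr c v) w) / (lowVertices d (decr (decr c v) w)).card ≤
      (∑ w ∈ Finset.univ.filter (fun w => decr c v w ≠ 0), occupation d (decr (decr c v) w)) /
        (lowVertices d (decr c v)).card := by
    rw [Finset.sum_div]
    refine (Finset.sum_le_sum fun w _ => ?_).trans (Finset.sum_le_sum_of_subset_of_nonneg
      (f := fun w => occupation d (decr (decr c v) w) / (lowVertices d (decr c v)).card) ?_ ?_)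
    · have := Finset.card_le_card (lowVertices_decr_subset d (decr c v) w)
      have h2 : ((lowVertices d (decr c v)).card : ℝ) ≤
        (lowVertices d (decr (decr c v) w)).card := by exact_mod_cast this
      have := occupation_nonneg d (decr (decr c v) w)
      gcongr
    · intro w hw
      simp only [Finset.mem_filter, Finset.mem_univ, true_and] at hw ⊢
      rw [decr, Function.update_of_ne hw.1.symm]
      exact hw.2
    · intro w _ _
      exact div_nonneg (occupation_nonneg _ _) hpos.le
  refine h1.trans ?_
  rw [div_le_iff₀ hpos, mul_comm]
  by_cases hz : decr c v = 0
  · rw [hz]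
    simp only [Pi.zero_apply, ne_eq, not_true_eq_false, Finset.filter_false, Finset.sum_empty]
    exact mul_nonneg (by positivity) (occupation_nonneg _ _)
  · rw [card_lowVertices_mul_occupation (decr_le hc v) hz ⟨v, hvlow⟩]

/-- The indicator of the graphs with degree sequence `c`. -/
noncomputable def degreeIndicator (c : V → ℕ) (G : SimpleGraph V) : ℝ :=
  if (fun v => G.degree v) = c then 1 else 0

theorem degreeIndicator_addEdge_le {d : ℕ} {G : SimpleGraph V} {p : V × V}
    (hp : p ∈ openPairs d G) {c : V → ℕ} (h : (fun v => (addEdge G p).degree v) = c) :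
    p ∈ loadPairs c ∧ (fun v => G.degree v) = decr (decr c p.1) p.2 := by
  have hne := (mem_openPairs.mp hp).1
  subst h
  constructor
  · simp only [loadPairs, Finset.mem_filter, Finset.mem_univ, true_and, degree_addEdge hp]
    simp [hne]
  · ext v
    unfold decr
    by_cases h2 : v = p.2
    · subst h2
      rw [Function.update_self, Function.update_of_ne hne.symm, degree_addEdge hp]
      simp
    · rw [Function.update_of_ne h2]
      by_cases h1 : v = p.1
      · subst h1
        rw [Function.update_self]
        simp only [degree_addEdge hp]
        simp
      · rw [Function.update_of_ne h1, degree_addEdge hp]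
        simp [h1, h2]

/-- A new edge `p` determines the previous degree sequence, and there are at least `u * (u - d)`
open pairs, so each has probability at most `(1 + 2 * d / u) / u ^ 2`; finally `D ≤ d * u`. -/
theorem stepExp_degreeIndicator_le {d : ℕ} {D : ℝ} (hd : 1 ≤ d) {G : SimpleGraph V}
    (hD : (deficitSum d G : ℝ) = D) (hD2 : 2 * (d : ℝ) ^ 2 ≤ D) (c : V → ℕ) :
    stepExp d (degreeIndicator c) G ≤ ∑ p ∈ loadPairs c, (1 + 2 * d ^ 2 / D) *
      ((1 / ((lowVertices d (decr (decr c p.1) p.2)).card : ℝ) ^ 2) *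
        degreeIndicator (decr (decr c p.1) p.2) G) := by
  have hd' : (1 : ℝ) ≤ d := by exact_mod_cast hd
  have hD0 : 0 < D := by nlinarith
  have hDu : D ≤ d * (unsat d G).card := by rw [← hD]; exact_mod_cast deficitSum_le d G
  have hu : 2 * (d : ℝ) ≤ (unsat d G).card := by
    by_contra h
    push Not at h
    nlinarith
  have hne : (openPairs d G).Nonempty := openPairs_nonempty_of_lt (by
    have : (d : ℝ) < (unsat d G).card := by linarith
    exact_mod_cast this)
  have hA : (0 : ℝ) < (openPairs d G).card := by exact_mod_cast hne.card_pos
  have hAl := le_card_openPairs (d := d) G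
  have hu0 : (0 : ℝ) < (unsat d G).card := by linarith
  have hinv : 1 / ((openPairs d G).card : ℝ) ≤
      (1 + 2 * d ^ 2 / D) * (1 / ((unsat d G).card : ℝ) ^ 2) := by
    have h1 : (1 : ℝ) ≤ (1 + 2 * d / (unsat d G).card) * (1 - d / (unsat d G).card) := by
      have : (1 + 2 * (d : ℝ) / (unsat d G).card) * (1 - d / (unsat d G).card) =
          1 + d / (unsat d G).card * (1 - 2 * d / (unsat d G).card) := by ring
      rw [this]
      have h2 : 2 * (d : ℝ) / (unsat d G).card ≤ 1 := by rw [div_le_one hu0]; exact hu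
      have h3 : (0 : ℝ) ≤ d / (unsat d G).card * (1 - 2 * d / (unsat d G).card) :=
        mul_nonneg (by positivity) (by linarith)
      linarith
    have h2 : 2 * (d : ℝ) / (unsat d G).card ≤ 2 * d ^ 2 / D := by
      rw [div_le_div_iff₀ hu0 hD0]; nlinarith
    have h3 : ((unsat d G).card : ℝ) ^ 2 ≤ (1 + 2 * d ^ 2 / D) * (openPairs d G).card := by
      calc ((unsat d G).card : ℝ) ^ 2 = ((unsat d G).card : ℝ) ^ 2 * 1 := (mul_one _).symm
        _ ≤ ((unsat d G).card : ℝ) ^ 2 *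
            ((1 + 2 * d / (unsat d G).card) * (1 - d / (unsat d G).card)) := by gcongr
        _ = (1 + 2 * d / (unsat d G).card) * ((unsat d G).card * ((unsat d G).card - d)) := by
            field_simp
        _ ≤ (1 + 2 * d ^ 2 / D) * (openPairs d G).card := by
            gcongr
            exact mul_nonneg hu0.le (by linarith)
    rw [mul_one_div, div_le_div_iff₀ hA (by positivity)]
    linarith
  rw [stepExp_of_nonempty hne, div_eq_mul_one_div, Finset.sum_mul]
  have hterm : ∀ p ∈ openPairs d G, degreeIndicator c (addEdge G p) * (1 / (openPairs d G).card) ≤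
      if p ∈ loadPairs c then (1 + 2 * d ^ 2 / D) *
      ((1 / ((lowVertices d (decr (decr c p.1) p.2)).card : ℝ) ^ 2) *
        degreeIndicator (decr (decr c p.1) p.2) G) else 0 := by
    intro p hp
    by_cases h : (fun v => (addEdge G p).degree v) = c
    · obtain ⟨h1, h2⟩ := degreeIndicator_addEdge_le hp h
      have h3 : lowVertices d (decr (decr c p.1) p.2) = unsat d G := by
        rw [← h2]; rfl
      rw [degreeIndicator, if_pos h, if_pos h1, degreeIndicator, if_pos h2, h3, one_mul, mul_one]
      exact hinv
    · rw [degreeIndicator, if_neg h, zero_mul]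
      split_ifs
      · unfold degreeIndicator
        split_ifs <;> positivity
      · exact le_rfl
  refine (Finset.sum_le_sum hterm).trans ?_
  rw [← Finset.sum_filter, Finset.filter_mem_eq_inter]
  refine Finset.sum_le_sum_of_subset_of_nonneg Finset.inter_subset_right fun p _ _ => ?_
  unfold degreeIndicator
  split_ifs <;> positivity

/-- The probability of a degree sequence is at most a power of the number of vertices times the
probability that balls thrown into bins of capacity `d` pass through it. -/
theorem expect_degreeIndicator_le {d : ℕ} (hd : 1 ≤ d) [Nonempty V] (s : ℕ)
    (hs : 2 * (d * d) + 2 * s + 2 ≤ d * Fintype.card V) {c : V → ℕ} (hc : ∀ v, c v ≤ d) :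
    expect d s (degreeIndicator c) ≤
      ((d * Fintype.card V : ℕ) / ((d * Fintype.card V : ℕ) - 2 * s) : ℝ) ^ (d * d) *
        ((lowVertices d c).card * occupation d c) := by
  have hd' : (1 : ℝ) ≤ d := by exact_mod_cast hd
  induction s generalizing c with
  | zero =>
    have hM : (0 : ℝ) < (d * Fintype.card V : ℕ) := by
      exact_mod_cast Nat.mul_pos hd Fintype.card_pos
    rw [expect_zero]
    simp only [Nat.cast_zero, mul_zero, sub_zero]
    rw [div_self hM.ne', one_pow, one_mul]
    unfold degreeIndicator
    split_ifs with h
    · have : c = 0 := by rw [← h]; ext v; simp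
      rw [this, card_mul_occupation_zero hd]
    · exact mul_nonneg (by positivity) (occupation_nonneg _ _)
  | succ s ih =>
    have hs' : ((2 * (d * d) + 2 * (s + 1) + 2 : ℕ) : ℝ) ≤ (d * Fintype.card V : ℕ) := by
      exact_mod_cast hs
    push_cast at hs'
    set M : ℝ := ((d * Fintype.card V : ℕ) : ℝ) with hM
    have hMd : M = d * Fintype.card V := by rw [hM]; push_cast; rfl
    rw [← hMd] at hs'
    have hD : 2 * (d : ℝ) ^ 2 + 4 ≤ M - 2 * s := by nlinarith
    have hM0 : 0 ≤ M := by positivity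
    have e : M - 2 * ((s + 1 : ℕ) : ℝ) = M - 2 * s - 2 := by push_cast; ring
    rw [e]
    have hD2 : (0 : ℝ) < M - 2 * s - 2 := by nlinarith
    have hD0 : (0 : ℝ) < M - 2 * s := by linarith
    -- If every bin is full the right side is zero, and so is the left, because the total deficit is
    -- still positive at this time.
    rcases (lowVertices d c).eq_empty_or_nonempty with hlow | hlow
    · rw [hlow]
      simp only [Finset.card_empty, Nat.cast_zero, zero_mul, mul_zero]
      refine (expect_mono (g := fun _ => 0) fun G hG => ?_).trans (expect_const d (s + 1) 0).le
      have hDG := law_deficitSum hG (by omega)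
      unfold degreeIndicator
      rw [if_neg]
      intro h
      have : unsat d G = ∅ := by rw [← hlow, ← h]; rfl
      have h2 := deficitSum_le d G
      rw [this, Finset.card_empty, mul_zero] at h2
      omega
    · have h1 : expect d (s + 1) (degreeIndicator c) ≤ ∑ p ∈ loadPairs c,
          (1 + 2 * d ^ 2 / (M - 2 * s)) *
            ((1 / ((lowVertices d (decr (decr c p.1) p.2)).card : ℝ) ^ 2) *
            expect d s (degreeIndicator (decr (decr c p.1) p.2))) := by
        rw [expect_succ]
        simp only [← expect_const_mul]
        rw [← expect_sum]
        refine expect_mono fun G hG => ?_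
        exact stepExp_degreeIndicator_le hd (law_deficitSum_cast hG (by omega)) (by linarith) c
      have h2 : ∀ p ∈ loadPairs c, (1 + 2 * d ^ 2 / (M - 2 * s)) *
            ((1 / ((lowVertices d (decr (decr c p.1) p.2)).card : ℝ) ^ 2) *
            expect d s (degreeIndicator (decr (decr c p.1) p.2))) ≤
          (1 + 2 * d ^ 2 / (M - 2 * s)) * (M / (M - 2 * s)) ^ (d * d) *
            (occupation d (decr (decr c p.1) p.2) /
              (lowVertices d (decr (decr c p.1) p.2)).card) := by
        intro p hp
        simp only [loadPairs, Finset.mem_filter, Finset.mem_univ, true_and] at hp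
        have h3 := ih (by omega) (decr_le (decr_le hc p.1) p.2)
        have h4 : decr c p.1 p.2 ≠ 0 := by
          rw [decr, Function.update_of_ne hp.1.symm]; exact hp.2.2
        have h5 := mem_lowVertices_decr (decr_le hc p.1) h4
        have h6 : (0 : ℝ) < (lowVertices d (decr (decr c p.1) p.2)).card := by
          exact_mod_cast Finset.card_pos.mpr ⟨_, h5⟩
        rw [mul_assoc]
        refine mul_le_mul_of_nonneg_left ?_ (by positivity)
        refine (mul_le_mul_of_nonneg_left h3 (by positivity)).trans (le_of_eq ?_)
        field_simp
      refine (h1.trans (Finset.sum_le_sum h2)).trans ?_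
      rw [← Finset.mul_sum]
      refine mul_le_mul ?_ (sum_occupation_decr_decr_le hc hlow)
        (Finset.sum_nonneg fun p _ => div_nonneg (occupation_nonneg _ _) (by positivity))
        (by positivity)
      -- By Bernoulli's inequality the error factor of one step is at most the ratio of successive
      -- values of `D ^ (-(d * d))`; this is the source of the exponent `d * d`.
      have h7 : 1 + 2 * (d : ℝ) ^ 2 / (M - 2 * s) ≤
          ((M - 2 * s) / (M - 2 * s - 2)) ^ (d * d) := by
        have bern := one_add_mul_le_pow (a := 2 / (M - 2 * s - 2))
          (by have : 0 ≤ 2 / (M - 2 * s - 2) := by positivity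
              linarith) (d * d)
        have e2 : (M - 2 * s) / (M - 2 * s - 2) = 1 + 2 / (M - 2 * s - 2) := by
          field_simp; ring
        rw [e2]
        refine le_trans ?_ bern
        have : 2 / (M - 2 * s) ≤ 2 / (M - 2 * s - 2) := by
          apply div_le_div_of_nonneg_left <;> linarith
        have h8 : 2 * (d : ℝ) ^ 2 / (M - 2 * s) = d ^ 2 * (2 / (M - 2 * s)) := by ring
        rw [h8]
        push_cast
        rw [← pow_two]
        gcongr
      calc (1 + 2 * d ^ 2 / (M - 2 * s)) * (M / (M - 2 * s)) ^ (d * d)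
          ≤ ((M - 2 * s) / (M - 2 * s - 2)) ^ (d * d) * (M / (M - 2 * s)) ^ (d * d) := by gcongr
        _ = (M / (M - 2 * s - 2)) ^ (d * d) := by
          rw [← mul_pow]; congr 1; field_simp

/-! ### Concentration of truncated Poisson loads -/

/-- The loads that are at most `d` everywhere. -/
noncomputable def loadBox (V : Type*) [Fintype V] (d : ℕ) : Finset (V → ℕ) :=
  Fintype.piFinset fun _ => Finset.range (d + 1)

theorem sum_filter_le_sum_sum {α ι : Type*} {s : Finset α} (I : Finset ι) {P : α → Prop}
    {Q : ι → α → Prop} [DecidablePred P] [∀ i, DecidablePred (Q i)] {f : α → ℝ} (hf : ∀ a ∈ s, 0 ≤ f a)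
    (h : ∀ a ∈ s, P a → ∃ i ∈ I, Q i a) :
    ∑ a ∈ s.filter P, f a ≤ ∑ i ∈ I, ∑ a ∈ s.filter (Q i), f a := by
  simp only [Finset.sum_filter]
  rw [Finset.sum_comm]
  refine Finset.sum_le_sum fun a ha => ?_
  have hnn : ∀ i ∈ I, 0 ≤ if Q i a then f a else 0 := fun i _ => by
    split_ifs
    · exact hf a ha
    · exact le_rfl
  split_ifs with hP
  · obtain ⟨i, hi, hQ⟩ := h a ha hP
    refine le_trans (le_of_eq ?_) (Finset.single_le_sum hnn hi)
    rw [if_pos hQ]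
  · exact Finset.sum_nonneg hnn

theorem mem_loadBox {d : ℕ} {c : V → ℕ} : c ∈ loadBox V d ↔ ∀ v, c v ≤ d := by
  simp [loadBox]

/-- The number of vertices of load `j`. -/
noncomputable def loadCount (c : V → ℕ) (j : ℕ) : ℕ := (Finset.univ.filter fun v => c v = j).card

/-- The number of bins of load `j` is a sum of independent indicators of mean `poissonWeight t j`;
its moment generating function is bounded through `exp l - 1 ≤ l + l ^ 2`. -/
theorem sum_loadWeight_mul_exp_le {d j : ℕ} (hj : j < d) {t l : ℝ} (ht : 0 ≤ t) (hl : |l| ≤ 1) :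
    ∑ c ∈ loadBox V d, loadWeight d t c * Real.exp (l * loadCount c j) ≤
      Real.exp (Fintype.card V * poissonWeight t j * (l + l ^ 2)) := by
  have h1 : ∀ c : V → ℕ, loadWeight d t c * Real.exp (l * loadCount c j) =
      ∏ v, truncWeight d t (c v) * Real.exp (if c v = j then l else 0) := by
    intro c
    rw [loadWeight, Finset.prod_mul_distrib, ← Real.exp_sum, ← Finset.sum_filter,
      Finset.sum_const, nsmul_eq_mul, loadCount, mul_comm l]
  simp only [h1]
  rw [loadBox, ← Finset.prod_univ_sum (fun _ => Finset.range (d + 1))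
    (fun _ i => truncWeight d t i * Real.exp (if i = j then l else 0)),
    Finset.prod_const, Finset.card_univ]
  have h2 : ∑ i ∈ Finset.range (d + 1), truncWeight d t i * Real.exp (if i = j then l else 0) =
      1 + poissonWeight t j * (Real.exp l - 1) := by
    have h3 : ∀ i ∈ Finset.range (d + 1),
        truncWeight d t i * Real.exp (if i = j then l else 0) = truncWeight d t i +
          if i = j then truncWeight d t i * (Real.exp l - 1) else 0 := by
      intro i _
      split_ifs
      · ring
      · simp
    rw [Finset.sum_congr rfl h3, Finset.sum_add_distrib, sum_truncWeight, Finset.sum_ite_eq',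
      if_pos (Finset.mem_range.mpr (by omega))]
    congr 2
    exact if_pos hj
  rw [h2]
  have h4 : Real.exp l - 1 ≤ l + l ^ 2 := by
    have := (abs_le.mp (Real.abs_exp_sub_one_sub_id_le hl)).2
    linarith
  have h5 : (0 : ℝ) ≤ 1 + poissonWeight t j * (Real.exp l - 1) := by
    rw [← h2]
    exact Finset.sum_nonneg fun i _ => mul_nonneg (truncWeight_nonneg ht _ _) (Real.exp_pos _).le
  calc (1 + poissonWeight t j * (Real.exp l - 1)) ^ Fintype.card V
      ≤ Real.exp (poissonWeight t j * (l + l ^ 2)) ^ Fintype.card V := by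
        refine pow_le_pow_left₀ h5 ?_ _
        rw [add_comm]
        refine le_trans ?_ (Real.add_one_le_exp _)
        gcongr
        exact poissonWeight_nonneg ht j
    _ = _ := by rw [← Real.exp_nat_mul]; congr 1; ring

/-- Chernoff's bound with `l = ±η / 2`. The additive slack `Λ` keeps the bound uniform in `t`, even
where the mean count is tiny. -/
theorem sum_loadWeight_deviation_le {d j : ℕ} (hj : j < d) {t η Λ : ℝ} (ht : 0 ≤ t)
    (hη : 0 ≤ η) (hη1 : η ≤ 1) (hΛ : 0 ≤ Λ) :
    ∑ c ∈ (loadBox V d).filter (fun c => ¬ |(loadCount c j : ℝ) -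
        Fintype.card V * poissonWeight t j| ≤ η * (Fintype.card V * poissonWeight t j + Λ)),
      loadWeight d t c ≤ 2 * Real.exp (-(η ^ 2 * Λ / 4)) := by
  set μ := (Fintype.card V : ℝ) * poissonWeight t j with hμ
  have hμ0 : 0 ≤ μ := mul_nonneg (by positivity) (poissonWeight_nonneg ht j)
  have key : ∀ l : ℝ, |l| = η / 2 →
      ∑ c ∈ loadBox V d, loadWeight d t c *
        Real.exp (l * loadCount c j - l * μ - η / 2 * (η * (μ + Λ))) ≤
      Real.exp (-(η ^ 2 * Λ / 4)) := by
    intro l hl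
    have h1 := sum_loadWeight_mul_exp_le (V := V) hj (l := l) ht (by rw [hl]; linarith)
    have h2 : ∀ c : V → ℕ, loadWeight d t c *
        Real.exp (l * loadCount c j - l * μ - η / 2 * (η * (μ + Λ))) =
        Real.exp (-(l * μ) - η / 2 * (η * (μ + Λ))) *
          (loadWeight d t c * Real.exp (l * loadCount c j)) := by
      intro c
      have : l * loadCount c j - l * μ - η / 2 * (η * (μ + Λ)) =
        (-(l * μ) - η / 2 * (η * (μ + Λ))) + l * loadCount c j := by ring
      rw [this, Real.exp_add]
      ring
    simp only [h2]
    rw [← Finset.mul_sum]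
    refine (mul_le_mul_of_nonneg_left h1 (Real.exp_pos _).le).trans ?_
    rw [← Real.exp_add, Real.exp_le_exp, ← hμ]
    have h3 : l ^ 2 = η ^ 2 / 4 := by rw [← sq_abs, hl]; ring
    rw [h3]
    have h4 : 0 ≤ η ^ 2 * μ := by positivity
    have : 0 ≤ η ^ 2 * Λ := by positivity
    linarith
  have hη2 : |η / 2| = η / 2 := abs_of_nonneg (by linarith)
  have k1 := key (η / 2) hη2
  have k2 := key (-(η / 2)) (by rw [abs_neg, hη2])
  rw [two_mul]
  refine le_trans ?_ (add_le_add k1 k2)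
  rw [← Finset.sum_add_distrib, Finset.sum_filter]
  refine Finset.sum_le_sum fun c _ => ?_
  have hw := loadWeight_nonneg ht d c
  have e1 := (Real.exp_pos (η / 2 * loadCount c j - η / 2 * μ - η / 2 * (η * (μ + Λ)))).le
  have e2 := (Real.exp_pos (-(η / 2) * loadCount c j - -(η / 2) * μ - η / 2 * (η * (μ + Λ)))).le
  split_ifs with h
  swap
  · rw [← mul_add]
    refine le_mul_of_one_le_right hw ?_
    push Not at h
    rcases lt_abs.mp h with h | h
    · have := Real.one_le_exp
        (x := η / 2 * loadCount c j - η / 2 * μ - η / 2 * (η * (μ + Λ))) (by nlinarith)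
      linarith
    · have := Real.one_le_exp
        (x := -(η / 2) * loadCount c j - -(η / 2) * μ - η / 2 * (η * (μ + Λ))) (by nlinarith)
      linarith
  · exact add_nonneg (mul_nonneg hw e1) (mul_nonneg hw e2)

/-- The load counts `Z` are close to those of independent Poisson loads with a common mean. -/
def IsTypical (d : ℕ) (n η Λ : ℝ) (Z : ℕ → ℝ) : Prop :=
  ∃ t, 0 ≤ t ∧ ∀ j < d, |Z j - n * poissonWeight t j| ≤ η * (n * poissonWeight t j + Λ)

theorem sum_loadWeight_not_isTypical_le {d : ℕ} {t η Λ : ℝ} (ht : 0 ≤ t)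
    (hη : 0 ≤ η) (hη1 : η ≤ 1) (hΛ : 0 ≤ Λ) :
    ∑ c ∈ (loadBox V d).filter (fun c => ¬ IsTypical d (Fintype.card V) η Λ
        fun j => loadCount c j), loadWeight d t c ≤ d * (2 * Real.exp (-(η ^ 2 * Λ / 4))) := by
  refine (sum_filter_le_sum_sum (Finset.range d)
    (Q := fun j (c : V → ℕ) => ¬ |(loadCount c j : ℝ) -
        Fintype.card V * poissonWeight t j| ≤ η * (Fintype.card V * poissonWeight t j + Λ))
    (fun c _ => loadWeight_nonneg ht d c) ?_).trans ?_
  · intro c _ hc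
    unfold IsTypical at hc
    push Not at hc
    obtain ⟨j, hj, hj'⟩ := hc t ht
    exact ⟨j, Finset.mem_range.mpr hj, not_le.mpr hj'⟩
  · refine (Finset.sum_le_card_nsmul _ _ _ fun j hj =>
      sum_loadWeight_deviation_le (Finset.mem_range.mp hj) ht hη hη1 hΛ).trans ?_
    rw [Finset.card_range, nsmul_eq_mul]

theorem sum_loadWeight_lowVertices_le {d : ℕ} {t : ℝ} (ht : 0 ≤ t) :
    ∑ c ∈ (loadBox V d).filter (fun c => (lowVertices d c).Nonempty), loadWeight d t c ≤
      Fintype.card V * (2 ^ d * Real.exp (-(1 / 2) * t)) := by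
  have hone : ∀ v : V, ∑ c ∈ (loadBox V d).filter (fun c => c v < d), loadWeight d t c ≤
      2 ^ d * Real.exp (-(1 / 2) * t) := by
    intro v
    have h1 : (loadBox V d).filter (fun c => c v < d) =
        Fintype.piFinset fun w => if w = v then Finset.range d else Finset.range (d + 1) := by
      ext c
      rw [Finset.mem_filter, mem_loadBox, Fintype.mem_piFinset]
      constructor
      · rintro ⟨h2, h3⟩ w
        split_ifs with h
        · subst h; simpa using h3
        · simpa [Nat.lt_succ_iff] using h2 w
      · intro h2
        refine ⟨fun w => ?_, by simpa using h2 v⟩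
        have h3 := h2 w
        split_ifs at h3
        · rw [Finset.mem_range] at h3; omega
        · rw [Finset.mem_range] at h3; omega
    rw [h1]
    unfold loadWeight
    rw [← Finset.prod_univ_sum _ (fun _ i => truncWeight d t i),
      ← Finset.mul_prod_erase _ _ (Finset.mem_univ v)]
    rw [Finset.prod_eq_one, mul_one, if_pos rfl]
    · have h2 : ∀ i ∈ Finset.range d, truncWeight d t i ≤ 2 ^ i * Real.exp (-(1 / 2) * t) := by
        intro i hi
        rw [truncWeight, if_pos (Finset.mem_range.mp hi)]
        exact poissonWeight_le ht i
      refine (Finset.sum_le_sum h2).trans ?_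
      rw [← Finset.sum_mul]
      refine mul_le_mul_of_nonneg_right ?_ (Real.exp_pos _).le
      rw [geom_sum_eq (by norm_num)]
      norm_num
    · intro w hw
      rw [if_neg (Finset.ne_of_mem_erase hw), sum_truncWeight]
  refine (sum_filter_le_sum_sum (Finset.univ : Finset V) (Q := fun v (c : V → ℕ) => c v < d)
    (fun c _ => loadWeight_nonneg ht d c) ?_).trans ?_
  · rintro c _ ⟨v, hv⟩
    exact ⟨v, Finset.mem_univ v, mem_lowVertices.mp hv⟩
  · refine (Finset.sum_le_card_nsmul _ _ _ fun v _ => hone v).trans ?_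
    rw [Finset.card_univ, nsmul_eq_mul]

/-- Summed over bad configurations, occupations become the integral over time of the probability
that independent loads are bad. The polynomial factor from `expect_degreeIndicator_le` is harmless
against the exponential concentration bound. -/
theorem expect_not_isTypical_le {d s : ℕ} {η Λ : ℝ} (hd : 1 ≤ d) [Nonempty V]
    (hs : 2 * (d * d) + 2 * s + 2 ≤ d * Fintype.card V)
    (hη : 0 ≤ η) (hη1 : η ≤ 1) (hΛ : 0 ≤ Λ) :
    expect d s (fun G : SimpleGraph V => if IsTypical d (Fintype.card V) η Λ
        (fun j => loadCount (fun v => G.degree v) j) then (0 : ℝ) else 1) ≤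
      (d * Fintype.card V : ℝ) ^ (d * d) * (4 * Fintype.card V *
        (√(2 * d * Fintype.card V * 2 ^ d) * Real.exp (-(η ^ 2 * Λ / 8)))) := by
  set n : ℝ := (Fintype.card V : ℝ) with hn
  set bad := (loadBox V d).filter fun c => (¬ IsTypical d n η Λ fun j => loadCount c j) ∧
    (lowVertices d c).Nonempty with hbad
  have hM : (1 : ℝ) ≤ ((d * Fintype.card V : ℕ) : ℝ) - 2 * s := by
    have : ((2 * (d * d) + 2 * s + 2 : ℕ) : ℝ) ≤ (d * Fintype.card V : ℕ) := by exact_mod_cast hs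
    push_cast at this ⊢
    nlinarith
  have h1 : expect d s (fun G : SimpleGraph V => if IsTypical d n η Λ
        (fun j => loadCount (fun v => G.degree v) j) then (0 : ℝ) else 1) ≤
      ∑ c ∈ bad, expect d s (degreeIndicator c) := by
    rw [← expect_sum]
    refine expect_mono fun G hG => ?_
    have hnn : ∀ c ∈ bad, 0 ≤ degreeIndicator c G := by
      intro c _
      unfold degreeIndicator
      split_ifs <;> norm_num
    split_ifs with h
    · exact Finset.sum_nonneg hnn
    · have hDG := law_deficitSum hG (by omega)
      have hlow : (lowVertices d fun v => G.degree v).Nonempty := by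
        rw [Finset.nonempty_iff_ne_empty]
        intro h0
        have h2 := deficitSum_le d G
        have h3 : unsat d G = ∅ := h0
        rw [h3, Finset.card_empty, mul_zero] at h2
        omega
      have hmem : (fun v => G.degree v) ∈ bad :=
        Finset.mem_filter.mpr ⟨mem_loadBox.mpr (law_degree_le hG), h, hlow⟩
      refine le_trans (le_of_eq ?_) (Finset.single_le_sum hnn hmem)
      exact (if_pos rfl).symm
  have h2 : ∀ c ∈ bad, expect d s (degreeIndicator c) ≤
      (d * n) ^ (d * d) * (n * occupation d c) := by
    intro c hc
    rw [hbad, Finset.mem_filter, mem_loadBox] at hc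
    refine (expect_degreeIndicator_le hd s hs hc.1).trans ?_
    have h3 : (((d * Fintype.card V : ℕ) : ℝ) / (((d * Fintype.card V : ℕ) : ℝ) - 2 * s)) ≤
        d * n := by
      refine (div_le_self (by positivity) hM).trans (le_of_eq ?_)
      push_cast; rfl
    have h4 : ((lowVertices d c).card : ℝ) ≤ n := by
      rw [hn]
      exact_mod_cast Finset.card_le_univ (lowVertices d c)
    have := occupation_nonneg d c
    have h5 : 0 ≤ (((d * Fintype.card V : ℕ) : ℝ) / (((d * Fintype.card V : ℕ) : ℝ) - 2 * s)) := by
      positivity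
    gcongr
  refine (h1.trans (Finset.sum_le_sum h2)).trans ?_
  rw [← Finset.mul_sum, ← Finset.mul_sum]
  refine mul_le_mul_of_nonneg_left ?_ (by positivity)
  have hint : ∀ c ∈ bad, MeasureTheory.IntegrableOn (fun t => loadWeight d t c) (Set.Ioi 0) := by
    intro c hc
    rw [hbad, Finset.mem_filter] at hc
    obtain ⟨v, hv⟩ := hc.2.2
    exact integrableOn_loadWeight (mem_lowVertices.mp hv)
  set a := √(2 * d * n * 2 ^ d) * Real.exp (-(η ^ 2 * Λ / 8)) with ha
  -- Concentration is uniform in `t` but not integrable, while the probability that some bin is not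
  -- full decays in `t` but is not small at first. Their geometric mean is both small and
  -- integrable.
  have h6 : ∀ t ∈ Set.Ioi (0 : ℝ), ∑ c ∈ bad, loadWeight d t c ≤
      a * Real.exp (-(1 / 4) * t) := by
    intro t ht
    have ht' : 0 ≤ t := le_of_lt ht
    have k1 : ∑ c ∈ bad, loadWeight d t c ≤ d * (2 * Real.exp (-(η ^ 2 * Λ / 4))) := by
      refine le_trans ?_ (sum_loadWeight_not_isTypical_le (V := V) ht' hη hη1 hΛ)
      refine Finset.sum_le_sum_of_subset_of_nonneg ?_ fun c _ _ => loadWeight_nonneg ht' d c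
      intro c hc
      rw [hbad, Finset.mem_filter] at hc
      exact Finset.mem_filter.mpr ⟨hc.1, hc.2.1⟩
    have k2 : ∑ c ∈ bad, loadWeight d t c ≤ n * (2 ^ d * Real.exp (-(1 / 2) * t)) := by
      refine le_trans ?_ (sum_loadWeight_lowVertices_le (V := V) ht')
      refine Finset.sum_le_sum_of_subset_of_nonneg ?_ fun c _ _ => loadWeight_nonneg ht' d c
      intro c hc
      rw [hbad, Finset.mem_filter] at hc
      exact Finset.mem_filter.mpr ⟨hc.1, hc.2.2⟩
    have k0 : 0 ≤ ∑ c ∈ bad, loadWeight d t c :=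
      Finset.sum_nonneg fun c _ => loadWeight_nonneg ht' d c
    refine le_of_sq_le_sq ?_ (by positivity)
    calc (∑ c ∈ bad, loadWeight d t c) ^ 2
        = (∑ c ∈ bad, loadWeight d t c) * ∑ c ∈ bad, loadWeight d t c := sq _
      _ ≤ (d * (2 * Real.exp (-(η ^ 2 * Λ / 4)))) * (n * (2 ^ d * Real.exp (-(1 / 2) * t))) :=
          mul_le_mul k1 k2 k0 (by positivity)
      _ = (a * Real.exp (-(1 / 4) * t)) ^ 2 := by
          rw [ha, mul_pow, mul_pow, Real.sq_sqrt (by positivity), ← Real.exp_nat_mul,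
            ← Real.exp_nat_mul]
          have e1 : ((2 : ℕ) : ℝ) * -(η ^ 2 * Λ / 8) = -(η ^ 2 * Λ / 4) := by push_cast; ring
          have e2 : ((2 : ℕ) : ℝ) * (-(1 / 4) * t) = -(1 / 2) * t := by push_cast; ring
          rw [e1, e2]
          ring
  have h7 : ∑ c ∈ bad, occupation d c ≤ a * 4 := by
    unfold occupation
    rw [← MeasureTheory.integral_finsetSum _ hint]
    have h8 : ∫ t in Set.Ioi (0 : ℝ), a * Real.exp (-(1 / 4) * t) = a * 4 := by
      rw [MeasureTheory.integral_const_mul, integral_exp_mul_Ioi (by norm_num)]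
      norm_num
    rw [← h8]
    refine MeasureTheory.setIntegral_mono_on (MeasureTheory.integrable_finsetSum _ hint)
      ((exp_neg_integrableOn_Ioi 0 (by norm_num : (0 : ℝ) < 1 / 4)).const_mul _)
      measurableSet_Ioi h6
  have hn0 : 0 ≤ n := by positivity
  nlinarith

/-! ### Asymptotics of typical load counts -/

theorem tendsto_pow_mul_exp_neg_mul (q : ℕ) {c : ℝ} (hc : 0 < c) :
    Tendsto (fun y : ℝ => y ^ q * Real.exp (-(c * y))) atTop (nhds 0) := by
  have h1 := (Real.tendsto_pow_mul_exp_neg_atTop_nhds_zero q).comp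
    (tendsto_id.const_mul_atTop hc)
  have h2 := h1.const_mul ((c ^ q)⁻¹)
  rw [mul_zero] at h2
  refine h2.congr fun y => ?_
  simp only [Function.comp, id, mul_pow]
  field_simp

theorem eventually_mul_one_add_sq_pow_lt_exp (d : ℕ) (C : ℝ) :
    ∀ᶠ y : ℝ in atTop, C * (1 + y ^ 2) ^ d < Real.exp y := by
  have h := (tendsto_pow_mul_exp_neg_mul (2 * d) one_pos).const_mul (|C| * 2 ^ d)
  rw [mul_zero] at h
  filter_upwards [h.eventually (gt_mem_nhds one_pos), eventually_ge_atTop 1] with y h1 hy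
  rw [one_mul, Real.exp_neg] at h1
  have h2 : (1 + y ^ 2) ^ d ≤ 2 ^ d * y ^ (2 * d) := by
    rw [pow_mul, ← mul_pow]
    have : 1 ≤ y ^ 2 := one_le_pow₀ hy
    gcongr
    linarith
  have h3 : |C| * 2 ^ d * (y ^ (2 * d) * (Real.exp y)⁻¹) * Real.exp y =
      |C| * (2 ^ d * y ^ (2 * d)) := by
    field_simp
  calc C * (1 + y ^ 2) ^ d ≤ |C| * (1 + y ^ 2) ^ d := by gcongr; exact le_abs_self C
    _ ≤ |C| * (2 ^ d * y ^ (2 * d)) := by gcongr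
    _ = |C| * 2 ^ d * (y ^ (2 * d) * (Real.exp y)⁻¹) * Real.exp y := h3.symm
    _ < 1 * Real.exp y := by gcongr
    _ = Real.exp y := one_mul _

theorem exp_neg_mul_one_add_pow_le {x : ℝ} (hx : 0 ≤ x) (d : ℕ) :
    Real.exp (-x) * (1 + x) ^ d ≤ Real.exp 1 * d.factorial := by
  have h := Real.pow_div_factorial_le_exp (1 + x) (by linarith) d
  rw [div_le_iff₀ (by positivity), Real.exp_add] at h
  calc Real.exp (-x) * (1 + x) ^ d
      ≤ Real.exp (-x) * (Real.exp 1 * Real.exp x * d.factorial) := by gcongr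
    _ = Real.exp 1 * d.factorial * (Real.exp (-x) * Real.exp x) := by ring
    _ = _ := by rw [← Real.exp_add]; simp

theorem poissonWeight_le_exp_mul_one_add_pow {t : ℝ} (ht : 0 ≤ t) {j d : ℕ} (hj : j < d) :
    poissonWeight t j ≤ Real.exp (-t) * (1 + t) ^ d := by
  unfold poissonWeight
  have h1 : (1 : ℝ) ≤ j.factorial := by exact_mod_cast Nat.one_le_iff_ne_zero.mpr j.factorial_ne_zero
  refine (div_le_self (by positivity) h1).trans ?_
  gcongr
  calc t ^ j ≤ (1 + t) ^ j := by gcongr; linarith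
    _ ≤ (1 + t) ^ d := pow_le_pow_right₀ (by linarith) hj.le

/-- The time at which the load counts are typical is close to `y ^ 2 = log n`. -/
theorem time_le_of_typical {d : ℕ} (hd : 1 ≤ d) :
    ∀ᶠ y : ℝ in atTop, ∀ (t D : ℝ) (Z : ℕ → ℝ), 0 ≤ t → Real.exp y ≤ D → D ≤ Real.exp y + 2 →
      (∀ j, 0 ≤ Z j) → ∑ j ∈ Finset.range d, ((d : ℝ) - j) * Z j = D →
      (∀ j < d, |Z j - Real.exp (y ^ 2) * poissonWeight t j| ≤
        Real.exp (-(y / 16)) * (Real.exp (y ^ 2) * poissonWeight t j + Real.exp (y / 2))) →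
      y ^ 2 - y - 3 ≤ t ∧ t ≤ y ^ 2 := by
  have hη : ∀ᶠ y : ℝ in atTop, Real.exp (-(y / 16)) < 1 / 2 := by
    have h := tendsto_pow_mul_exp_neg_mul 0 (c := 1 / 16) (by norm_num)
    filter_upwards [h.eventually (gt_mem_nhds (by norm_num : (0 : ℝ) < 1 / 2))] with y hy
    simpa [div_eq_inv_mul] using hy
  have hΛ : ∀ᶠ y : ℝ in atTop, Real.exp (y / 2) * (2 * d ^ 2) ≤ Real.exp y := by
    have h := tendsto_pow_mul_exp_neg_mul 0 (c := 1 / 2) (by norm_num)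
    have hd0 : (0 : ℝ) < 1 / (2 * d ^ 2) := by positivity
    filter_upwards [h.eventually (gt_mem_nhds hd0)] with y hy
    have e1 : Real.exp y = Real.exp (y / 2) * Real.exp (y / 2) := by
      rw [← Real.exp_add]; congr 1; ring
    rw [e1]
    refine mul_le_mul_of_nonneg_left ?_ (Real.exp_pos _).le
    rw [pow_zero, one_mul, Real.exp_neg, show (1 : ℝ) / 2 * y = y / 2 by ring, inv_eq_one_div,
      div_lt_div_iff₀ (Real.exp_pos _) (by positivity)] at hy
    linarith
  filter_upwards [hη, hΛ, eventually_mul_one_add_sq_pow_lt_exp d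
    (4 * d ^ 2 * (Real.exp 1 * d.factorial)), eventually_ge_atTop 1] with y h1 h2 h3 hy
  intro t D Z ht hD1 hD2 hZ0 hsum hZ
  have hd' : (1 : ℝ) ≤ d := by exact_mod_cast hd
  have hμ0 : ∀ j, 0 ≤ Real.exp (y ^ 2) * poissonWeight t j := fun j =>
    mul_nonneg (Real.exp_pos _).le (poissonWeight_nonneg ht j)
  have hy0 := Real.exp_pos (y / 2)
  have hΛ1 : Real.exp (y / 2) ≤ D / (2 * d ^ 2) := by
    rw [le_div_iff₀ (by positivity)]; linarith
  constructor
  · have k1 : Z 0 ≤ D := by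
      rw [← hsum]
      have k2 := Finset.single_le_sum (f := fun j : ℕ => ((d : ℝ) - j) * Z j)
        (s := Finset.range d) (fun j hj => mul_nonneg (by
          have : (j : ℝ) ≤ d := by exact_mod_cast (Finset.mem_range.mp hj).le
          linarith) (hZ0 j)) (Finset.mem_range.mpr hd)
      simp only [Nat.cast_zero, sub_zero] at k2
      nlinarith [hZ0 0]
    have k3 := (abs_le.mp (hZ 0 hd)).1
    have k4 : poissonWeight t 0 = Real.exp (-t) := by simp [poissonWeight]
    have k5 := hμ0 0
    rw [k4] at k3 k5
    have k6 : D / (2 * d ^ 2) ≤ D := div_le_self (by linarith [Real.exp_pos y]) (by nlinarith)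
    have k7 : Real.exp (y ^ 2) * Real.exp (-t) ≤ 4 * D := by
      nlinarith [Real.exp_pos (-(y / 16))]
    -- From `4 * D ≤ 4 * (exp y + 2) ≤ 12 * exp y` and `12 ≤ exp 3`.
    have k8 : Real.exp (y ^ 2 - t) ≤ Real.exp (y + 3) := by
      rw [sub_eq_add_neg, Real.exp_add, Real.exp_add]
      have k9 : (12 : ℝ) ≤ Real.exp 3 := by
        have := Real.exp_one_gt_d9
        have e : Real.exp 3 = Real.exp 1 ^ 3 := by rw [← Real.exp_nat_mul]; norm_num
        rw [e]
        have : (2.5 : ℝ) ^ 3 ≤ Real.exp 1 ^ 3 := by gcongr; linarith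
        linarith
      have k10 : (1 : ℝ) ≤ Real.exp y := Real.one_le_exp (by linarith)
      nlinarith
    have := Real.exp_le_exp.mp k8
    linarith
  -- Beyond time `y ^ 2 = log n` the mean counts below `d` are at most a polynomial in `y`, too few
  -- to carry a deficit of `exp y`.
  · by_contra hlt
    push Not at hlt
    have k1 : D ≤ d * (d * (2 * (Real.exp (y ^ 2) * (Real.exp (-t) * (1 + t) ^ d)) +
        Real.exp (y / 2))) := by
      rw [← hsum]
      refine (Finset.sum_le_card_nsmul _ _ (d * (2 * (Real.exp (y ^ 2) *
        (Real.exp (-t) * (1 + t) ^ d)) + Real.exp (y / 2))) fun j hj => ?_).trans ?_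
      · have hj' := Finset.mem_range.mp hj
        have k2 := (abs_le.mp (hZ j hj')).2
        have k3 : Z j ≤ 2 * (Real.exp (y ^ 2) * poissonWeight t j) + Real.exp (y / 2) := by
          nlinarith [hμ0 j]
        have k4 := poissonWeight_le_exp_mul_one_add_pow ht hj'
        have k5 : Z j ≤ 2 * (Real.exp (y ^ 2) * (Real.exp (-t) * (1 + t) ^ d)) +
            Real.exp (y / 2) := by
          refine k3.trans ?_
          gcongr
        have k6 : (d : ℝ) - j ≤ d := by
          have : (0 : ℝ) ≤ j := by positivity
          linarith
        exact mul_le_mul k6 k5 (hZ0 j) (by positivity)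
      · rw [Finset.card_range, nsmul_eq_mul]
    have k2 : D ≤ 4 * d ^ 2 * (Real.exp (y ^ 2) * (Real.exp (-t) * (1 + t) ^ d)) := by
      have : d ^ 2 * Real.exp (y / 2) ≤ D / 2 := by
        calc d ^ 2 * Real.exp (y / 2) ≤ d ^ 2 * (D / (2 * d ^ 2)) := by gcongr
          _ = D / 2 := by field_simp
      nlinarith
    have k3 : Real.exp (y ^ 2) * (Real.exp (-t) * (1 + t) ^ d) ≤
        (Real.exp 1 * d.factorial) * (1 + y ^ 2) ^ d := by
      have k4 := exp_neg_mul_one_add_pow_le (x := t - y ^ 2) (by linarith) d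
      have k5 : (1 + t) ^ d ≤ ((1 + y ^ 2) * (1 + (t - y ^ 2))) ^ d := by
        gcongr
        nlinarith [sq_nonneg y]
      have k6 : Real.exp (y ^ 2) * Real.exp (-t) = Real.exp (-(t - y ^ 2)) := by
        rw [← Real.exp_add]; congr 1; ring
      calc Real.exp (y ^ 2) * (Real.exp (-t) * (1 + t) ^ d)
          = Real.exp (-(t - y ^ 2)) * (1 + t) ^ d := by rw [← mul_assoc, k6]
        _ ≤ Real.exp (-(t - y ^ 2)) * ((1 + y ^ 2) * (1 + (t - y ^ 2))) ^ d := by gcongr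
        _ = (Real.exp (-(t - y ^ 2)) * (1 + (t - y ^ 2)) ^ d) * (1 + y ^ 2) ^ d := by
          rw [mul_pow]; ring
        _ ≤ _ := by gcongr
    have k7 : D ≤ 4 * d ^ 2 * (Real.exp 1 * d.factorial) * (1 + y ^ 2) ^ d := by
      rw [mul_assoc]
      exact k2.trans (mul_le_mul_of_nonneg_left k3 (by positivity))
    linarith

section

variable {α : Type*} {l : Filter α} {d : ℕ} {y t D : α → ℝ} {Z : ℕ → α → ℝ}

/-- A bootstrap: the self-referential estimate first bounds `w` by 4 and then forces it to 1. -/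
theorem tendsto_of_abs_one_sub_le {w e₁ e₂ : α → ℝ} (h1 : Tendsto e₁ l (nhds 0))
    (h2 : Tendsto e₂ l (nhds 0)) (hw : ∀ᶠ a in l, 0 ≤ w a)
    (h : ∀ᶠ a in l, |1 - w a| ≤ e₁ a * w a + e₂ a) : Tendsto w l (nhds 1) := by
  have hbound : ∀ᶠ a in l, w a ≤ 4 := by
    filter_upwards [h, h1.eventually (gt_mem_nhds (by norm_num : (0 : ℝ) < 1 / 2)),
      h2.eventually (gt_mem_nhds one_pos), hw] with a h3 h4 h5 h6
    have := (abs_le.mp h3).1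
    nlinarith
  have hlim : Tendsto (fun a => 4 * |e₁ a| + |e₂ a|) l (nhds 0) := by
    simpa using (h1.abs.const_mul 4).add h2.abs
  have : Tendsto (fun a => w a - 1) l (nhds 0) := by
    refine squeeze_zero_norm' ?_ hlim
    filter_upwards [h, hbound, hw] with a h3 h4 h5
    rw [Real.norm_eq_abs, abs_sub_comm]
    refine h3.trans (add_le_add ?_ (le_abs_self _))
    calc e₁ a * w a ≤ |e₁ a| * w a := by gcongr; exact le_abs_self _
      _ ≤ |e₁ a| * 4 := by gcongr
      _ = _ := mul_comm _ _
  simpa using this.add_const 1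

theorem poissonWeight_eq_mul {t : ℝ} (ht : 0 < t) {j : ℕ} (hj : j < d) :
    poissonWeight t j = poissonWeight t (d - 1) *
      (((d - 1).factorial : ℝ) / j.factorial * (1 / t) ^ (d - 1 - j)) := by
  unfold poissonWeight
  have : t ^ (d - 1) = t ^ j * t ^ (d - 1 - j) := by rw [← pow_add]; congr 1; omega
  rw [this, one_div, inv_pow]
  field_simp

/-- As `t` tends to infinity, the vertices of degree `d - 1` dominate: the mean count of degree `j`
is the leading one, `W`, times a constant multiple of `t ^ (-(d-1-j))`. So the deficit identity
forces `W / D` to tend to 1, and `t` is asymptotic to `y ^ 2` by `time_le_of_typical`. -/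
theorem tendsto_typical (hd : 1 ≤ d) (hy : Tendsto y l atTop)
    (hD1 : ∀ᶠ a in l, Real.exp (y a) ≤ D a) (hD2 : ∀ᶠ a in l, D a ≤ Real.exp (y a) + 2)
    (ht : ∀ᶠ a in l, 0 ≤ t a) (hZ0 : ∀ᶠ a in l, ∀ j, 0 ≤ Z j a)
    (hsum : ∀ᶠ a in l, ∑ j ∈ Finset.range d, ((d : ℝ) - j) * Z j a = D a)
    (hZ : ∀ᶠ a in l, ∀ j < d, |Z j a - Real.exp (y a ^ 2) * poissonWeight (t a) j| ≤
        Real.exp (-(y a / 16)) *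
          (Real.exp (y a ^ 2) * poissonWeight (t a) j + Real.exp (y a / 2)))
    {i : ℕ} (hi : i < d) :
    Tendsto (fun a => Z i a * (y a ^ 2) ^ (d - 1 - i) / D a) l
      (nhds (((d - 1).factorial : ℝ) / i.factorial)) := by
  have htime : ∀ᶠ a in l, y a ^ 2 - y a - 3 ≤ t a ∧ t a ≤ y a ^ 2 := by
    filter_upwards [hy.eventually (time_le_of_typical hd), hD1, hD2, ht, hZ0, hsum, hZ] with
      a h h1 h2 h3 h4 h5 h6
    exact h (t a) (D a) (fun j => Z j a) h3 h1 h2 h4 h5 h6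
  have hη : Tendsto (fun a => Real.exp (-(y a / 16))) l (nhds 0) := by
    have h := (tendsto_pow_mul_exp_neg_mul 0 (c := 1 / 16) (by norm_num)).comp hy
    refine h.congr fun a => ?_
    simp [Function.comp, div_eq_inv_mul]
  have hΛ : ∀ q : ℕ, Tendsto (fun a => Real.exp (y a / 2) * (y a ^ 2) ^ q / D a) l (nhds 0) := by
    intro q
    have h := (tendsto_pow_mul_exp_neg_mul (2 * q) (c := 1 / 2) (by norm_num)).comp hy
    refine squeeze_zero' ?_ ?_ h
    · filter_upwards [hD1] with a h1
      have := Real.exp_pos (y a)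
      have : 0 < D a := by linarith
      positivity
    · filter_upwards [hD1] with a h1
      have h2 := Real.exp_pos (y a)
      calc Real.exp (y a / 2) * (y a ^ 2) ^ q / D a
          ≤ Real.exp (y a / 2) * (y a ^ 2) ^ q / Real.exp (y a) := by gcongr
        _ = y a ^ (2 * q) * Real.exp (-(1 / 2 * y a)) := by
          rw [← pow_mul, div_eq_mul_inv, ← Real.exp_neg, mul_comm (Real.exp _), mul_assoc,
            ← Real.exp_add]
          congr 2; ring
  have hyinv : Tendsto (fun a => (y a)⁻¹) l (nhds 0) := tendsto_inv_atTop_zero.comp hy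
  have hratio : Tendsto (fun a => t a / y a ^ 2) l (nhds 1) := by
    have h1 : Tendsto (fun a => 1 - (y a)⁻¹ - 3 * ((y a)⁻¹ * (y a)⁻¹)) l (nhds 1) := by
      have := (tendsto_const_nhds (x := (1 : ℝ)).sub hyinv).sub ((hyinv.mul hyinv).const_mul 3)
      simpa using this
    refine tendsto_of_tendsto_of_tendsto_of_le_of_le' h1 tendsto_const_nhds ?_ ?_
    · filter_upwards [htime, hy.eventually (eventually_ge_atTop 1)] with a h2 h3
      have h4 : 0 < y a := by linarith
      rw [le_div_iff₀ (by positivity)]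
      refine le_trans (le_of_eq ?_) h2.1
      field_simp
    · filter_upwards [htime, hy.eventually (eventually_ge_atTop 1)] with a h2 h3
      have h4 : 0 < y a := by linarith
      rw [div_le_one (by positivity)]
      exact h2.2
  have htop : Tendsto t l atTop := by
    have h1 : Tendsto (fun a => y a * (y a - 4)) l atTop :=
      hy.atTop_mul_atTop₀ (tendsto_atTop_add_const_right l (-4) hy)
    refine tendsto_atTop_mono' l ?_ h1
    filter_upwards [htime, hy.eventually (eventually_ge_atTop 1)] with a h2 h3
    nlinarith
  have htinv : Tendsto (fun a => 1 / t a) l (nhds 0) := by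
    simp only [one_div]
    exact tendsto_inv_atTop_zero.comp htop
  set W : α → ℝ := fun a => Real.exp (y a ^ 2) * poissonWeight (t a) (d - 1) with hW
  set r : ℕ → α → ℝ := fun j a =>
    ((d - 1).factorial : ℝ) / j.factorial * (1 / t a) ^ (d - 1 - j) with hr
  have hrlim : ∀ j, j < d → Tendsto (r j) l (nhds (if j = d - 1 then 1 else 0)) := by
    intro j hj
    have h1 := (htinv.pow (d - 1 - j)).const_mul (((d - 1).factorial : ℝ) / j.factorial)
    convert h1 using 2
    split_ifs with h
    · subst h
      simp
      rw [div_self (by positivity)]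
    · rw [zero_pow (by omega), mul_zero]
  have hμ : ∀ᶠ a in l, ∀ j < d, Real.exp (y a ^ 2) * poissonWeight (t a) j = W a * r j a := by
    filter_upwards [htop.eventually (eventually_gt_atTop 0)] with a h j hj
    rw [poissonWeight_eq_mul h hj, hW, hr]
    ring
  have hW0 : ∀ᶠ a in l, 0 ≤ W a := by
    filter_upwards [ht] with a h
    exact mul_nonneg (Real.exp_pos _).le (poissonWeight_nonneg h _)
  have hDpos : ∀ᶠ a in l, 0 < D a := by
    filter_upwards [hD1] with a h
    linarith [Real.exp_pos (y a)]
  have hw : Tendsto (fun a => W a / D a) l (nhds 1) := by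
    set e₁ : α → ℝ := fun a => ∑ j ∈ Finset.range d, ((d : ℝ) - j) *
      (Real.exp (-(y a / 16)) * r j a) +
        |∑ j ∈ Finset.range d, ((d : ℝ) - j) * r j a - 1| with he₁
    set e₂ : α → ℝ := fun a => ∑ j ∈ Finset.range d, ((d : ℝ) - j) *
      (Real.exp (-(y a / 16)) * (Real.exp (y a / 2) * (y a ^ 2) ^ 0 / D a)) with he₂
    have hone : ∑ j ∈ Finset.range d, ((d : ℝ) - j) * (if j = d - 1 then (1 : ℝ) else 0) = 1 := by
      simp only [mul_ite, mul_one, mul_zero]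
      rw [Finset.sum_ite_eq', if_pos (Finset.mem_range.mpr (by omega)), Nat.cast_sub hd]
      simp
    have he₁0 : Tendsto e₁ l (nhds 0) := by
      have h1 : Tendsto (fun a => ∑ j ∈ Finset.range d, ((d : ℝ) - j) *
          (Real.exp (-(y a / 16)) * r j a)) l (nhds (∑ j ∈ Finset.range d, ((d : ℝ) - j) *
          (0 * if j = d - 1 then 1 else 0))) :=
        tendsto_finsetSum _ fun j hj =>
          (hη.mul (hrlim j (Finset.mem_range.mp hj))).const_mul _
      have h2 : Tendsto (fun a => ∑ j ∈ Finset.range d, ((d : ℝ) - j) * r j a) l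
          (nhds (∑ j ∈ Finset.range d, ((d : ℝ) - j) * if j = d - 1 then (1 : ℝ) else 0)) :=
        tendsto_finsetSum _ fun j hj => (hrlim j (Finset.mem_range.mp hj)).const_mul _
      rw [hone] at h2
      simpa using h1.add (h2.sub_const 1).abs
    have he₂0 : Tendsto e₂ l (nhds 0) := by
      have h1 : Tendsto e₂ l (nhds (∑ j ∈ Finset.range d, ((d : ℝ) - j) * (0 * 0))) :=
        tendsto_finsetSum _ fun j _ => (hη.mul (hΛ 0)).const_mul _
      simpa using h1
    refine tendsto_of_abs_one_sub_le he₁0 he₂0 ?_ ?_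
    · filter_upwards [hW0, hDpos] with a h1 h2
      positivity
    · filter_upwards [hsum, hZ, hμ, hW0, hDpos] with a h1 h2 h3 h4 h5
      have k1 : D a - W a = ∑ j ∈ Finset.range d, ((d : ℝ) - j) * (Z j a - W a * r j a) +
          W a * (∑ j ∈ Finset.range d, ((d : ℝ) - j) * r j a - 1) := by
        rw [← h1, mul_sub, Finset.mul_sum, ← add_sub_assoc, ← Finset.sum_add_distrib, mul_one]
        congr 1
        exact Finset.sum_congr rfl fun j _ => by ring
      have k2 : |D a - W a| ≤ ∑ j ∈ Finset.range d, ((d : ℝ) - j) *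
          (Real.exp (-(y a / 16)) * (W a * r j a + Real.exp (y a / 2))) +
          W a * |∑ j ∈ Finset.range d, ((d : ℝ) - j) * r j a - 1| := by
        rw [k1]
        refine (abs_add_le _ _).trans (add_le_add ?_ (by rw [abs_mul, abs_of_nonneg h4]))
        refine (Finset.abs_sum_le_sum_abs _ _).trans (Finset.sum_le_sum fun j hj => ?_)
        have hj' := Finset.mem_range.mp hj
        have hdj : (0 : ℝ) ≤ (d : ℝ) - j := by
          have : (j : ℝ) ≤ d := by exact_mod_cast hj'.le
          linarith
        rw [abs_mul, abs_of_nonneg hdj]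
        refine mul_le_mul_of_nonneg_left ?_ hdj
        have := h2 j hj'
        rwa [h3 j hj'] at this
      have k3 : 1 - W a / D a = (D a - W a) / D a := by field_simp
      rw [k3, abs_div, abs_of_pos h5, div_le_iff₀ h5]
      refine k2.trans (le_of_eq ?_)
      rw [he₁, he₂]
      simp only [pow_zero, mul_one, add_mul, Finset.sum_mul]
      have k4 : ∀ j ∈ Finset.range d, ((d : ℝ) - j) *
          (Real.exp (-(y a / 16)) * (W a * r j a + Real.exp (y a / 2))) =
          ((d : ℝ) - j) * (Real.exp (-(y a / 16)) * r j a) * (W a / D a) * D a +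
          ((d : ℝ) - j) * (Real.exp (-(y a / 16)) * (Real.exp (y a / 2) / D a)) * D a := by
        intro j _
        field_simp
      rw [Finset.sum_congr rfl k4, Finset.sum_add_distrib]
      have k5 : |∑ j ∈ Finset.range d, ((d : ℝ) - j) * r j a - 1| * (W a / D a) * D a =
          W a * |∑ j ∈ Finset.range d, ((d : ℝ) - j) * r j a - 1| := by
        field_simp
      linarith
  have hmain : Tendsto (fun a => Real.exp (y a ^ 2) * poissonWeight (t a) i *
      (y a ^ 2) ^ (d - 1 - i) / D a) l (nhds (((d - 1).factorial : ℝ) / i.factorial)) := by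
    have h1 := (hw.mul ((hratio.inv₀ one_ne_zero).pow (d - 1 - i))).const_mul
      (((d - 1).factorial : ℝ) / i.factorial)
    rw [inv_one, one_pow, mul_one, mul_one] at h1
    refine h1.congr' ?_
    filter_upwards [hμ, htop.eventually (eventually_gt_atTop 0), hDpos] with a h2 h3 h4
    rw [h2 i hi, hr]
    simp only [inv_div, div_pow, one_pow]
    field_simp
  have hdiff : Tendsto (fun a => (Z i a - Real.exp (y a ^ 2) * poissonWeight (t a) i) *
      (y a ^ 2) ^ (d - 1 - i) / D a) l (nhds 0) := by
    have h1 := hη.mul (hmain.add (hΛ (d - 1 - i)))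
    rw [zero_mul] at h1
    refine squeeze_zero_norm' ?_ h1
    filter_upwards [hZ, hDpos] with a h2 h3
    rw [Real.norm_eq_abs, abs_div, abs_of_pos h3, abs_mul, abs_of_nonneg (a := (y a ^ 2) ^ _)
      (by positivity), ← add_div, ← mul_div_assoc]
    refine div_le_div_of_nonneg_right ?_ h3.le
    rw [← add_mul, ← mul_assoc]
    exact mul_le_mul_of_nonneg_right (h2 i hi) (by positivity)
  have := hdiff.add hmain
  rw [zero_add] at this
  refine this.congr fun a => ?_
  ring

end

/-! ### Uniform estimates for typical load counts -/

/-- The filter of large `n`, together with typical times and load counts of total deficit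
`D n`. -/
def typicalFilter (d : ℕ) (D : ℕ → ℝ) : Filter (ℕ × ℝ × (ℕ → ℝ)) :=
  comap Prod.fst atTop ⊓ 𝓟 {a | 0 ≤ a.2.1 ∧ (∀ j, 0 ≤ a.2.2 j) ∧
    ∑ j ∈ Finset.range d, ((d : ℝ) - j) * a.2.2 j = D a.1 ∧
    ∀ j < d, |a.2.2 j - a.1 * poissonWeight a.2.1 j| ≤
      Real.exp (-(√(Real.log a.1) / 16)) *
        (a.1 * poissonWeight a.2.1 j + Real.exp (√(Real.log a.1) / 2))}

theorem tendsto_sqrt_log : Tendsto (fun n : ℕ => √(Real.log n)) atTop atTop :=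
  Real.tendsto_sqrt_atTop.comp (Real.tendsto_log_atTop.comp tendsto_natCast_atTop_atTop)

theorem exp_sqrt_log_sq {n : ℕ} (hn : 1 ≤ n) : Real.exp (√(Real.log n) ^ 2) = n := by
  have h : (1 : ℝ) ≤ n := by exact_mod_cast hn
  rw [Real.sq_sqrt (Real.log_nonneg h), Real.exp_log (by linarith)]

theorem tendsto_typicalFilter {d : ℕ} (hd : 1 ≤ d) {D : ℕ → ℝ}
    (hD1 : ∀ᶠ n : ℕ in atTop, Real.exp √(Real.log n) ≤ D n)
    (hD2 : ∀ᶠ n : ℕ in atTop, D n ≤ Real.exp √(Real.log n) + 2) {i : ℕ} (hi : i < d) :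
    Tendsto (fun a : ℕ × ℝ × (ℕ → ℝ) => a.2.2 i * Real.log a.1 ^ (d - 1 - i) / D a.1)
      (typicalFilter d D) (nhds (((d - 1).factorial : ℝ) / i.factorial)) := by
  have hfst : Tendsto (Prod.fst : ℕ × ℝ × (ℕ → ℝ) → ℕ) (typicalFilter d D) atTop :=
    tendsto_comap.mono_left inf_le_left
  have hmem : ∀ᶠ a : ℕ × ℝ × (ℕ → ℝ) in typicalFilter d D, 0 ≤ a.2.1 ∧ (∀ j, 0 ≤ a.2.2 j) ∧
    ∑ j ∈ Finset.range d, ((d : ℝ) - j) * a.2.2 j = D a.1 ∧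
    ∀ j < d, |a.2.2 j - a.1 * poissonWeight a.2.1 j| ≤
      Real.exp (-(√(Real.log a.1) / 16)) *
        (a.1 * poissonWeight a.2.1 j + Real.exp (√(Real.log a.1) / 2)) :=
    Filter.mem_inf_of_right (mem_principal_self _)
  have hone : ∀ᶠ a : ℕ × ℝ × (ℕ → ℝ) in typicalFilter d D, 1 ≤ a.1 :=
    hfst.eventually (eventually_ge_atTop 1)
  have h := tendsto_typical (y := fun a : ℕ × ℝ × (ℕ → ℝ) => √(Real.log a.1))
    (t := fun a => a.2.1) (D := fun a => D a.1) (Z := fun j a => a.2.2 j) hd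
    (tendsto_sqrt_log.comp hfst) (hfst.eventually hD1) (hfst.eventually hD2)
    (hmem.mono fun a h => h.1) (hmem.mono fun a h => h.2.1) (hmem.mono fun a h => h.2.2.1) ?_ hi
  · refine h.congr' ?_
    filter_upwards [hone] with a ha
    have : (1 : ℝ) ≤ a.1 := by exact_mod_cast ha
    rw [Real.sq_sqrt (Real.log_nonneg this)]
  · filter_upwards [hmem, hone] with a h1 h2
    rw [exp_sqrt_log_sq h2]
    exact h1.2.2.2

/-- A limit along `typicalFilter` is a limit in `n` uniform over all typical counts, which is what
taking expectations requires. -/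
theorem eventually_of_typicalFilter {d : ℕ} {D : ℕ → ℝ} {P : ℕ → (ℕ → ℝ) → Prop}
    (h : ∀ᶠ a in typicalFilter d D, P a.1 a.2.2) :
    ∀ᶠ n in atTop, ∀ Z : ℕ → ℝ, (∀ j, 0 ≤ Z j) →
      ∑ j ∈ Finset.range d, ((d : ℝ) - j) * Z j = D n →
      IsTypical d n (Real.exp (-(√(Real.log n) / 16))) (Real.exp (√(Real.log n) / 2)) Z →
      P n Z := by
  rw [typicalFilter, eventually_inf_principal, eventually_comap] at h
  filter_upwards [h] with n h1 Z hZ0 hsum ⟨t, ht, hZ⟩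
  exact h1 (n, t, Z) rfl ⟨ht, hZ0, hsum, hZ⟩

theorem eventually_weight_le {d : ℕ} (hd : 1 ≤ d) {D : ℕ → ℝ}
    (hD1 : ∀ᶠ n : ℕ in atTop, Real.exp √(Real.log n) ≤ D n)
    (hD2 : ∀ᶠ n : ℕ in atTop, D n ≤ Real.exp √(Real.log n) + 2) :
    ∃ C : ℝ, 0 < C ∧ ∀ᶠ n : ℕ in atTop, ∀ Z : ℕ → ℝ, (∀ j, 0 ≤ Z j) →
      ∑ j ∈ Finset.range d, ((d : ℝ) - j) * Z j = D n →
      IsTypical d n (Real.exp (-(√(Real.log n) / 16))) (Real.exp (√(Real.log n) / 2)) Z →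
      ∑ j ∈ Finset.range d, Z j * Real.log n ^ (d - 1 - j) ≤ C * D n := by
  refine ⟨∑ j ∈ Finset.range d, ((d - 1).factorial : ℝ) / j.factorial + 1, by positivity, ?_⟩
  have hlim : Tendsto (fun a : ℕ × ℝ × (ℕ → ℝ) =>
      ∑ j ∈ Finset.range d, a.2.2 j * Real.log a.1 ^ (d - 1 - j) / D a.1) (typicalFilter d D)
      (nhds (∑ j ∈ Finset.range d, ((d - 1).factorial : ℝ) / j.factorial)) :=
    tendsto_finsetSum _ fun j hj => tendsto_typicalFilter hd hD1 hD2 (Finset.mem_range.mp hj)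
  have h := eventually_of_typicalFilter (P := fun n Z =>
    ∑ j ∈ Finset.range d, Z j * Real.log n ^ (d - 1 - j) / D n <
      ∑ j ∈ Finset.range d, ((d - 1).factorial : ℝ) / j.factorial + 1)
    (hlim.eventually (gt_mem_nhds (lt_add_one _)))
  filter_upwards [h, hD1] with n h1 h2 Z hZ0 hsum hZ
  have h3 := h1 Z hZ0 hsum hZ
  have h4 : 0 < D n := by linarith [Real.exp_pos √(Real.log n)]
  rw [← Finset.sum_div, div_lt_iff₀ h4] at h3
  exact h3.le

/-- Among the degrees at most `d - k` only `d - k` itself matters; each unit below it costs a factor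
`1 / log n`. -/
theorem eventually_density_near {d k : ℕ} (hk : 1 ≤ k) (hkd : k ≤ d) {D : ℕ → ℝ}
    (hD1 : ∀ᶠ n : ℕ in atTop, Real.exp √(Real.log n) ≤ D n)
    (hD2 : ∀ᶠ n : ℕ in atTop, D n ≤ Real.exp √(Real.log n) + 2) {δ : ℝ} (hδ : 0 < δ) :
    ∀ᶠ n : ℕ in atTop, ∀ Z : ℕ → ℝ, (∀ j, 0 ≤ Z j) →
      ∑ j ∈ Finset.range d, ((d : ℝ) - j) * Z j = D n →
      IsTypical d n (Real.exp (-(√(Real.log n) / 16))) (Real.exp (√(Real.log n) / 2)) Z →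
      |(∑ j ∈ Finset.range (d + 1 - k), Z j) * Real.log n ^ (k - 1) / D n -
        ((d - 1).factorial : ℝ) / (d - k).factorial| ≤ δ := by
  have hfst : Tendsto (Prod.fst : ℕ × ℝ × (ℕ → ℝ) → ℕ) (typicalFilter d D) atTop :=
    tendsto_comap.mono_left inf_le_left
  have hlogtop : Tendsto (fun a : ℕ × ℝ × (ℕ → ℝ) => Real.log a.1) (typicalFilter d D) atTop :=
    (Real.tendsto_log_atTop.comp tendsto_natCast_atTop_atTop).comp hfst
  have hinv : Tendsto (fun a : ℕ × ℝ × (ℕ → ℝ) => (Real.log a.1)⁻¹) (typicalFilter d D)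
    (nhds 0) := tendsto_inv_atTop_zero.comp hlogtop
  have hlim : Tendsto (fun a : ℕ × ℝ × (ℕ → ℝ) =>
      ∑ j ∈ Finset.range (d + 1 - k), a.2.2 j * Real.log a.1 ^ (d - 1 - j) / D a.1 *
        (Real.log a.1)⁻¹ ^ (d - k - j)) (typicalFilter d D)
      (nhds (∑ j ∈ Finset.range (d + 1 - k), ((d - 1).factorial : ℝ) / j.factorial *
        0 ^ (d - k - j))) := by
    refine tendsto_finsetSum _ fun j hj => ?_
    have hj' := Finset.mem_range.mp hj
    exact (tendsto_typicalFilter (by omega) hD1 hD2 (by omega)).mul (hinv.pow _)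
  have hval : ∑ j ∈ Finset.range (d + 1 - k), ((d - 1).factorial : ℝ) / j.factorial *
        0 ^ (d - k - j) = ((d - 1).factorial : ℝ) / (d - k).factorial := by
    rw [Finset.sum_eq_single (d - k)]
    · simp
    · intro j hj hne
      have hj' := Finset.mem_range.mp hj
      rw [zero_pow (by omega), mul_zero]
    · intro h
      exact absurd (Finset.mem_range.mpr (by omega)) h
  rw [hval] at hlim
  refine eventually_of_typicalFilter (P := fun n Z =>
    |(∑ j ∈ Finset.range (d + 1 - k), Z j) * Real.log n ^ (k - 1) / D n -
        ((d - 1).factorial : ℝ) / (d - k).factorial| ≤ δ) ?_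
  have h := hlim.eventually (Metric.closedBall_mem_nhds _ hδ)
  filter_upwards [h, hlogtop.eventually (eventually_gt_atTop 0)] with a h1 h2
  rw [Real.dist_eq] at h1
  refine le_trans (le_of_eq ?_) h1
  congr 2
  rw [Finset.sum_mul, Finset.sum_div]
  refine Finset.sum_congr rfl fun j hj => ?_
  have hj' := Finset.mem_range.mp hj
  have h3 : d - 1 - j = (k - 1) + (d - k - j) := by omega
  rw [h3, pow_add, inv_pow]
  field_simp

/-! ### The probability of atypical load counts -/

/-- An upper bound for the probability that the load counts are not typical. -/
noncomputable def atypicalBound (d n : ℕ) : ℝ :=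
  (d * n : ℝ) ^ (d * d) * (4 * n * (√(2 * d * n * 2 ^ d) *
    Real.exp (-(Real.exp (-(√(Real.log n) / 16)) ^ 2 * Real.exp (√(Real.log n) / 2) / 8))))

theorem atypicalBound_nonneg (d n : ℕ) : 0 ≤ atypicalBound d n := by
  unfold atypicalBound; positivity

/-- With `y = √(log n)` the exponent contains `exp (-(y / 16)) ^ 2 * exp (y / 2) = exp (3 y / 8)`,
which beats every multiple of `y ^ 2 = log n`; so the bound is smaller than any power of `1 / n`. -/
theorem tendsto_log_pow_mul_atypicalBound (d q : ℕ) :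
    Tendsto (fun n : ℕ => Real.log n ^ q * atypicalBound d n) atTop (nhds 0) := by
  set A : ℕ := q + (d * d + 2) with hA
  set C : ℝ := (d : ℝ) ^ (d * d) * (4 * (2 * d * 2 ^ d + 1)) with hC
  have hC0 : 0 ≤ C := by positivity
  have hexp : ∀ᶠ y : ℝ in atTop, 8 * (A + 1) * (1 + y ^ 2) ^ 1 < Real.exp (3 / 8 * y) := by
    have h1 := (tendsto_id.const_mul_atTop (by norm_num : (0 : ℝ) < 3 / 8)).eventually
      (eventually_mul_one_add_sq_pow_lt_exp 1 (8 * (A + 1) * (64 / 9)))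
    filter_upwards [h1] with y h2
    simp only [id, pow_one] at h2 ⊢
    nlinarith [sq_nonneg y]
  have hlim : Tendsto (fun n : ℕ => C * (n : ℝ)⁻¹) atTop (nhds 0) := by
    simpa using (tendsto_inv_atTop_zero.comp
      (tendsto_natCast_atTop_atTop (R := ℝ))).const_mul C
  refine squeeze_zero' ?_ ?_ hlim
  · filter_upwards [eventually_ge_atTop 1] with n hn
    have : (1 : ℝ) ≤ n := by exact_mod_cast hn
    exact mul_nonneg (pow_nonneg (Real.log_nonneg this) _) (atypicalBound_nonneg d n)
  · filter_upwards [eventually_ge_atTop 1, tendsto_sqrt_log.eventually hexp] with n hn h1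
    have hn1 : (1 : ℝ) ≤ n := by exact_mod_cast hn
    have hlog : Real.log n ≤ n := (Real.log_le_sub_one_of_pos (by linarith)).trans (by linarith)
    have hlog0 : 0 ≤ Real.log n := Real.log_nonneg hn1
    set y := √(Real.log n) with hy
    have hyn : Real.exp (y ^ 2) = n := exp_sqrt_log_sq hn
    have e1 : Real.exp (-(y / 16)) ^ 2 * Real.exp (y / 2) = Real.exp (3 / 8 * y) := by
      rw [← Real.exp_nat_mul, ← Real.exp_add]; congr 1; push_cast; ring
    have e2 : Real.exp (-(Real.exp (3 / 8 * y) / 8)) ≤ ((n : ℝ) ^ (A + 1))⁻¹ := by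
      rw [← hyn, ← Real.exp_nat_mul, ← Real.exp_neg, Real.exp_le_exp]
      push_cast
      rw [pow_one] at h1
      have : (0 : ℝ) ≤ A := by positivity
      nlinarith
    have e3 : √(2 * d * n * 2 ^ d) ≤ (2 * d * 2 ^ d + 1) * n := by
      rw [Real.sqrt_le_left (by positivity)]
      have h2 : (0 : ℝ) ≤ 2 * d * 2 ^ d := by positivity
      have h3 : 2 * d * n * 2 ^ d = (2 * d * 2 ^ d : ℝ) * n := by ring
      rw [h3, mul_pow]
      have h4 : (n : ℝ) ≤ n ^ 2 := by nlinarith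
      have h5 : (2 * d * 2 ^ d : ℝ) ≤ (2 * d * 2 ^ d + 1) ^ 2 := by nlinarith
      exact mul_le_mul h5 h4 (by linarith) (by positivity)
    unfold atypicalBound
    rw [← hy, e1]
    calc Real.log n ^ q * ((d * n : ℝ) ^ (d * d) * (4 * n * (√(2 * d * n * 2 ^ d) *
          Real.exp (-(Real.exp (3 / 8 * y) / 8)))))
        ≤ (n : ℝ) ^ q * ((d * n : ℝ) ^ (d * d) * (4 * n * (((2 * d * 2 ^ d + 1) * n) *
          ((n : ℝ) ^ (A + 1))⁻¹))) := by gcongr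
      _ = C * (n : ℝ)⁻¹ := by
        rw [hC, hA, mul_pow]
        have : (n : ℝ) ≠ 0 := by linarith
        field_simp
        ring

/-! ### Degree counts of a graph -/

theorem sum_unsat_eq (d : ℕ) (G : SimpleGraph V) (g : ℕ → ℝ) :
    ∑ v ∈ unsat d G, g (G.degree v) =
      ∑ j ∈ Finset.range d, (loadCount (fun v => G.degree v) j : ℝ) * g j := by
  rw [← Finset.sum_fiberwise_of_maps_to (s := unsat d G) (t := Finset.range d)
    (g := fun v => G.degree v) fun v hv => Finset.mem_range.mpr (mem_unsat.mp hv)]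
  refine Finset.sum_congr rfl fun j hj => ?_
  have h1 : (unsat d G).filter (fun v => G.degree v = j) =
      Finset.univ.filter fun v => G.degree v = j := by
    ext v
    simp only [Finset.mem_filter, mem_unsat, Finset.mem_univ, true_and, and_iff_right_iff_imp]
    rintro rfl
    exact Finset.mem_range.mp hj
  rw [h1, Finset.sum_congr rfl (g := fun _ => g j), Finset.sum_const, nsmul_eq_mul]
  · rfl
  · intro v hv
    rw [(Finset.mem_filter.mp hv).2]

theorem sum_loadCount_eq_deficitSum (d : ℕ) (G : SimpleGraph V) :
    ∑ j ∈ Finset.range d, ((d : ℝ) - j) * loadCount (fun v => G.degree v) j = deficitSum d G := by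
  rw [deficitSum_eq_sum_unsat, Nat.cast_sum]
  have h1 := sum_unsat_eq d G fun j => (d : ℝ) - j
  rw [Finset.sum_congr rfl fun j _ => mul_comm _ _, ← h1]
  refine Finset.sum_congr rfl fun v hv => ?_
  rw [Nat.cast_sub (mem_unsat.mp hv).le]

theorem card_deficient_eq_sum_loadCount {d k : ℕ} (hk : k ≤ d) (G : SimpleGraph V) :
    ((deficient d k G).card : ℝ) =
      ∑ j ∈ Finset.range (d + 1 - k), (loadCount (fun v => G.degree v) j : ℝ) := by
  have h1 := sum_unsat_eq (d + 1 - k) G fun _ => 1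
  simp only [mul_one, Finset.sum_const, nsmul_eq_mul] at h1
  rw [← h1]
  congr 2
  ext v
  rw [mem_deficient, mem_unsat]
  omega

/-! ### Cut weights in terms of the degrees -/

theorem sum_powersetCard_prod_le {ι : Type*} (s : Finset ι) {x : ι → ℝ} (hx : ∀ i ∈ s, 0 ≤ x i)
    (m : ℕ) : ∑ S ∈ s.powersetCard m, ∏ i ∈ S, x i ≤ (∑ i ∈ s, x i) ^ m := by
  induction s using Finset.induction_on generalizing m with
  | empty =>
    cases m with
    | zero => simp
    | succ m => rw [Finset.powersetCard_eq_empty.mpr (by simp)]; simp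
  | insert a s ha ih =>
    have hxs : ∀ i ∈ s, 0 ≤ x i := fun i hi => hx i (Finset.mem_insert_of_mem hi)
    have hxa : 0 ≤ x a := hx a (Finset.mem_insert_self _ _)
    have hX : 0 ≤ ∑ i ∈ s, x i := Finset.sum_nonneg hxs
    cases m with
    | zero => simp
    | succ m =>
      rw [Finset.powersetCard_succ_insert ha, Finset.sum_union, Finset.sum_image,
        Finset.sum_insert ha]
      · have h1 : ∑ S ∈ s.powersetCard m, ∏ i ∈ insert a S, x i =
            x a * ∑ S ∈ s.powersetCard m, ∏ i ∈ S, x i := by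
          rw [Finset.mul_sum]
          refine Finset.sum_congr rfl fun S hS => ?_
          rw [Finset.prod_insert fun h => ha ((Finset.mem_powersetCard.mp hS).1 h)]
        rw [h1]
        have h2 : (∑ i ∈ s, x i) ^ m ≤ (x a + ∑ i ∈ s, x i) ^ m := by gcongr; linarith
        calc _ ≤ (∑ i ∈ s, x i) ^ (m + 1) + x a * (∑ i ∈ s, x i) ^ m :=
              add_le_add (ih hxs _) (mul_le_mul_of_nonneg_left (ih hxs _) hxa)
          _ = (x a + ∑ i ∈ s, x i) * (∑ i ∈ s, x i) ^ m := by ring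
          _ ≤ _ := by rw [pow_succ']; gcongr
      · intro S hS T hT h
        have hS' := fun h => ha ((Finset.mem_powersetCard.mp hS).1 h)
        have hT' := fun h => ha ((Finset.mem_powersetCard.mp hT).1 h)
        rw [← Finset.erase_insert hS', ← Finset.erase_insert hT', h]
      · refine Finset.disjoint_left.mpr fun S hS hS2 => ?_
        obtain ⟨T, -, rfl⟩ := Finset.mem_image.mp hS2
        exact ha ((Finset.mem_powersetCard.mp hS).1 (Finset.mem_insert_self _ _))

theorem card_powersetCard_filter_pair_le {ι : Type*} (s : Finset ι) {a b : ι} (hab : a ≠ b)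
    (m : ℕ) : ((s.powersetCard m).filter fun S => a ∈ S ∧ b ∈ S).card ≤ s.card ^ (m - 2) := by
  have h1 : ((s.powersetCard m).filter fun S => a ∈ S ∧ b ∈ S).card ≤
      (s.powersetCard (m - 2)).card := by
    refine Finset.card_le_card_of_injOn (fun S => S \ {a, b}) ?_ ?_
    · intro S hS
      obtain ⟨h1, h2, h3⟩ := Finset.mem_filter.mp hS
      obtain ⟨h4, h5⟩ := Finset.mem_powersetCard.mp h1
      refine Finset.mem_powersetCard.mpr ⟨Finset.sdiff_subset.trans h4, ?_⟩
      rw [Finset.card_sdiff_of_subset, Finset.card_pair hab, h5]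
      intro x hx
      rcases Finset.mem_insert.mp hx with rfl | hx
      · exact h2
      · rwa [Finset.mem_singleton.mp hx]
    · intro S hS T hT h
      obtain ⟨-, hS2, hS3⟩ := Finset.mem_filter.mp hS
      obtain ⟨-, hT2, hT3⟩ := Finset.mem_filter.mp hT
      have hsub : ∀ R : Finset ι, a ∈ R → b ∈ R → {a, b} ⊆ R := fun R h1 h2 x hx => by
        rcases Finset.mem_insert.mp hx with rfl | hx
        · exact h1
        · rwa [Finset.mem_singleton.mp hx]
      rw [← Finset.sdiff_union_of_subset (hsub S hS2 hS3),
        ← Finset.sdiff_union_of_subset (hsub T hT2 hT3)]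
      simp only at h
      rw [h]
  refine h1.trans ?_
  rw [Finset.card_powersetCard]
  exact Nat.choose_le_pow _ _

theorem card_powersetCard_filter_adj_le {d : ℕ} {G : SimpleGraph V} (hG : ∀ v, G.degree v ≤ d)
    (U : Finset V) (m : ℕ) :
    ((U.powersetCard m).filter fun S => ∃ v ∈ S, ∃ w ∈ S, G.Adj v w).card ≤
      d * U.card ^ (m - 1) := by
  rcases Nat.lt_or_ge m 2 with hm | hm
  · rw [Finset.card_eq_zero.mpr]
    · exact Nat.zero_le _
    · rw [Finset.filter_eq_empty_iff]
      rintro S hS ⟨v, hv, w, hw, hvw⟩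
      have h1 := (Finset.mem_powersetCard.mp hS).2
      exact hvw.ne (Finset.card_le_one.mp (by omega) v hv w hw)
  · have hsub : (U.powersetCard m).filter (fun S => ∃ v ∈ S, ∃ w ∈ S, G.Adj v w) ⊆
        (U.sigma fun v => G.neighborFinset v).biUnion fun p =>
          (U.powersetCard m).filter fun S => p.1 ∈ S ∧ p.2 ∈ S := by
      intro S hS
      obtain ⟨h1, v, hv, w, hw, hvw⟩ := Finset.mem_filter.mp hS
      refine Finset.mem_biUnion.mpr ⟨⟨v, w⟩, ?_, Finset.mem_filter.mpr ⟨h1, hv, hw⟩⟩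
      refine Finset.mem_sigma.mpr ⟨(Finset.mem_powersetCard.mp h1).1 hv, ?_⟩
      rw [SimpleGraph.mem_neighborFinset]
      exact hvw
    refine (Finset.card_le_card hsub).trans (Finset.card_biUnion_le.trans ?_)
    calc _ ≤ ∑ p ∈ U.sigma fun v => G.neighborFinset v, U.card ^ (m - 2) := by
          refine Finset.sum_le_sum fun p hp => card_powersetCard_filter_pair_le _ ?_ _
          have := (Finset.mem_sigma.mp hp).2
          rw [SimpleGraph.mem_neighborFinset] at this
          exact this.ne
      _ = (∑ v ∈ U, G.degree v) * U.card ^ (m - 2) := by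
          rw [Finset.sum_const, smul_eq_mul, Finset.card_sigma]
          rfl
      _ ≤ U.card * d * U.card ^ (m - 2) := by
          gcongr
          exact Finset.sum_le_card_nsmul _ _ _ fun v _ => hG v
      _ = d * U.card ^ (m - 1) := by
          rw [show m - 1 = m - 2 + 1 by omega]
          ring

theorem pow_mul_cutWeight_le {d m : ℕ} {b : ℝ} (hb : 1 ≤ b) (S : Finset V)
    (G : SimpleGraph V) : b ^ (m * (d - 1)) * cutWeight d b S G ≤ b ^ (m * (d - 1)) := by
  refine mul_le_of_le_one_right (by positivity) ?_
  unfold cutWeight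
  split_ifs
  · exact pow_le_one₀ (by positivity) (inv_le_one_of_one_le₀ hb)
  · exact zero_le_one

theorem pow_mul_cutWeight_eq {d m : ℕ} {b : ℝ} (hb : 1 ≤ b) {S : Finset V} (hS : S.card = m)
    {G : SimpleGraph V} (hSU : S ⊆ unsat d G) (h : ¬ ∃ v ∈ S, ∃ w ∈ S, G.Adj v w) :
    b ^ (m * (d - 1)) * cutWeight d b S G = ∏ v ∈ S, b ^ (d - 1 - G.degree v) := by
  have h1 : ∑ v ∈ S, ((G.neighborFinset v).filter (· ∈ S)).card = 0 := by
    refine Finset.sum_eq_zero fun v hv => ?_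
    rw [Finset.card_eq_zero, Finset.filter_eq_empty_iff]
    intro w hw hwS
    rw [SimpleGraph.mem_neighborFinset] at hw
    exact h ⟨v, hv, w, hwS, hw⟩
  have h2 := sum_degree_eq_cut_add S G
  rw [h1, add_zero] at h2
  have h3 : m * (d - 1) = ∑ v ∈ S, (d - 1 - G.degree v) + cut S G := by
    rw [← h2, ← Finset.sum_add_distrib, ← hS, ← smul_eq_mul, ← Finset.sum_const]
    refine Finset.sum_congr rfl fun v hv => ?_
    have := mem_unsat.mp (hSU hv)
    omega
  have hb0 : b ≠ 0 := by linarith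
  rw [cutWeight, if_pos hSU, h3, pow_add, mul_assoc, ← mul_pow, mul_inv_cancel₀ hb0, one_pow,
    mul_one, Finset.prod_pow_eq_pow_sum]

theorem sumCutWeight_eq_sum_unsat {d m : ℕ} {b : ℝ} (G : SimpleGraph V) :
    sumCutWeight d m b G = ∑ S ∈ (unsat d G).powersetCard m, cutWeight d b S G := by
  unfold sumCutWeight
  symm
  refine Finset.sum_subset (Finset.powersetCard_mono (Finset.subset_univ _)) fun S hS hSU => ?_
  rw [cutWeight, if_neg]
  intro h
  exact hSU (Finset.mem_powersetCard.mpr ⟨h, (Finset.mem_powersetCard.mp hS).2⟩)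

/-- For independent sets the cut is the sum of the degrees, so the scaled weights are products over
the vertices and sum to at most an `m`-th power. Sets containing an edge are bounded trivially, but
there are only `d * u ^ (m - 1)` of them. -/
theorem pow_mul_sumCutWeight_le {d m : ℕ} {b : ℝ} (hb : 1 ≤ b) {G : SimpleGraph V}
    (hG : ∀ v, G.degree v ≤ d) :
    b ^ (m * (d - 1)) * sumCutWeight d m b G ≤
      (∑ v ∈ unsat d G, b ^ (d - 1 - G.degree v)) ^ m +
        d * ((unsat d G).card : ℝ) ^ (m - 1) * b ^ (m * (d - 1)) := by
  rw [sumCutWeight_eq_sum_unsat, Finset.mul_sum,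
    ← Finset.sum_filter_not_add_sum_filter _ (fun S => ∃ v ∈ S, ∃ w ∈ S, G.Adj v w)]
  refine add_le_add ?_ ?_
  · refine le_trans ?_ (sum_powersetCard_prod_le _ (fun v _ => by positivity) m)
    calc _ = ∑ S ∈ ((unsat d G).powersetCard m).filter fun S => ¬ ∃ v ∈ S, ∃ w ∈ S, G.Adj v w,
          ∏ v ∈ S, b ^ (d - 1 - G.degree v) := by
          refine Finset.sum_congr rfl fun S hS => ?_
          obtain ⟨h1, h2⟩ := Finset.mem_filter.mp hS
          obtain ⟨h3, h4⟩ := Finset.mem_powersetCard.mp h1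
          exact pow_mul_cutWeight_eq hb h4 h3 h2
      _ ≤ _ := Finset.sum_le_sum_of_subset_of_nonneg (Finset.filter_subset _ _)
          fun S _ _ => Finset.prod_nonneg fun v _ => by positivity
  · calc _ ≤ ∑ S ∈ ((unsat d G).powersetCard m).filter fun S => ∃ v ∈ S, ∃ w ∈ S, G.Adj v w,
          b ^ (m * (d - 1)) := Finset.sum_le_sum fun S _ =>
            pow_mul_cutWeight_le hb S G
      _ ≤ _ := by
          rw [Finset.sum_const, nsmul_eq_mul]
          refine mul_le_mul_of_nonneg_right ?_ (by positivity)
          exact_mod_cast card_powersetCard_filter_adj_le hG _ m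

theorem pow_mul_sumCutWeight_le_card {d m : ℕ} {b : ℝ} (hb : 1 ≤ b) (G : SimpleGraph V) :
    b ^ (m * (d - 1)) * sumCutWeight d m b G ≤
      ((unsat d G).card : ℝ) ^ m * b ^ (m * (d - 1)) := by
  rw [sumCutWeight_eq_sum_unsat, Finset.mul_sum]
  calc _ ≤ ∑ S ∈ (unsat d G).powersetCard m, b ^ (m * (d - 1)) := Finset.sum_le_sum fun S _ =>
          pow_mul_cutWeight_le hb S G
    _ ≤ _ := by
        rw [Finset.sum_const, nsmul_eq_mul, Finset.card_powersetCard]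
        refine mul_le_mul_of_nonneg_right ?_ (by positivity)
        exact_mod_cast Nat.choose_le_pow _ _

/-! ### The state of the process when the deficit is about `exp √(log n)` -/

theorem eventually_log_pow_le_exp (q : ℕ) :
    ∀ᶠ n : ℕ in atTop, Real.log n ^ q ≤ Real.exp √(Real.log n) := by
  filter_upwards [tendsto_sqrt_log.eventually (eventually_mul_one_add_sq_pow_lt_exp q 1),
    eventually_ge_atTop 1] with n h hn
  have h0 : 0 ≤ Real.log n := Real.log_nonneg (by exact_mod_cast hn)
  rw [Real.sq_sqrt h0, one_mul] at h
  refine le_trans ?_ h.le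
  gcongr
  linarith

theorem eventually_one_le_log : ∀ᶠ n : ℕ in atTop, 1 ≤ Real.log n :=
  (Real.tendsto_log_atTop.comp tendsto_natCast_atTop_atTop).eventually (eventually_ge_atTop 1)

theorem eventually_le_of_exp_sqrt_log_le {D : ℕ → ℝ}
    (hD1 : ∀ᶠ n : ℕ in atTop, Real.exp √(Real.log n) ≤ D n) (c : ℝ) :
    ∀ᶠ n in atTop, c ≤ D n := by
  filter_upwards [hD1, (Real.tendsto_exp_atTop.comp tendsto_sqrt_log).eventually
    (eventually_ge_atTop c)] with n h1 h2
  exact le_trans h2 h1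

/-- The indicator that the degree counts of `G` are not typical. -/
noncomputable def atypical (d : ℕ) {n : ℕ} (G : SimpleGraph (Fin n)) : ℝ :=
  if IsTypical d n (Real.exp (-(√(Real.log n) / 16))) (Real.exp (√(Real.log n) / 2))
    (fun j => loadCount (fun v => G.degree v) j) then 0 else 1

theorem eventually_expect_atypical_le {d : ℕ} (hd : 1 ≤ d) {s D : ℕ → ℕ}
    (hs : ∀ᶠ n in atTop, D n + 2 * s n = d * n)
    (hD1 : ∀ᶠ n : ℕ in atTop, Real.exp √(Real.log n) ≤ D n) :
    ∀ᶠ n in atTop, expect d (s n) (atypical d (n := n)) ≤ atypicalBound d n := by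
  filter_upwards [hs, eventually_le_of_exp_sqrt_log_le hD1 (2 * (d * d) + 2 : ℕ),
    eventually_ge_atTop 1] with n h1 h2 hn
  have h3 : 2 * (d * d) + 2 ≤ D n := by exact_mod_cast h2
  have : Nonempty (Fin n) := ⟨⟨0, hn⟩⟩
  have h := expect_not_isTypical_le (V := Fin n) (d := d) (s := s n)
    (η := Real.exp (-(√(Real.log n) / 16))) (Λ := Real.exp (√(Real.log n) / 2)) hd
    (by rw [Fintype.card_fin]; omega) (Real.exp_pos _).le
    (Real.exp_le_one_iff.mpr (by simp only [Left.neg_nonpos_iff]; positivity)) (Real.exp_pos _).le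
  simp only [Fintype.card_fin] at h
  exact h

/-- For typical degree counts the sum of `b ^ (deficit - 1)` over the unsaturated vertices is
`O(D)`. Atypical graphs have at most `D ^ m * b ^ q` in scaled weight and a probability far below `b
^ (-q)`. -/
theorem exists_eventually_start_weight_le {d : ℕ} (hd : 1 ≤ d) {s D : ℕ → ℕ}
    (hs : ∀ᶠ n in atTop, D n + 2 * s n = d * n)
    (hD1 : ∀ᶠ n : ℕ in atTop, Real.exp √(Real.log n) ≤ D n)
    (hD2 : ∀ᶠ n : ℕ in atTop, (D n : ℝ) ≤ Real.exp √(Real.log n) + 2) (m : ℕ) :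
    ∃ C : ℝ, 0 ≤ C ∧ ∀ᶠ n : ℕ in atTop, Real.log n ^ (m * (d - 1)) *
      expect d (s n) (sumCutWeight (V := Fin n) d m (Real.log n)) ≤ C * (D n : ℝ) ^ m := by
  obtain ⟨C, hC, hX⟩ := eventually_weight_le hd hD1 hD2
  refine ⟨C ^ m + d + 1, by positivity, ?_⟩
  filter_upwards [hX, hs, hD1, eventually_log_pow_le_exp (m * (d - 1)), eventually_one_le_log,
    eventually_expect_atypical_le hd hs hD1,
    eventually_le_of_exp_sqrt_log_le hD1 (2 * (d * d) + 2 : ℕ),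
    (tendsto_log_pow_mul_atypicalBound d (m * (d - 1))).eventually (ge_mem_nhds zero_lt_one)]
    with n hX hs hD1 hpow hb hatyp hDbig hsmall
  have h3 : 2 * (d * d) + 2 ≤ D n := by exact_mod_cast hDbig
  set b := Real.log n with hbdef
  set q := m * (d - 1) with hq
  have hG : ∀ G ∈ (dProcessLaw (Fin n) d (s n)).support,
      b ^ q * sumCutWeight d m b G ≤
        (C ^ m + d) * (D n : ℝ) ^ m + (D n : ℝ) ^ m * b ^ q * atypical d G := by
    intro G hG
    have hdef : deficitSum d G = D n := by
      have := law_deficitSum hG (by rw [Fintype.card_fin]; nlinarith)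
      rw [Fintype.card_fin] at this
      omega
    have hu : ((unsat d G).card : ℝ) ≤ D n := by
      rw [← hdef]; exact_mod_cast card_unsat_le_deficitSum d G
    have hDpos : (1 : ℝ) ≤ D n := by exact_mod_cast (by omega : 1 ≤ D n)
    unfold atypical
    split_ifs with ht
    · have h1 := hX _ (fun j => Nat.cast_nonneg _)
        (by rw [sum_loadCount_eq_deficitSum, hdef]) ht
      have h2 := sum_unsat_eq d G fun j => b ^ (d - 1 - j)
      rw [← h2] at h1
      refine (pow_mul_sumCutWeight_le hb (law_degree_le hG)).trans ?_
      have h4 : (∑ v ∈ unsat d G, b ^ (d - 1 - G.degree v)) ^ m ≤ C ^ m * (D n : ℝ) ^ m := by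
        rw [← mul_pow]
        gcongr
      -- The factor `D` missing for sets with an inner edge outweighs `b ^ q`, because `D ≥ exp
      -- √(log n)` exceeds every power of `log n`.
      have h5 : ((unsat d G).card : ℝ) ^ (m - 1) * b ^ q ≤ (D n : ℝ) ^ m := by
        rcases Nat.eq_zero_or_pos m with rfl | hm
        · simp [hq]
        · calc _ ≤ (D n : ℝ) ^ (m - 1) * (D n : ℝ) := by gcongr; exact hpow.trans hD1
            _ = (D n : ℝ) ^ m := by rw [← pow_succ]; congr 1; omega
      have h6 : (0 : ℝ) ≤ d := by positivity
      rw [mul_assoc (d : ℝ)]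
      nlinarith
    · refine (pow_mul_sumCutWeight_le_card hb G).trans ?_
      rw [mul_one]
      have : ((unsat d G).card : ℝ) ^ m * b ^ q ≤ (D n : ℝ) ^ m * b ^ q := by gcongr
      have h7 : 0 ≤ (C ^ m + d) * (D n : ℝ) ^ m := by positivity
      linarith
  have h := expect_mono hG
  rw [expect_const_mul, expect_add_fun, expect_const, expect_const_mul] at h
  have h8 : (D n : ℝ) ^ m * b ^ q * expect d (s n) (atypical d (n := n)) ≤ (D n : ℝ) ^ m * 1 := by
    rw [mul_assoc]
    refine mul_le_mul_of_nonneg_left (le_trans ?_ hsmall) (by positivity)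
    exact mul_le_mul_of_nonneg_left hatyp (by positivity)
  linarith

theorem eventually_start_density_near {d k : ℕ} (hk : 1 ≤ k) (hkd : k ≤ d) {s D : ℕ → ℕ}
    (hs : ∀ᶠ n in atTop, D n + 2 * s n = d * n)
    (hD1 : ∀ᶠ n : ℕ in atTop, Real.exp √(Real.log n) ≤ D n)
    (hD2 : ∀ᶠ n : ℕ in atTop, (D n : ℝ) ≤ Real.exp √(Real.log n) + 2) {δ : ℝ} (hδ : 0 < δ) :
    ∀ᶠ n : ℕ in atTop, |expect d (s n) (fun G : SimpleGraph (Fin n) => ((deficient d k G).card : ℝ))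
      / D n * Real.log n ^ (k - 1) - ((d - 1).factorial : ℝ) / (d - k).factorial| ≤ δ := by
  set κ : ℝ := ((d - 1).factorial : ℝ) / (d - k).factorial with hκ
  have hκ0 : 0 ≤ κ := by positivity
  have hlim : Tendsto (fun n : ℕ => Real.log n ^ (k - 1) * atypicalBound d n +
      κ * (Real.log n ^ 0 * atypicalBound d n)) atTop (nhds 0) := by
    simpa using (tendsto_log_pow_mul_atypicalBound d (k - 1)).add
      ((tendsto_log_pow_mul_atypicalBound d 0).const_mul κ)
  filter_upwards [eventually_density_near hk hkd hD1 hD2 (half_pos hδ), hs, hD1,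
    eventually_one_le_log, eventually_expect_atypical_le (hk.trans hkd) hs hD1,
    eventually_le_of_exp_sqrt_log_le hD1 (2 * (d * d) + 2 : ℕ),
    hlim.eventually (ge_mem_nhds (half_pos hδ))] with n hX hs hD1 hb hatyp hDbig hsmall
  have h3 : 2 * (d * d) + 2 ≤ D n := by exact_mod_cast hDbig
  have hDpos : (0 : ℝ) < D n := by exact_mod_cast (by omega : 0 < D n)
  set b := Real.log n with hbdef
  have hG : ∀ G ∈ (dProcessLaw (Fin n) d (s n)).support,
      |b ^ (k - 1) / D n * ((deficient d k G).card : ℝ) - κ| ≤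
        δ / 2 + (b ^ (k - 1) + κ) * atypical d G := by
    intro G hG
    have hdef : deficitSum d G = D n := by
      have := law_deficitSum hG (by rw [Fintype.card_fin]; nlinarith)
      rw [Fintype.card_fin] at this
      omega
    unfold atypical
    split_ifs with ht
    · have h1 := hX _ (fun j => Nat.cast_nonneg _)
        (by rw [sum_loadCount_eq_deficitSum, hdef]) ht
      rw [← card_deficient_eq_sum_loadCount hkd] at h1
      rw [mul_zero, add_zero]
      refine le_trans (le_of_eq ?_) h1
      congr 2
      ring
    · have hN : ((deficient d k G).card : ℝ) ≤ D n := by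
        rw [← hdef]
        exact_mod_cast (Finset.card_le_card (deficient_subset_unsat hk G)).trans
          (card_unsat_le_deficitSum d G)
      have h1 : b ^ (k - 1) / D n * ((deficient d k G).card : ℝ) ≤ b ^ (k - 1) := by
        rw [div_mul_eq_mul_div, div_le_iff₀ hDpos]
        gcongr
      have h2 : 0 ≤ b ^ (k - 1) / D n * ((deficient d k G).card : ℝ) := by positivity
      have h4 : 0 ≤ b ^ (k - 1) := by positivity
      rw [mul_one, abs_le]
      constructor <;> linarith
  have h := abs_expect_le hG
  rw [expect_add_fun, expect_const, expect_const_mul, expect_sub_fun, expect_const,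
    expect_const_mul] at h
  have h5 : (b ^ (k - 1) + κ) * expect d (s n) (atypical d (n := n)) ≤ δ / 2 := by
    refine le_trans (mul_le_mul_of_nonneg_left hatyp (by positivity)) ?_
    rw [pow_zero, one_mul] at hsmall
    linarith
  calc _ = |b ^ (k - 1) / D n * expect d (s n)
        (fun G : SimpleGraph (Fin n) => ((deficient d k G).card : ℝ)) - κ| := by
        congr 2; ring
    _ ≤ δ := by linarith

/-! ### The probability of failure -/

/-- The number of steps after which the deficit is about `exp √(log n)`. -/
noncomputable def startTime (d n : ℕ) : ℕ := (d * n - ⌈Real.exp √(Real.log n)⌉₊) / 2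

/-- The deficit after `startTime d n` steps. -/
noncomputable def startDeficit (d n : ℕ) : ℕ := d * n - 2 * startTime d n

theorem eventually_ceil_le {d : ℕ} (hd : 2 ≤ d) :
    ∀ᶠ n : ℕ in atTop, ⌈Real.exp √(Real.log n)⌉₊ ≤ d * n := by
  filter_upwards [eventually_one_le_log, eventually_ge_atTop 1] with n h hn
  have hn1 : (1 : ℝ) ≤ n := by exact_mod_cast hn
  have h1 : Real.exp √(Real.log n) ≤ n := by
    rw [← Real.exp_log (show (0 : ℝ) < n by linarith), Real.exp_le_exp, Real.log_exp]
    exact Real.sqrt_le_iff.mpr ⟨by linarith, by nlinarith⟩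
  exact (Nat.ceil_le.mpr h1).trans (Nat.le_mul_of_pos_left n (by omega))

theorem startDeficit_add (d n : ℕ) : startDeficit d n + 2 * startTime d n = d * n := by
  have : 2 * startTime d n ≤ d * n := by unfold startTime; omega
  unfold startDeficit
  omega

theorem eventually_exp_le_startDeficit {d : ℕ} (hd : 2 ≤ d) :
    ∀ᶠ n : ℕ in atTop, Real.exp √(Real.log n) ≤ startDeficit d n := by
  filter_upwards [eventually_ceil_le hd] with n h
  have h1 : ⌈Real.exp √(Real.log n)⌉₊ ≤ startDeficit d n := by
    unfold startDeficit startTime; omega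
  exact (Nat.le_ceil _).trans (by exact_mod_cast h1)

theorem eventually_startDeficit_le {d : ℕ} (hd : 2 ≤ d) :
    ∀ᶠ n : ℕ in atTop, (startDeficit d n : ℝ) ≤ Real.exp √(Real.log n) + 2 := by
  filter_upwards [eventually_ceil_le hd] with n h
  have h1 : startDeficit d n ≤ ⌈Real.exp √(Real.log n)⌉₊ + 1 := by
    unfold startDeficit startTime; omega
  have h2 : (startDeficit d n : ℝ) ≤ (⌈Real.exp √(Real.log n)⌉₊ : ℝ) + 1 := by exact_mod_cast h1
  have h3 := Nat.ceil_lt_add_one (Real.exp_pos √(Real.log n)).le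
  linarith

theorem startDeficit_eq_cast (d n : ℕ) :
    ((d * n : ℕ) : ℝ) - 2 * (startTime d n : ℝ) = startDeficit d n := by
  rw [← startDeficit_add d n]; push_cast; ring

/-- This is the reason for starting at `exp √(log n)`: its logarithm is negligible against `b = log
n`, while it still exceeds all powers of `b`. -/
theorem eventually_log_startDeficit_le {d : ℕ} (hd : 2 ≤ d) {ε : ℝ} (hε : 0 < ε) :
    ∀ᶠ n : ℕ in atTop, Real.log (startDeficit d n) ≤ ε * Real.log n := by
  filter_upwards [eventually_startDeficit_le hd, eventually_exp_le_startDeficit hd,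
    tendsto_sqrt_log.eventually (eventually_ge_atTop (3 / ε)), eventually_one_le_log]
    with n h1 h2 h3 h4
  set y := √(Real.log n) with hy
  have hyy : y ^ 2 = Real.log n := Real.sq_sqrt (by linarith)
  have hy1 : 1 ≤ y := Real.one_le_sqrt.mpr h4
  have h5 : (startDeficit d n : ℝ) ≤ Real.exp (y + 2) := by
    rw [Real.exp_add]
    nlinarith [Real.add_one_le_exp (2 : ℝ), Real.one_le_exp (show (0 : ℝ) ≤ y by linarith)]
  have h6 := Real.log_le_log (lt_of_lt_of_le (Real.exp_pos y) h2) h5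
  rw [Real.log_exp] at h6
  rw [div_le_iff₀ hε] at h3
  rw [← hyy]
  nlinarith

theorem exists_eventually_weight_le {d : ℕ} (hd : 2 ≤ d) (m : ℕ) :
    ∃ C : ℝ, 0 ≤ C ∧ ∀ᶠ n : ℕ in atTop, ∀ s, startTime d n ≤ s → d * d + 2 * s + 2 ≤ d * n →
      Real.log n ^ (m * (d - 1)) *
        expect d s (sumCutWeight (V := Fin n) d m (Real.log n)) ≤
        C * (((d * n : ℕ) : ℝ) - 2 * s) ^ m := by
  obtain ⟨C, hC, h⟩ := exists_eventually_start_weight_le (show 1 ≤ d by omega)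
    (Eventually.of_forall fun n => startDeficit_add d n) (eventually_exp_le_startDeficit hd)
    (eventually_startDeficit_le hd) m
  refine ⟨Real.exp (2 ^ m * (2 * m * (d + m) * d ^ 2)) * C, by positivity, ?_⟩
  filter_upwards [h, eventually_one_le_log, eventually_log_startDeficit_le hd one_pos,
    eventually_exp_le_startDeficit hd] with n h hb hlog hD s hs hs1
  have h1 := expect_sumCutWeight_le (V := Fin n) (d := d) (m := m) hb hs
    (by rw [Fintype.card_fin]; exact hs1)
    (by rw [Fintype.card_fin, startDeficit_eq_cast]; linarith)
  rw [Fintype.card_fin, startDeficit_eq_cast] at h1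
  have hD0 : (0 : ℝ) < startDeficit d n := lt_of_lt_of_le (Real.exp_pos _) hD
  have hDs : (0 : ℝ) < ((d * n : ℕ) : ℝ) - 2 * s := by
    have : 2 * (s : ℝ) + 2 ≤ ((d * n : ℕ) : ℝ) := by exact_mod_cast (by omega : 2 * s + 2 ≤ d * n)
    linarith
  rw [div_le_iff₀ (by positivity)] at h1
  have h2 : Real.log n ^ (m * (d - 1)) * (expect d (startTime d n)
      (sumCutWeight (V := Fin n) d m (Real.log n)) / (startDeficit d n : ℝ) ^ m) ≤ C := by
    rw [← mul_div_assoc, div_le_iff₀ (by positivity)]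
    exact h
  have h3 : 0 ≤ Real.log n ^ (m * (d - 1)) := by positivity
  calc _ ≤ Real.log n ^ (m * (d - 1)) * _ := mul_le_mul_of_nonneg_left h1 h3
    _ = Real.exp (2 ^ m * (2 * m * (d + m) * d ^ 2)) * (Real.log n ^ (m * (d - 1)) *
        (expect d (startTime d n) (sumCutWeight (V := Fin n) d m (Real.log n)) /
          (startDeficit d n : ℝ) ^ m)) * (((d * n : ℕ) : ℝ) - 2 * s) ^ m := by ring
    _ ≤ _ := by gcongr

theorem exists_deficit {d k : ℕ} (B : ℝ) : ∃ K : ℕ, d ≤ K ∧ B ≤ K ∧ K % 2 = k % 2 := by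
  refine ⟨2 * (d + ⌈B⌉₊) + k % 2, by omega, ?_, by omega⟩
  refine (Nat.le_ceil B).trans ?_
  exact_mod_cast (by omega : ⌈B⌉₊ ≤ 2 * (d + ⌈B⌉₊) + k % 2)

/-- Passing from `N / (K - k + 1)` to `N / K` costs the relative error `(k - 1) / (K - k + 1)`, at
most `2 / (K - 2)` for both values of `k`. -/
theorem abs_mul_sub_le {P N L κ δ r : ℝ} {K k : ℕ} (hkK : k < K) (hk : k = 2 ∨ k = 3)
    (hκ : |N / K * L - κ| ≤ δ) (hr : |P - N / ((K : ℝ) - k + 1)| * L ≤ r) (hL : 0 ≤ L)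
    (hδ : δ ≤ 1) (hκ0 : 0 ≤ κ) :
    |P * L - κ| ≤ r + δ + (κ + 1) * (2 / ((K : ℝ) - 2)) := by
  have hK : (k : ℝ) + 1 ≤ K := by exact_mod_cast hkK
  have hk2 : (2 : ℝ) ≤ k := by rcases hk with rfl | rfl <;> norm_num
  have hk3 : (k : ℝ) ≤ 3 := by rcases hk with rfl | rfl <;> norm_num
  have hK0 : (0 : ℝ) < K := by linarith
  have h1 : P * L - κ = (P - N / ((K : ℝ) - k + 1)) * L + (N / K * L - κ) +
      N / K * L * ((k - 1) / ((K : ℝ) - k + 1)) := by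
    have : (K : ℝ) - k + 1 ≠ 0 := by linarith
    field_simp
    ring
  have h2 : |N / K * L| ≤ κ + 1 := by
    have := abs_le.mp hκ
    rw [abs_le]
    constructor <;> linarith
  have h3 : |((k : ℝ) - 1) / ((K : ℝ) - k + 1)| ≤ 2 / ((K : ℝ) - 2) := by
    rw [abs_of_nonneg (div_nonneg (by linarith) (by linarith)),
      div_le_div_iff₀ (by linarith) (by linarith)]
    nlinarith
  rw [h1]
  refine (abs_add_three _ _ _).trans ?_
  rw [abs_mul, abs_mul (N / K * L), abs_of_nonneg hL]
  have := mul_le_mul h2 h3 (abs_nonneg _) (by linarith)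
  linarith

theorem eventually_probNotSaturated_near {d k : ℕ} (hd : 2 ≤ d) (hk : k = 2 ∨ k = 3)
    (hkd : k ≤ d) {δ : ℝ} (hδ : 0 < δ) :
    ∀ᶠ n : ℕ in atTop, (d * n) % 2 = k % 2 →
      |probNotSaturated n d * Real.log n ^ (k - 1) -
        ((d - 1).factorial : ℝ) / (d - k).factorial| ≤ δ := by
  set κ : ℝ := ((d - 1).factorial : ℝ) / (d - k).factorial with hκdef
  have hκ0 : 0 ≤ κ := by positivity
  choose C hC0 hC using fun m => exists_eventually_weight_le hd m
  set A : ℝ := 12 * d ^ 3 * max (C 1) (C 2) with hA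
  have hA0 : 0 ≤ A := by have := hC0 1; positivity
  set ε : ℝ := min (δ / 5) (1 / 3) with hε
  have hε0 : 0 < ε := by positivity
  -- The final error is `ε` from the end stage, `3 * ε` from the density at `D = K` and `ε` from the
  -- finite size of `K`. The bound `1 / 3` ensures `3 * ε ≤ 1`, as `abs_mul_sub_le` requires.
  have hε1 : ε ≤ δ / 5 := min_le_left _ _
  have hε2 : ε ≤ 1 / 3 := min_le_right _ _
  -- `K` is fixed before `n` and has the parity of `k`, so that it is a possible deficit; it makes
  -- the drift error `A / K` and the correction `(κ + 1) * 2 / (K - 2)` at most `ε`. The constant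
  -- `B` depends on `K`, and only `n` has to be large against it.
  obtain ⟨K, hK1, hK2, hKpar⟩ := exists_deficit (d := 2 * (d * d) + 2 + 5) (k := k)
    (max (A / ε) (2 + (κ + 1) * 2 / ε))
  set B : ℝ := (1 + K) * ∑ m ∈ Finset.range (K + 1), C m * (K : ℝ) ^ m with hB
  have hKpos : (5 : ℝ) ≤ K := by exact_mod_cast (by omega : 5 ≤ K)
  have hAK : A / K ≤ ε := by
    have := (div_le_iff₀ hε0).mp ((le_max_left _ _).trans hK2)
    rw [div_le_iff₀ (by linarith)]
    linarith
  have hκK : (κ + 1) * (2 / ((K : ℝ) - 2)) ≤ ε := by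
    have h1 := (le_max_right (A / ε) (2 + (κ + 1) * 2 / ε)).trans hK2
    have h2 : (κ + 1) * 2 / ε ≤ K - 2 := by linarith
    rw [div_le_iff₀ hε0] at h2
    rw [← mul_div_assoc, div_le_iff₀ (by linarith)]
    linarith
  have hall : ∀ᶠ n : ℕ in atTop, ∀ m ∈ Finset.range (K + 1), ∀ s, startTime d n ≤ s →
      d * d + 2 * s + 2 ≤ d * n → Real.log n ^ (m * (d - 1)) *
        expect d s (sumCutWeight (V := Fin n) d m (Real.log n)) ≤
        C m * (((d * n : ℕ) : ℝ) - 2 * s) ^ m :=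
    (Filter.eventually_all_finset _).mpr fun m _ => hC m
  have hε3 : 0 < ε / (A + 1) := by positivity
  filter_upwards [hall, eventually_one_le_log, eventually_log_startDeficit_le hd hε3,
    eventually_start_density_near (show 1 ≤ k by omega) hkd
      (Eventually.of_forall fun n => startDeficit_add d n) (eventually_exp_le_startDeficit hd)
      (eventually_startDeficit_le hd) hε0,
    eventually_le_of_exp_sqrt_log_le (eventually_exp_le_startDeficit hd) K,
    (Real.tendsto_log_atTop.comp tendsto_natCast_atTop_atTop).eventually
      (eventually_ge_atTop (B / ε))]
    with n hall hb hlog hstart hDK hbig hpar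
  simp only [Function.comp_apply] at hbig
  set b := Real.log n with hbdef
  have hDK' : K ≤ startDeficit d n := by exact_mod_cast hDK
  have hadd := startDeficit_add d n
  obtain ⟨s, hs⟩ : ∃ s, K + 2 * s = d * n := ⟨(d * n - K) / 2, by omega⟩
  have hss : startTime d n ≤ s := by omega
  have hcast : ((d * n : ℕ) : ℝ) - 2 * s = K := by rw [← hs]; push_cast; ring
  have hcw : ∀ m ∈ Finset.range (K + 1), m = 1 ∨ m = 2 → ∀ s', startTime d n ≤ s' → s' ≤ s →
      b ^ (m * (d - 1)) * expect d s' (sumCutWeight (V := Fin n) d m b) ≤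
        max (C 1) (C 2) * (((d * n : ℕ) : ℝ) - 2 * s') ^ m := by
    intro m hm hm' s' h1 h2
    refine (hall m hm s' h1 (by omega)).trans ?_
    have h3 : 0 ≤ ((d * n : ℕ) : ℝ) - 2 * s' := by
      have : 2 * (s' : ℝ) ≤ ((d * n : ℕ) : ℝ) := by exact_mod_cast (by omega : 2 * s' ≤ d * n)
      linarith
    refine mul_le_mul_of_nonneg_right ?_ (by positivity)
    rcases hm' with rfl | rfl
    · exact le_max_left _ _
    · exact le_max_right _ _
  have hdens := abs_density_sub_le (V := Fin n) (d := d) (k := k) (K := max (C 1) (C 2)) (b := b)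
    (by omega) (by omega) hb hss (by rw [Fintype.card_fin]; omega)
    (fun s' h1 h2 => by
      have := hcw 1 (Finset.mem_range.mpr (by omega)) (Or.inl rfl) s' h1 h2
      rw [Fintype.card_fin]
      simpa only [pow_one] using this)
    (fun s' h1 h2 => by
      have := hcw 2 (Finset.mem_range.mpr (by omega)) (Or.inr rfl) s' h1 h2
      rw [Fintype.card_fin]
      exact this)
  rw [Fintype.card_fin, hcast, startDeficit_eq_cast] at hdens
  have hfail := abs_expect_failure_sub_le (V := Fin n) (d := d) (k := k) (s := s) (D := K) hb hk
    (by rw [Fintype.card_fin]; exact hs) (by nlinarith) hKpar (by omega)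
  rw [Fintype.card_fin] at hfail
  have hP : expect d (d * n / 2) (failure (V := Fin n) d) = probNotSaturated n d :=
    (probNotSaturated_eq n d).symm
  rw [hP] at hfail
  have hfail2 : |probNotSaturated n d - expect d s
      (fun G : SimpleGraph (Fin n) => ((deficient d k G).card : ℝ)) / ((K : ℝ) - k + 1)| *
        b ^ (k - 1) ≤ ε := by
    have h1 : (1 + (K : ℝ)) * ∑ m ∈ Finset.range (K + 1), b ^ (m * (d - 1)) *
        expect d s (sumCutWeight (V := Fin n) d m b) ≤ B := by
      refine mul_le_mul_of_nonneg_left (Finset.sum_le_sum fun m hm => ?_) (by positivity)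
      rw [← hcast]
      exact hall m hm s hss (by omega)
    have h2 := hfail.trans h1
    rw [show b ^ k = b ^ (k - 1) * b by rw [← pow_succ]; congr 1; omega, ← mul_assoc] at h2
    have hb0 : 0 < b := by linarith
    rw [div_le_iff₀ hε0] at hbig
    refine le_of_mul_le_mul_right (h2.trans ?_) hb0
    linarith
  have hnear : |expect d s (fun G : SimpleGraph (Fin n) => ((deficient d k G).card : ℝ)) / K *
      b ^ (k - 1) - κ| ≤ 3 * ε := by
    have h1 : 12 * (d : ℝ) ^ 3 * max (C 1) (C 2) *
        (1 / K + Real.log (startDeficit d n) / b) ≤ 2 * ε := by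
      have h2 : Real.log (startDeficit d n) / b ≤ ε / (A + 1) := by
        rw [div_le_iff₀ (by linarith)]; exact hlog
      have h3 : A * (ε / (A + 1)) ≤ ε := by
        rw [← mul_div_assoc, div_le_iff₀ (by linarith)]; nlinarith
      have h4 : A * (1 / K) ≤ ε := by rw [mul_one_div]; exact hAK
      rw [← hA, mul_add]
      nlinarith
    have h5 : (0 : ℝ) ≤ b ^ (k - 1) := by positivity
    rw [← abs_of_nonneg h5, ← abs_mul, sub_mul] at hdens
    calc _ = |(expect d s (fun G : SimpleGraph (Fin n) => ((deficient d k G).card : ℝ)) / K *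
          b ^ (k - 1) - expect d (startTime d n)
            (fun G : SimpleGraph (Fin n) => ((deficient d k G).card : ℝ)) / startDeficit d n *
          b ^ (k - 1)) + (expect d (startTime d n)
            (fun G : SimpleGraph (Fin n) => ((deficient d k G).card : ℝ)) / startDeficit d n *
          b ^ (k - 1) - κ)| := by congr 1; ring
      _ ≤ 3 * ε := by
        refine (abs_add_le _ _).trans ?_
        linarith
  have := abs_mul_sub_le (by omega) hk hnear hfail2 (by positivity) (by linarith) hκ0
  linarith

/-! ### The constants for the two parities and the main theorem -/

theorem factorial_div_factorial_sub_two {d : ℕ} (hd : 2 ≤ d) :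
    ((d - 1).factorial : ℝ) / (d - 2).factorial = (d : ℝ) - 1 := by
  obtain ⟨e, rfl⟩ := Nat.exists_eq_add_of_le' hd
  have h : ((e.factorial : ℕ) : ℝ) ≠ 0 := by positivity
  simp only [show e + 2 - 1 = e + 1 by omega, Nat.add_sub_cancel, Nat.factorial_succ]
  push_cast
  field_simp
  ring

theorem factorial_div_factorial_sub_three {d : ℕ} (hd : 3 ≤ d) :
    ((d - 1).factorial : ℝ) / (d - 3).factorial = ((d : ℝ) - 1) * ((d : ℝ) - 2) := by
  obtain ⟨e, rfl⟩ := Nat.exists_eq_add_of_le' hd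
  have h : ((e.factorial : ℕ) : ℝ) ≠ 0 := by positivity
  simp only [show e + 3 - 1 = e + 1 + 1 by omega, Nat.add_sub_cancel, Nat.factorial_succ]
  push_cast
  field_simp
  ring

theorem abs_sub_div_le {P κ c L : ℝ} (hL : 0 < L) (hκ : 0 ≤ κ) (h : |P * L - κ| ≤ c * κ) :
    ‖P - κ / L‖ ≤ c * ‖κ / L‖ := by
  rw [Real.norm_eq_abs, Real.norm_eq_abs, abs_of_nonneg (div_nonneg hκ hL.le), ← mul_div_assoc,
    le_div_iff₀ hL]
  refine le_trans (le_of_eq ?_) h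
  rw [← abs_of_pos hL, ← abs_mul, abs_of_pos hL, sub_mul, div_mul_cancel₀ _ hL.ne']

end DegreeBounded
end

theorem theorem1p2 (d : ℕ) (hd : 2 ≤ d) :
    (fun n : ℕ => probNotSaturated n d) ~[atTop] fun n : ℕ =>
      if Even (d * n) then ((d : ℝ) - 1) / Real.log n
      else ((d : ℝ) - 1) * ((d : ℝ) - 2) / Real.log n ^ 2 := by
  rw [IsEquivalent, isLittleO_iff]
  intro c hc
  have hd2 : (2 : ℝ) ≤ d := by exact_mod_cast hd
  have heven := DegreeBounded.eventually_probNotSaturated_near hd (Or.inl rfl) hd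
    (δ := c * ((d : ℝ) - 1)) (mul_pos hc (by linarith))
  have hodd : ∀ᶠ n : ℕ in atTop, ¬ Even (d * n) →
      |probNotSaturated n d * Real.log n ^ 2 - ((d : ℝ) - 1) * ((d : ℝ) - 2)| ≤
        c * (((d : ℝ) - 1) * ((d : ℝ) - 2)) := by
    -- For `d = 2` the product `d * n` is never odd; for `d ≥ 3` a vertex can have deficit 3.
    rcases hd.eq_or_lt with rfl | hd3
    · exact Eventually.of_forall fun n h => absurd (even_two_mul n) h
    · have h3 : (3 : ℝ) ≤ d := by exact_mod_cast hd3
      filter_upwards [DegreeBounded.eventually_probNotSaturated_near hd (Or.inr rfl) hd3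
        (δ := c * (((d : ℝ) - 1) * ((d : ℝ) - 2)))
        (mul_pos hc (mul_pos (by linarith) (by linarith)))] with n h hn
      rw [DegreeBounded.factorial_div_factorial_sub_three hd3] at h
      exact h (Nat.odd_iff.mp (Nat.not_even_iff_odd.mp hn))
  filter_upwards [heven, hodd, DegreeBounded.eventually_one_le_log] with n h1 h2 h3
  have hL : 0 < Real.log n := by linarith
  simp only [Pi.sub_apply]
  split_ifs with hn
  · rw [DegreeBounded.factorial_div_factorial_sub_two hd] at h1
    refine DegreeBounded.abs_sub_div_le hL (by linarith) ?_
    simpa only [Nat.add_one_sub_one, pow_one] using h1 (Nat.even_iff.mp hn)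
  · refine DegreeBounded.abs_sub_div_le (pow_pos hL 2) ?_ (h2 hn)
    exact mul_nonneg (by linarith) (by linarith)
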